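/- Let $n,d\ge 1$. Let $\widetilde W$ be the extended affine Weyl group of type $\tilde A_{d-1}$, i.e. the group of permutations $g$ of $\mathbb Z$ with $g(i+d)=g(i)+d$. Put $\pi:t\mapsto t+1$ and let $S=\{s_1,\dots,s_d=s_0\}$ be the simple reflections $s_i=\prod_{k\in\mathbb Z}(kd+i,\,kd+i+1)$ ($S=\emptyset$ if $d=1$). Every $g\in\widetilde W$ is $\pi^z w$ with $z\in\mathbb Z$ and $w\in\langle S\rangle$ unique, and $\ell(g)$ is the length of $w$ with respect to $S$. Let $\mathcal H$ be the extended affine Hecke algebra over $\mathbb Z[v,v^{-1}]$, with basis $T_g$ ($g\in\widetilde W$) and relations $T_wT_{w'}=T_{ww'}$ if $\ell(ww')=\ell(w)+\ell(w')$, and $(T_s+1)(T_s-v^2)=0$ for $s\in S$; its bar involution is the ring homomorphism with $\bar v=v^{-1}$, $\overline{T_g}=T_{g^{-1}}^{-1}$. For a finite set $X\subset\widetilde W$ let $T_X=\sum_{w\in X}T_w$. Let $\Lambda$ be the set of $\lambda\in\mathbb N^n$ with $\sum_i\lambda_i=d$. For $\lambda\in\Lambda$ let $W_\lambda$ be the (finite)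 subgroup generated by $S\setminus\{s_{\lambda_1},s_{\lambda_1+\lambda_2},\dots,s_{\lambda_1+\cdots+\lambda_n}\}$, let $w_\circ^\lambda$ be its longest element, let $x_\lambda=T_{W_\lambda}$, and let $R_i^\lambda=(\lambda_1+\cdots+\lambda_{i-1}\,..\,\lambda_1+\cdots+\lambda_i]$ for $1\le i\le n$, extended to $i\in\mathbb Z$ by $R^\lambda_{i+n}=R^\lambda_i+d$. The affine $q$-Schur algebra is $\mathbf S=\mathrm{End}_{\mathcal H}\big(\bigoplus_{\lambda\in\Lambda}x_\lambda\mathcal H\big)$ (right $\mathcal H$-modules). Its bar involution sends $f\in\mathrm{Hom}_{\mathcal H}(x_\mu\mathcal H,x_\lambda\mathcal H)$ to the map $\bar f$ with $\bar f(x_\mu h)=v^{2\ell(w_\circ^\mu)}\,\overline{f(x_\mu)}\,h$ for $h\in\mathcal H$. Let $\Theta_d$ be the set of $\mathbb Z\times\mathbb Z$ matrices $A=(a_{ij})$ over $\mathbb N$ with $a_{i+n,j+n}=a_{ij}$ and $\sum_{i=1}^n\sum_{j\in\mathbb Z}a_{ij}=d$. Each $A\in\Theta_d$ is given by $a_{ij}=|R_i^\lambda\cap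 gR_j^\mu|$ for a unique triple $(\lambda,g,\mu)$, where $\lambda,\mu\in\Lambda$ and $g$ is the shortest element of $W_\lambda gW_\mu$. Let $e_A\in\mathbf S$ be the right $\mathcal H$-linear map $x_\mu\mathcal H\to x_\lambda\mathcal H$ with $x_\mu\mapsto T_{W_\lambda gW_\mu}$ (zero on the other summands), and let $[A]=v^{-d_A}e_A$ with $d_A=\sum_{1\le i\le n,\,j\in\mathbb Z}\ \sum_{x\le i,\,y>j}a_{ij}a_{xy}$. For $A\in\Theta_d$ define bidiagonal matrices $B^{(1)},\dots,B^{(x)},B_{(1)},\dots,B_{(y)}\in\Theta_d$ as follows. Start with $U=A$. As long as $U=(u_{ij})$ is not lower triangular, let $k>0$ be the largest integer such that the diagonal $j-i=k$ of $U$ is nonzero. The next $B^{(\cdot)}$ is the matrix with entries $u_{i,i+k}$ at $(i,i+1)$ ($i\in\mathbb Z$), with diagonal entries such that its row sums are those of $U$, and zero elsewhere; then $U$ is replaced by the matrix obtained by moving each entry of the diagonal $j-i=k$ down by one row and adding it to the entry there. When $U$ has become lower triangular, put $L=U$. As long as $L=(l_{ij})$ is not lower bidiagonal, let $k>1$ be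 the largest integer such that the diagonal $i-j=k$ of $L$ is nonzero. The next $B_{(\cdot)}$ is the matrix with entries $l_{i,i-k}$ at $(i,i-1)$, with diagonal entries such that its row sums are those of $L$, and zero elsewhere; then $L$ is replaced by the matrix obtained by moving each entry of the diagonal $i-j=k$ up by one row and adding it to the entry there. When $L$ is lower bidiagonal, the last matrix is $B_{(y)}=L$. (The column sums of each of these matrices are then the row sums of the next one.) Put $$m_A=[B^{(1)}]\cdots[B^{(x)}]\,[B_{(1)}]\cdots[B_{(y)}]\in\mathbf S.$$ Then $\{m_A\mid A\in\Theta_d\}$ is a basis of $\mathbf S$ over $\mathbb Z[v,v^{-1}]$ (the family being indexed without repetition by $\Theta_d$), and $\overline{m_A}=m_A$ for every $A\in\Theta_d$. -/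

import Mathlib

namespace AffineSchur

/-! ### The extended affine Weyl group -/

/-- The extended affine Weyl group of type `Ã_{d-1}`, as the group of all permutations `g` of `ℤ`
with `g (i + d) = g i + d`. -/
def extWeyl (d : ℕ) : Subgroup (Equiv.Perm ℤ) where
  carrier := {g | ∀ i : ℤ, g (i + d) = g i + d}
  mul_mem' := by
    intro a b ha hb i
    simp only [Set.mem_ofPred_eq] at ha hb
    simp [hb i, ha]
  one_mem' := by intro i; simp
  inv_mem' := by
    intro a ha i
    simp only [Set.mem_ofPred_eq] at ha
    rw [Equiv.Perm.inv_eq_iff_eq, ha]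
    simp

abbrev ExtWeyl (d : ℕ) : Type := extWeyl d

theorem extWeyl_apply_add {d : ℕ} (g : ExtWeyl d) (i : ℤ) :
    (g : Equiv.Perm ℤ) (i + d) = (g : Equiv.Perm ℤ) i + d := g.2 i

/-- The element `π : t ↦ t + 1`. -/
def rot (d : ℕ) : ExtWeyl d :=
  ⟨Equiv.addRight 1, by intro i; simp; ring⟩

/-- The map `∏_k (kd + i, kd + i + 1)` on `ℤ`; for `d = 1`, where there is no simple reflection,
it is the identity. -/
def simpleFun (d : ℕ) (i t : ℤ) : ℤ :=
  if d = 1 then t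
  else if (d : ℤ) ∣ t - i then t + 1
  else if (d : ℤ) ∣ t - (i + 1) then t - 1
  else t

theorem simpleFun_involutive (d : ℕ) (i : ℤ) : Function.Involutive (simpleFun d i) := by
  intro t
  unfold simpleFun
  by_cases h1 : d = 1
  · simp [h1]
  · have hd : ¬ (d : ℤ) ∣ 1 := by
      intro h
      exact h1 (Nat.dvd_one.mp (by exact_mod_cast h))
    simp only [h1, if_false]
    by_cases h2 : (d : ℤ) ∣ t - i
    · have h3 : ¬ (d : ℤ) ∣ t + 1 - i := fun h => hd (by
        have := dvd_sub h h2
        ring_nf at this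
        exact this)
      simp [h2, h3]
    · by_cases h3 : (d : ℤ) ∣ t - (i + 1)
      · have h4 : (d : ℤ) ∣ t - 1 - i := by
          have e : t - 1 - i = t - (i + 1) := by ring
          rw [e]; exact h3
        rw [if_neg h2, if_pos h3, if_pos h4]; ring
      · simp [h2, h3]

/-- The simple reflection `s_i`, for `i` modulo `d`; in particular `s_0 = s_d`. -/
def simple (d : ℕ) (i : ℤ) : ExtWeyl d :=
  ⟨(simpleFun_involutive d i).toPerm, by
    intro t
    have e : ∀ a : ℤ, (d : ℤ) ∣ t + d - a ↔ (d : ℤ) ∣ t - a := by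
      intro a
      have : t + d - a = (t - a) + d := by ring
      rw [this]
      exact dvd_add_self_right
    simp only [Function.Involutive.coe_toPerm, simpleFun, e]
    split_ifs <;> ring⟩

/-- The set `S` of simple reflections; it is empty for `d = 1`. -/
def simples (d : ℕ) : Set (ExtWeyl d) := {g | 2 ≤ d ∧ ∃ i : ℤ, g = simple d i}

/-- The length of `g = π ^ z * w`, with `w` in the affine Weyl group generated by `S`: the least
number of factors in an expression of `w` as a product of simple reflections. -/
noncomputable def len {d : ℕ} (g : ExtWeyl d) : ℕ :=
  sInf {k | ∃ (z : ℤ) (l : List (ExtWeyl d)),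
    (∀ s ∈ l, s ∈ simples d) ∧ l.length = k ∧ g = rot d ^ z * l.prod}

/-! ### Compositions and parabolic subgroups -/

/-- Weak compositions `(l_1, …, l_n)` of `d`; the part `l_k` is the value at `k - 1 : Fin n`. -/
abbrev Comp (n d : ℕ) : Type := {l : Fin n → ℕ // ∑ k, l k = d}

/-- The parabolic subgroup `W_l`, generated by the simple reflections other than
`s_{l_1}, s_{l_1 + l_2}, …, s_{l_1 + ⋯ + l_n} = s_d = s_0`. -/
def parabolic {n d : ℕ} (l : Comp n d) : Subgroup (ExtWeyl d) :=
  Subgroup.closure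
    (simples d \ Set.range fun k : Fin n => simple d ((∑ j ∈ Finset.Iic k, l.1 j : ℕ) : ℤ))

/-- The shortest representatives of the right cosets `W_l w`. -/
def distinguished {n d : ℕ} (l : Comp n d) : Set (ExtWeyl d) :=
  {w | ∀ g ∈ parabolic l, len (g * w) = len g + len w}

/-- The shortest representatives of the double cosets `W_l g W_m`. -/
def distinguishedDouble {n d : ℕ} (l m : Comp n d) : Set (ExtWeyl d) :=
  {g | g ∈ distinguished l ∧ g⁻¹ ∈ distinguished m}

/-- The double coset `W_l g W_m`. -/
def doubleCoset {n d : ℕ} (l : Comp n d) (g : ExtWeyl d) (m : Comp n d) : Set (ExtWeyl d) :=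
  {w | ∃ x ∈ parabolic l, ∃ y ∈ parabolic m, w = x * g * y}

/-- The length of the longest element of the finite group `W_l`. -/
noncomputable def longestLen {n d : ℕ} (l : Comp n d) : ℕ :=
  sSup (len '' (parabolic l : Set (ExtWeyl d)))

/-! ### The extended affine Hecke algebra -/

/-- The ring `ℤ[v, v⁻¹]`. -/
abbrev Coeff : Type := LaurentPolynomial ℤ

/-- `v ^ k`. -/
noncomputable def vpow (k : ℤ) : Coeff := LaurentPolynomial.T k

inductive HeckeRel (d : ℕ) :
    FreeAlgebra Coeff (ExtWeyl d) → FreeAlgebra Coeff (ExtWeyl d) → Prop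
  | one : HeckeRel d (FreeAlgebra.ι Coeff 1) 1
  | mul (w w' : ExtWeyl d) (h : len w + len w' = len (w * w')) :
      HeckeRel d (FreeAlgebra.ι Coeff w * FreeAlgebra.ι Coeff w') (FreeAlgebra.ι Coeff (w * w'))
  | quad (s : ExtWeyl d) (hs : s ∈ simples d) :
      HeckeRel d ((FreeAlgebra.ι Coeff s + 1) *
        (FreeAlgebra.ι Coeff s - algebraMap Coeff _ (vpow 2))) 0

/-- The extended affine Hecke algebra over `ℤ[v, v⁻¹]`: generators `T_g`, and relations `T_1 = 1`,
`T_w T_w' = T_{ww'}` if lengths add, `(T_s + 1) (T_s - v ^ 2) = 0` for `s ∈ S`. -/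
def Hecke (d : ℕ) : Type := RingQuot (HeckeRel d)

noncomputable instance (d : ℕ) : Ring (Hecke d) := inferInstanceAs (Ring (RingQuot (HeckeRel d)))

noncomputable instance (d : ℕ) : Algebra Coeff (Hecke d) :=
  inferInstanceAs (Algebra Coeff (RingQuot (HeckeRel d)))

/-- The element `T_g`. -/
noncomputable def heckeT {d : ℕ} (g : ExtWeyl d) : Hecke d :=
  RingQuot.mkAlgHom Coeff (HeckeRel d) (FreeAlgebra.ι Coeff g)

/-- `T_X = ∑_{w ∈ X} T_w` for a finite set `X`. -/
noncomputable def heckeSum {d : ℕ} (X : Set (ExtWeyl d)) : Hecke d := ∑ᶠ w ∈ X, heckeT w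

/-- The element `x_l`. -/
noncomputable def xElt {n d : ℕ} (l : Comp n d) : Hecke d :=
  heckeSum (parabolic l : Set (ExtWeyl d))

/-! ### The bar involution of the Hecke algebra -/

theorem sum_window_succ {M : Type*} [AddCommMonoid M] (d : ℕ) (f : ℤ → M)
    (hf : ∀ i, f (i + d) = f i) (a : ℤ) :
    ∑ j ∈ Finset.range d, f (a + 1 + j) = ∑ j ∈ Finset.range d, f (a + j) := by
  cases d with
  | zero => simp
  | succ d =>
    rw [Finset.sum_range_succ, Finset.sum_range_succ']
    congr 1
    · apply Finset.sum_congr rfl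
      intro j _
      congr 1
      push_cast
      ring
    · have := hf a
      push_cast at this ⊢
      rw [add_zero, ← this]
      congr 1
      ring

theorem sum_window {M : Type*} [AddCommMonoid M] (d : ℕ) (f : ℤ → M)
    (hf : ∀ i, f (i + d) = f i) (a : ℤ) :
    ∑ j ∈ Finset.range d, f (a + j) = ∑ j ∈ Finset.range d, f (0 + j) := by
  induction a using Int.induction_on with
  | zero => rfl
  | succ i ih => rw [sum_window_succ d f hf, ih]
  | pred i ih => rw [← ih, ← sum_window_succ d f hf (-(i : ℤ) - 1), sub_add_cancel]

theorem rot_zpow_apply (d : ℕ) (z t : ℤ) : ((rot d ^ z : ExtWeyl d) : Equiv.Perm ℤ) t = t + z := by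
  simp [rot]

theorem simple_apply {d : ℕ} (hd : 2 ≤ d) (i t : ℤ) :
    (simple d i : Equiv.Perm ℤ) t =
      if (d : ℤ) ∣ t - i then t + 1 else if (d : ℤ) ∣ t - (i + 1) then t - 1 else t := by
  have h : d ≠ 1 := by omega
  simp [simple, simpleFun, h]

theorem simple_apply_self {d : ℕ} (hd : 2 ≤ d) (i : ℤ) :
    (simple d i : Equiv.Perm ℤ) i = i + 1 := by
  simp [simple_apply hd]

theorem simple_apply_succ {d : ℕ} (hd : 2 ≤ d) (i : ℤ) :
    (simple d i : Equiv.Perm ℤ) (i + 1) = i := by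
  have h : ¬ (d : ℤ) ∣ i + 1 - i := by
    intro h
    have h' : (d : ℤ) ∣ 1 := by simpa using h
    have := Int.le_of_dvd one_pos h'
    omega
  rw [simple_apply hd, if_neg h, if_pos (by simp)]
  ring

theorem simple_mul_self {d : ℕ} (i : ℤ) : simple d i * simple d i = 1 := by
  ext t
  simp [simple, simpleFun_involutive d i t]

theorem rot_zpow_mul_simple (d : ℕ) (z i : ℤ) :
    rot d ^ z * simple d i = simple d (i + z) * rot d ^ z := by
  ext t
  simp only [Subgroup.coe_mul, Equiv.Perm.mul_apply, rot_zpow_apply]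
  simp only [simple, simpleFun, Function.Involutive.coe_toPerm]
  have e1 : t + z - (i + z) = t - i := by ring
  have e2 : t + z - (i + z + 1) = t - (i + 1) := by ring
  rw [e1, e2]
  split_ifs <;> ring

/-- Used only as a decreasing measure. -/
def displacement {d : ℕ} (g : ExtWeyl d) (a : ℤ) : ℤ :=
  ∑ j ∈ Finset.range d, ((g : Equiv.Perm ℤ) (a + j) - (a + j)) ^ 2

theorem displacement_eq {d : ℕ} (g : ExtWeyl d) (a : ℤ) :
    displacement g a = displacement g 0 :=
  sum_window d (fun t => ((g : Equiv.Perm ℤ) t - t) ^ 2)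
    (by intro i; simp only [extWeyl_apply_add]; ring) a

theorem displacement_lt {d : ℕ} (hd : 2 ≤ d) (g : ExtWeyl d) (i : ℤ)
    (h : (g : Equiv.Perm ℤ) (i + 1) < (g : Equiv.Perm ℤ) i) :
    displacement (g * simple d i) 0 < displacement g 0 := by
  rw [← displacement_eq _ i, ← displacement_eq g i]
  obtain ⟨e, rfl⟩ : ∃ e, d = e + 2 := ⟨d - 2, by omega⟩
  unfold displacement
  rw [Finset.sum_range_succ', Finset.sum_range_succ', Finset.sum_range_succ',
    Finset.sum_range_succ']
  have hrest : ∀ j ∈ Finset.range e,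
      (((g * simple (e + 2) i : ExtWeyl (e + 2)) : Equiv.Perm ℤ) (i + ((j + 1 + 1 : ℕ) : ℤ))
        - (i + ((j + 1 + 1 : ℕ) : ℤ))) ^ 2 =
      ((g : Equiv.Perm ℤ) (i + ((j + 1 + 1 : ℕ) : ℤ)) - (i + ((j + 1 + 1 : ℕ) : ℤ))) ^ 2 := by
    intro j hj
    rw [Finset.mem_range] at hj
    have h1 : ¬ ((e + 2 : ℕ) : ℤ) ∣ i + ((j + 1 + 1 : ℕ) : ℤ) - i := by
      intro h
      have := Int.le_of_dvd (by push_cast; omega) h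
      push_cast at this
      omega
    have h2 : ¬ ((e + 2 : ℕ) : ℤ) ∣ i + ((j + 1 + 1 : ℕ) : ℤ) - (i + 1) := by
      intro h
      have := Int.le_of_dvd (by push_cast; omega) h
      push_cast at this
      omega
    rw [Subgroup.coe_mul, Equiv.Perm.mul_apply, simple_apply hd, if_neg h1, if_neg h2]
  rw [Finset.sum_congr rfl hrest]
  have h0 : i + ((0 : ℕ) : ℤ) = i := by simp
  have h1 : i + ((0 + 1 : ℕ) : ℤ) = i + 1 := by simp
  simp only [h0, h1, Subgroup.coe_mul, Equiv.Perm.mul_apply, simple_apply_self hd,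
    simple_apply_succ hd]
  nlinarith

theorem exists_word {d : ℕ} [NeZero d] (g : ExtWeyl d) :
    ∃ (z : ℤ) (l : List (ExtWeyl d)), (∀ s ∈ l, s ∈ simples d) ∧ g = rot d ^ z * l.prod := by
  by_cases hg : ∃ i : ℤ, (g : Equiv.Perm ℤ) (i + 1) < (g : Equiv.Perm ℤ) i
  · obtain ⟨i, hi⟩ := hg
    have hd : 2 ≤ d := by
      have h0 := NeZero.ne d
      by_contra h
      have h1 : d = 1 := by omega
      subst h1
      have := extWeyl_apply_add g i
      push_cast at this
      omega
    have hlt : (displacement (g * simple d i) 0).toNat < (displacement g 0).toNat := by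
      have h1 := displacement_lt hd g i hi
      have h2 : 0 ≤ displacement (g * simple d i) 0 := Finset.sum_nonneg fun _ _ => sq_nonneg _
      omega
    obtain ⟨z, l, hl, e⟩ := exists_word (g * simple d i)
    refine ⟨z, l ++ [simple d i], ?_, ?_⟩
    · intro s hs
      rcases List.mem_append.mp hs with hs | hs
      · exact hl s hs
      · rw [List.mem_singleton] at hs
        exact ⟨hd, i, hs⟩
    · rw [List.prod_append, List.prod_singleton, ← mul_assoc, ← e, mul_assoc, simple_mul_self,
        mul_one]
  · push Not at hg
    have hlt : ∀ i : ℤ, (g : Equiv.Perm ℤ) i < (g : Equiv.Perm ℤ) (i + 1) := by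
      intro i
      refine lt_of_le_of_ne (hg i) fun h => ?_
      have := (g : Equiv.Perm ℤ).injective h
      omega
    have hm : StrictMono (g : Equiv.Perm ℤ) := strictMono_int_of_lt_succ hlt
    have hs : ∀ i : ℤ, (g : Equiv.Perm ℤ) (i + 1) = (g : Equiv.Perm ℤ) i + 1 := by
      intro i
      obtain ⟨j, hj⟩ := (g : Equiv.Perm ℤ).surjective ((g : Equiv.Perm ℤ) i + 1)
      have h1 : i < j := hm.lt_iff_lt.mp (by omega)
      have h2 : (g : Equiv.Perm ℤ) (i + 1) ≤ (g : Equiv.Perm ℤ) j := hm.monotone (by omega)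
      have := hlt i
      omega
    refine ⟨(g : Equiv.Perm ℤ) 0, [], by simp, ?_⟩
    ext t
    rw [List.prod_nil, mul_one, rot_zpow_apply]
    induction t using Int.induction_on with
    | zero => simp
    | succ i ih => rw [hs, ih]; ring
    | pred i ih =>
      have := hs (-(i : ℤ) - 1)
      rw [sub_add_cancel] at this
      omega
termination_by (displacement g 0).toNat

theorem exists_reduced {d : ℕ} [NeZero d] (g : ExtWeyl d) :
    ∃ (z : ℤ) (l : List (ExtWeyl d)),
      (∀ s ∈ l, s ∈ simples d) ∧ l.length = len g ∧ g = rot d ^ z * l.prod := by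
  have h : {k | ∃ (z : ℤ) (l : List (ExtWeyl d)),
      (∀ s ∈ l, s ∈ simples d) ∧ l.length = k ∧ g = rot d ^ z * l.prod}.Nonempty := by
    obtain ⟨z, l, hl, e⟩ := exists_word g
    exact ⟨l.length, z, l, hl, rfl, e⟩
  exact Nat.sInf_mem h

theorem len_le {d : ℕ} (z : ℤ) (l : List (ExtWeyl d)) (hl : ∀ s ∈ l, s ∈ simples d) :
    len (rot d ^ z * l.prod) ≤ l.length :=
  Nat.sInf_le ⟨z, l, hl, rfl, rfl⟩

theorem len_rot_zpow {d : ℕ} (z : ℤ) : len (rot d ^ z) = 0 := by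
  have := len_le (d := d) z [] (by simp)
  simpa using this

theorem len_simple {d : ℕ} [NeZero d] {s : ExtWeyl d} (hs : s ∈ simples d) : len s = 1 := by
  have h1 : len s ≤ 1 := by
    have := len_le (d := d) 0 [s] (by simpa using hs)
    simpa using this
  obtain ⟨z, l, _, hlen, e⟩ := exists_reduced s
  by_contra h
  have h0 : l = [] := List.length_eq_zero_iff.mp (by omega)
  obtain ⟨hd, i, rfl⟩ := hs
  rw [h0, List.prod_nil, mul_one] at e
  have e1 := simple_apply_self hd i
  have e2 := simple_apply_succ hd i
  rw [e, rot_zpow_apply] at e1 e2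
  omega

theorem prod_mul_rot_zpow {d : ℕ} (z : ℤ) (l : List (ExtWeyl d)) (hl : ∀ s ∈ l, s ∈ simples d) :
    ∃ l' : List (ExtWeyl d), (∀ s ∈ l', s ∈ simples d) ∧ l'.length = l.length ∧
      l.prod * rot d ^ z = rot d ^ z * l'.prod := by
  induction l with
  | nil => exact ⟨[], by simp, rfl, by simp⟩
  | cons s l ih =>
    obtain ⟨l', h1, h2, h3⟩ := ih fun t ht => hl t (List.mem_cons_of_mem _ ht)
    obtain ⟨hd, i, rfl⟩ := hl s List.mem_cons_self
    refine ⟨simple d (i - z) :: l', ?_, by simp [h2], ?_⟩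
    · intro t ht
      rcases List.mem_cons.mp ht with rfl | ht
      · exact ⟨hd, _, rfl⟩
      · exact h1 t ht
    · rw [List.prod_cons, List.prod_cons, mul_assoc, h3, ← mul_assoc, ← mul_assoc,
        rot_zpow_mul_simple, sub_add_cancel]

theorem len_inv_le {d : ℕ} [NeZero d] (g : ExtWeyl d) : len g⁻¹ ≤ len g := by
  obtain ⟨z, l, hl, hlen, e⟩ := exists_reduced g
  have hr : ∀ s ∈ l.reverse, s ∈ simples d := fun s hs => hl s (List.mem_reverse.mp hs)
  obtain ⟨l', h1, h2, h3⟩ := prod_mul_rot_zpow (-z) l.reverse hr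
  have hinv : l.prod⁻¹ = l.reverse.prod := by
    rw [List.prod_inv_reverse]
    congr 2
    conv_rhs => rw [← List.map_id l]
    apply List.map_congr_left
    intro s hs
    obtain ⟨_, i, rfl⟩ := hl s hs
    exact inv_eq_of_mul_eq_one_left (simple_mul_self i)
  have : g⁻¹ = rot d ^ (-z) * l'.prod := by
    rw [← h3, ← hinv, zpow_neg, ← mul_inv_rev, ← e]
  rw [this, ← hlen, ← List.length_reverse (as := l), ← h2]
  exact len_le _ _ h1

theorem len_inv {d : ℕ} [NeZero d] (g : ExtWeyl d) : len g⁻¹ = len g :=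
  le_antisymm (len_inv_le g) (by simpa using len_inv_le g⁻¹)

theorem heckeT_one (d : ℕ) : heckeT (1 : ExtWeyl d) = 1 := by
  have := RingQuot.mkAlgHom_rel Coeff (HeckeRel.one (d := d))
  rw [map_one] at this
  exact this

theorem heckeT_mul {d : ℕ} {w w' : ExtWeyl d} (h : len w + len w' = len (w * w')) :
    heckeT w * heckeT w' = heckeT (w * w') := by
  have := RingQuot.mkAlgHom_rel Coeff (HeckeRel.mul w w' h)
  rw [map_mul] at this
  exact this

theorem heckeT_quad {d : ℕ} {s : ExtWeyl d} (hs : s ∈ simples d) :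
    (heckeT s + 1) * (heckeT s - algebraMap Coeff (Hecke d) (vpow 2)) = 0 := by
  have := RingQuot.mkAlgHom_rel Coeff (HeckeRel.quad s hs)
  rw [map_mul, map_add, map_sub, map_one, map_zero, AlgHom.commutes] at this
  exact this

theorem vpow_mul (a b : ℤ) : vpow a * vpow b = vpow (a + b) := (LaurentPolynomial.T_add a b).symm

theorem vpow_zero : vpow 0 = 1 := LaurentPolynomial.T_zero

theorem isUnit_heckeT_simple {d : ℕ} {s : ExtWeyl d} (hs : s ∈ simples d) :
    IsUnit (heckeT s) := by
  have hq := heckeT_quad hs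
  set t := heckeT s
  set c : Hecke d := algebraMap Coeff (Hecke d) (vpow 2) with hc
  set c' : Hecke d := algebraMap Coeff (Hecke d) (vpow (-2)) with hc'
  have hcc : c * c' = 1 := by
    rw [hc, hc', ← map_mul, vpow_mul]
    simp [vpow_zero]
  have hct : c * t = t * c := Algebra.commutes _ _
  have hct' : c' * t = t * c' := Algebra.commutes _ _
  have hcc' : c' * c = 1 := by rw [← hcc]; exact Algebra.commutes _ _
  have e : t * (t + 1 - c) = c := by
    have : t * (t + 1 - c) = (t + 1) * (t - c) + c := by noncomm_ring
    rw [this, hq, zero_add]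
  have e' : (t + 1 - c) * t = c := by
    have : (t + 1 - c) * t = t * (t + 1 - c) + (t * c - c * t) := by noncomm_ring
    rw [this, e, hct, sub_self, add_zero]
  refine ⟨⟨t, (t + 1 - c) * c', ?_, ?_⟩, rfl⟩
  · rw [← mul_assoc, e, hcc]
  · rw [mul_assoc, hct', ← mul_assoc, e', hcc]

theorem isUnit_heckeT {d : ℕ} [NeZero d] (g : ExtWeyl d) : IsUnit (heckeT g) := by
  obtain ⟨k, hk⟩ : ∃ k, len g = k := ⟨_, rfl⟩
  induction k generalizing g with
  | zero =>
    obtain ⟨z, l, _, hlen, e⟩ := exists_reduced g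
    have h0 : l = [] := List.length_eq_zero_iff.mp (by omega)
    rw [h0, List.prod_nil, mul_one] at e
    subst e
    have h1 : ∀ a : ℤ, heckeT (rot d ^ a) * heckeT (rot d ^ (-a)) = 1 := by
      intro a
      rw [heckeT_mul, ← zpow_add, add_neg_cancel, zpow_zero, heckeT_one]
      rw [← zpow_add, len_rot_zpow, len_rot_zpow, len_rot_zpow]
    have h2 := h1 (-z)
    rw [neg_neg] at h2
    exact ⟨⟨_, _, h1 z, h2⟩, rfl⟩
  | succ k ih =>
    obtain ⟨z, l, hl, hlen, e⟩ := exists_reduced g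
    rcases List.eq_nil_or_concat l with rfl | ⟨l', s, rfl⟩
    · simp at hlen; omega
    · rw [List.concat_eq_append] at *
      have hs : s ∈ simples d := hl s (by simp)
      have hl' : ∀ t ∈ l', t ∈ simples d := fun t ht => hl t (by simp [ht])
      have hlen' : l'.length = k := by simp at hlen; omega
      have e' : g = (rot d ^ z * l'.prod) * s := by
        rw [e, List.prod_append, List.prod_singleton, mul_assoc]
      have h1 : len (rot d ^ z * l'.prod) ≤ k := hlen' ▸ len_le z l' hl'
      have h2 : len (rot d ^ z * l'.prod) = k := by
        obtain ⟨z', m, hm, hmlen, em⟩ := exists_reduced (rot d ^ z * l'.prod)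
        have h3 : len g ≤ (m ++ [s]).length := by
          rw [e', em, mul_assoc]
          have := len_le z' (m ++ [s]) (by
            intro t ht
            rcases List.mem_append.mp ht with ht | ht
            · exact hm t ht
            · rw [List.mem_singleton] at ht; exact ht ▸ hs)
          simpa using this
        simp at h3
        omega
      rw [e', ← heckeT_mul]
      · exact (ih _ h2).mul (isUnit_heckeT_simple hs)
      · rw [h2, len_simple hs, ← e', hk]

/-- The Hecke algebra with `ℤ[v, v⁻¹]` acting through `v ↦ v⁻¹`. -/
def TwistedHecke (d : ℕ) : Type := Hecke d

noncomputable instance (d : ℕ) : Ring (TwistedHecke d) := inferInstanceAs (Ring (Hecke d))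

noncomputable instance (d : ℕ) : Algebra Coeff (TwistedHecke d) :=
  ((algebraMap Coeff (Hecke d)).comp
    (LaurentPolynomial.invert (R := ℤ)).toRingEquiv.toRingHom).toAlgebra'
    fun c x => Algebra.commutes (R := Coeff) (A := Hecke d) (LaurentPolynomial.invert c) x

noncomputable def barFree (d : ℕ) [NeZero d] :
    FreeAlgebra Coeff (ExtWeyl d) →ₐ[Coeff] TwistedHecke d :=
  FreeAlgebra.lift Coeff fun g => (Ring.inverse (heckeT g⁻¹) : Hecke d)

theorem barFree_ι {d : ℕ} [NeZero d] (g : ExtWeyl d) :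
    barFree d (FreeAlgebra.ι Coeff g) = (Ring.inverse (heckeT g⁻¹) : Hecke d) :=
  FreeAlgebra.lift_ι_apply _ _

theorem barFree_rel {d : ℕ} [NeZero d] {a b : FreeAlgebra Coeff (ExtWeyl d)}
    (h : HeckeRel d a b) : barFree d a = barFree d b := by
  cases h with
  | one =>
    rw [barFree_ι, map_one, inv_one, heckeT_one, Ring.inverse_one]
    rfl
  | mul w w' h =>
    rw [map_mul, barFree_ι, barFree_ι, barFree_ι]
    have h' : len w'⁻¹ + len w⁻¹ = len (w'⁻¹ * w⁻¹) := by
      rw [← mul_inv_rev, len_inv, len_inv, len_inv, ← h, add_comm]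
    obtain ⟨u, hu⟩ := isUnit_heckeT w⁻¹
    obtain ⟨u', hu'⟩ := isUnit_heckeT w'⁻¹
    rw [mul_inv_rev, ← heckeT_mul h', ← hu, ← hu', ← Units.val_mul, Ring.inverse_unit,
      Ring.inverse_unit, Ring.inverse_unit, mul_inv_rev, Units.val_mul]
    rfl
  | quad s hs =>
    rw [map_mul, map_add, map_sub, map_one, map_zero, AlgHom.commutes, barFree_ι]
    have hsi : s⁻¹ = s := by
      obtain ⟨_, i, rfl⟩ := hs
      exact inv_eq_of_mul_eq_one_left (simple_mul_self i)
    rw [hsi]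
    obtain ⟨u, hu⟩ := isUnit_heckeT_simple hs
    have hq := heckeT_quad hs
    have hb : algebraMap Coeff (TwistedHecke d) (vpow 2) =
        (algebraMap Coeff (Hecke d) (vpow (-2)) : Hecke d) := by
      change algebraMap Coeff (Hecke d) (LaurentPolynomial.invert (vpow 2)) = _
      rw [vpow, LaurentPolynomial.invert_T]
      rfl
    rw [hb, ← hu, Ring.inverse_unit]
    rw [← hu] at hq
    set c : Hecke d := algebraMap Coeff (Hecke d) (vpow 2) with hc
    set c' : Hecke d := algebraMap Coeff (Hecke d) (vpow (-2)) with hc'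
    have hcc : c * c' = 1 := by
      rw [hc, hc', ← map_mul, vpow_mul]
      simp [vpow_zero]
    change ((↑u⁻¹ : Hecke d) + 1) * ((↑u⁻¹ : Hecke d) - c') = 0
    have hcu : c' * (u : Hecke d) = u * c' := Algebra.commutes _ _
    have key : (u : Hecke d) * (((↑u⁻¹ : Hecke d) + 1) * ((↑u⁻¹ : Hecke d) - c')) * u = 0 := by
      have e1 : (u : Hecke d) * (((↑u⁻¹ : Hecke d) + 1) * ((↑u⁻¹ : Hecke d) - c')) * u =
          ((u : Hecke d) * ↑u⁻¹ + u) * ((↑u⁻¹ : Hecke d) * u - c' * u) := by noncomm_ring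
      rw [e1, Units.mul_inv, Units.inv_mul, hcu]
      have e2 : (1 + (u : Hecke d)) * (1 - u * c') =
          -(((u : Hecke d) + 1) * (u - c)) * c' + (1 + (u : Hecke d)) * (1 - c * c') := by
        noncomm_ring
      rw [e2, hq, hcc]
      simp
    have := congrArg (fun x => (↑u⁻¹ : Hecke d) * x * ↑u⁻¹) key
    simpa [mul_assoc] using this

/-- The bar involution of the Hecke algebra: the ring homomorphism with `v ↦ v⁻¹` and
`T_g ↦ (T_{g⁻¹})⁻¹`. -/
noncomputable def heckeBar (d : ℕ) [NeZero d] : Hecke d →+* Hecke d :=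
  ((RingQuot.liftAlgHom Coeff ⟨barFree d, fun _ _ h => barFree_rel h⟩ :
    RingQuot (HeckeRel d) →ₐ[Coeff] TwistedHecke d) : RingQuot (HeckeRel d) →+* TwistedHecke d)

theorem heckeBar_heckeT {d : ℕ} [NeZero d] (g : ExtWeyl d) :
    heckeBar d (heckeT g) = Ring.inverse (heckeT g⁻¹) := by
  have : heckeBar d (heckeT g) = barFree d (FreeAlgebra.ι Coeff g) :=
    RingQuot.liftAlgHom_mkAlgHom_apply (B := TwistedHecke d) Coeff (barFree d)
      (fun _ _ h => barFree_rel h) (FreeAlgebra.ι Coeff g)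
  rw [this, barFree_ι]

theorem heckeBar_algebraMap {d : ℕ} [NeZero d] (c : Coeff) :
    heckeBar d (algebraMap Coeff (Hecke d) c) =
      algebraMap Coeff (Hecke d) (LaurentPolynomial.invert c) :=
  AlgHom.commutes (RingQuot.liftAlgHom Coeff ⟨barFree d, fun _ _ h => barFree_rel h⟩ :
    RingQuot (HeckeRel d) →ₐ[Coeff] TwistedHecke d) c

/-! ### Periodic matrices -/

/-- The `ℤ × ℤ` matrices over `ℕ` with `a_{i+n,j+n} = a_{ij}` and
`∑_{1 ≤ i ≤ n} ∑_{j ∈ ℤ} a_{ij} = d` (in particular every row has finite support). -/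
@[ext]
structure Theta (n d : ℕ) where
  entry : ℤ → ℤ → ℕ
  periodic : ∀ i j : ℤ, entry (i + n) (j + n) = entry i j
  finite : ∀ i : ℤ, (Function.support (entry i)).Finite
  total : ∑ k ∈ Finset.range n, ∑ᶠ j : ℤ, entry (1 + k) j = d

namespace Theta

variable {n d : ℕ}

/-- The row sums, for all rows `i ∈ ℤ`. -/
noncomputable def rowSum (A : Theta n d) (i : ℤ) : ℕ := ∑ᶠ j : ℤ, A.entry i j

/-- The column sums, for all columns `j ∈ ℤ`. -/
noncomputable def colSum (A : Theta n d) (j : ℤ) : ℕ := ∑ᶠ i : ℤ, A.entry i j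

theorem finsum_ite_eq_left (c : ℤ) (x : ℕ) : (∑ᶠ j : ℤ, if j = c then x else 0) = x := by
  rw [finsum_eq_single _ c]
  · simp
  · intro j hj
    simp [hj]

theorem finite_ite (c : ℤ) (x : ℕ) :
    (Function.support fun j : ℤ => if j = c then x else 0).Finite := by
  apply (Set.finite_singleton c).subset
  intro j hj
  by_contra h
  simp at h hj
  exact h hj.1

theorem finsum_ite_eq_add (f : ℤ → ℕ) (hf : (Function.support f).Finite) (c : ℤ) :
    (∑ᶠ j : ℤ, (f j - if j = c then f c else 0)) + f c = ∑ᶠ j : ℤ, f j := by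
  have e : (∑ᶠ j : ℤ, (f j - if j = c then f c else 0)) + f c =
      (∑ᶠ j : ℤ, (f j - if j = c then f c else 0)) + ∑ᶠ j : ℤ, if j = c then f c else 0 := by
    rw [finsum_ite_eq_left]
  rw [e, ← finsum_add_distrib _ (finite_ite c (f c))]
  · apply finsum_congr
    intro j
    by_cases h : j = c
    · simp [h]
    · simp [h]
  · apply hf.subset
    intro j hj
    simp only [Function.mem_support] at hj ⊢
    omega

theorem periodic_int (A : Theta n d) (i j q : ℤ) : A.entry (i + q * n) (j + q * n) = A.entry i j := by
  induction q using Int.induction_on with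
  | zero => simp
  | succ q ih =>
    rw [← ih, ← A.periodic (i + q * n) (j + q * n)]
    congr 1 <;> ring
  | pred q ih =>
    rw [← ih, ← A.periodic (i + (-(q : ℤ) - 1) * n) (j + (-(q : ℤ) - 1) * n)]
    congr 1 <;> ring

theorem rowSum_add (A : Theta n d) (i : ℤ) : A.rowSum (i + n) = A.rowSum i := by
  unfold rowSum
  rw [← finsum_comp_equiv (Equiv.addRight (n : ℤ))]
  exact finsum_congr fun j => A.periodic i j

theorem entry_le_rowSum (A : Theta n d) (i j : ℤ) : A.entry i j ≤ A.rowSum i :=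
  single_le_finsum j (A.finite i) fun _ => Nat.zero_le _

/-- The entries of `A` on the diagonal `j - i = c` (and zeros elsewhere). -/
def diagPart (A : Theta n d) (c i j : ℤ) : ℕ := if j = i + c then A.entry i (i + c) else 0

/-- With `T` the part of `A` on the diagonal `j - i = c`, the matrix obtained from `A - T` by adding
`T` with every entry shifted down by `e` rows (up if `e < 0`). -/
def shiftDiag (A : Theta n d) (c e : ℤ) : Theta n d where
  entry i j := (A.entry i j - A.diagPart c i j) + A.diagPart c (i - e) j
  periodic i j := by
    have h1 : ∀ i j, A.diagPart c (i + n) (j + n) = A.diagPart c i j := by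
      intro i j
      have e1 : (j + (n : ℤ) = i + n + c) ↔ (j = i + c) := by constructor <;> intro h <;> linarith
      have e2 : A.entry (i + n) (i + n + c) = A.entry i (i + c) := by
        rw [← A.periodic i (i + c)]
        congr 1; ring
      simp only [diagPart, e1, e2]
    have e3 : i + (n : ℤ) - e = i - e + n := by ring
    rw [e3, h1, h1, A.periodic]
  finite i := by
    apply ((A.finite i).union (finite_ite (i - e + c) (A.entry (i - e) (i - e + c)))).subset
    intro j hj
    by_contra h
    simp only [Set.mem_union, Function.mem_support, not_or, not_not] at h
    simp only [Function.mem_support, diagPart, h.1, h.2] at hj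
    simp at hj
  total := by
    have hrow : ∀ i : ℤ,
        (∑ᶠ j : ℤ, ((A.entry i j - A.diagPart c i j) + A.diagPart c (i - e) j)) + A.entry i (i + c)
          = A.rowSum i + A.entry (i - e) (i - e + c) := by
      intro i
      rw [finsum_add_distrib, add_right_comm]
      · congr 1
        · rw [rowSum, ← finsum_ite_eq_add _ (A.finite i) (i + c)]
          rfl
        · exact finsum_ite_eq_left _ _
      · apply (A.finite i).subset
        intro j hj
        simp only [Function.mem_support] at hj ⊢
        omega
      · exact finite_ite _ _
    have hsum : ∑ k ∈ Finset.range n, A.entry (1 + k - e) (1 + k - e + c) =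
        ∑ k ∈ Finset.range n, A.entry (1 + k) (1 + k + c) := by
      have hp : ∀ i : ℤ, A.entry (i + n) (i + n + c) = A.entry i (i + c) := by
        intro i
        rw [← A.periodic i (i + c)]
        congr 1; ring
      have h1 := sum_window n (fun i => A.entry i (i + c)) hp (1 - e)
      have h2 := sum_window n (fun i => A.entry i (i + c)) hp 1
      rw [← h1.trans h2.symm]
      apply Finset.sum_congr rfl
      intro k _
      congr 1 <;> ring
    have := Finset.sum_congr (rfl : Finset.range n = Finset.range n)
      fun (k : ℕ) _ => hrow (1 + k)
    rw [Finset.sum_add_distrib, Finset.sum_add_distrib, hsum] at this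
    exact (Nat.add_right_cancel this).trans A.total

/-- The bidiagonal matrix with entries `a_{i,i+c}` at the places `(i, i + e)` and with the diagonal
that makes its row sums those of `A`. -/
noncomputable def bidiag (A : Theta n d) (c e : ℤ) : Theta n d where
  entry i j := (if j = i then A.rowSum i - A.entry i (i + c) else 0) +
    (if j = i + e then A.entry i (i + c) else 0)
  periodic i j := by
    have e1 : (j + (n : ℤ) = i + n) ↔ (j = i) := by constructor <;> intro h <;> linarith
    have e2 : (j + (n : ℤ) = i + n + e) ↔ (j = i + e) := by constructor <;> intro h <;> linarith
    have e3 : A.entry (i + n) (i + n + c) = A.entry i (i + c) := by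
      rw [← A.periodic i (i + c)]
      congr 1; ring
    simp only [e1, e2, e3, rowSum_add]
  finite i := by
    apply ((finite_ite i (A.rowSum i - A.entry i (i + c))).union
      (finite_ite (i + e) (A.entry i (i + c)))).subset
    intro j hj
    by_contra h
    simp only [Set.mem_union, Function.mem_support, not_or, not_not] at h
    simp only [Function.mem_support, h.1, h.2] at hj
    simp at hj
  total := by
    have hrow : ∀ i : ℤ, (∑ᶠ j : ℤ, ((if j = i then A.rowSum i - A.entry i (i + c) else 0) +
        (if j = i + e then A.entry i (i + c) else 0))) = A.rowSum i := by
      intro i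
      rw [finsum_add_distrib (finite_ite _ _) (finite_ite _ _), finsum_ite_eq_left,
        finsum_ite_eq_left]
      exact Nat.sub_add_cancel (A.entry_le_rowSum i (i + c))
    simp only [hrow]
    exact A.total

theorem rowSum_shiftDiag (A : Theta n d) (c e i : ℤ) :
    (A.shiftDiag c e).rowSum i + A.entry i (i + c) =
      A.rowSum i + A.entry (i - e) (i - e + c) := by
  unfold rowSum shiftDiag
  simp only
  rw [finsum_add_distrib, add_right_comm]
  · congr 1
    · rw [← finsum_ite_eq_add _ (A.finite i) (i + c)]
      rfl
    · exact finsum_ite_eq_left _ _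
  · apply (A.finite i).subset
    intro j hj
    simp only [Function.mem_support] at hj ⊢
    omega
  · exact finite_ite _ _

/-- The diagonal of `bidiag` is the one with the same row sums as `A`, -/
theorem rowSum_bidiag (A : Theta n d) (c e i : ℤ) : (A.bidiag c e).rowSum i = A.rowSum i := by
  unfold rowSum bidiag
  simp only
  rw [finsum_add_distrib (finite_ite _ _) (finite_ite _ _), finsum_ite_eq_left,
    finsum_ite_eq_left]
  exact Nat.sub_add_cancel (A.entry_le_rowSum i (i + c))

/-- and its column sums are the row sums of `shiftDiag`. -/
theorem colSum_bidiag (A : Theta n d) (c e i : ℤ) :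
    (A.bidiag c e).colSum i = (A.shiftDiag c e).rowSum i := by
  have h := A.rowSum_shiftDiag c e i
  have hle := A.entry_le_rowSum i (i + c)
  have h1 : ∀ k : ℤ, (A.bidiag c e).entry k i =
      (if k = i then A.rowSum i - A.entry i (i + c) else 0) +
        (if k = i - e then A.entry (i - e) (i - e + c) else 0) := by
    intro k
    have e1 : (i = k) ↔ (k = i) := eq_comm
    have e2 : (i = k + e) ↔ (k = i - e) := by constructor <;> intro h <;> linarith
    simp only [bidiag, e1, e2]
    congr 1
    · split_ifs with h <;> simp [h]
    · split_ifs with h <;> simp [h]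
  have h2 : (A.bidiag c e).colSum i =
      A.rowSum i - A.entry i (i + c) + A.entry (i - e) (i - e + c) := by
    unfold colSum
    rw [finsum_congr h1, finsum_add_distrib (finite_ite _ _) (finite_ite _ _),
      finsum_ite_eq_left, finsum_ite_eq_left]
  omega

/-- `0` if `A` is lower triangular, and otherwise the `k > 0` for which `j - i = k` is the outermost
nonzero upper diagonal of `A`. -/
noncomputable def upperWidth (A : Theta n d) : ℕ :=
  sInf {k : ℕ | ∀ i j : ℤ, A.entry i j ≠ 0 → j - i ≤ k}

/-- `0` if `A` is upper triangular, and otherwise the `k > 0` for which `i - j = k` is the outermost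
nonzero lower diagonal of `A`. -/
noncomputable def lowerWidth (A : Theta n d) : ℕ :=
  sInf {k : ℕ | ∀ i j : ℤ, A.entry i j ≠ 0 → i - j ≤ k}

theorem exists_width [NeZero n] (A : Theta n d) :
    ∃ k : ℕ, ∀ i j : ℤ, A.entry i j ≠ 0 → |j - i| ≤ k := by
  have hfin : (⋃ r ∈ Finset.range n, (fun j : ℤ => (j - r).natAbs) ''
      Function.support (A.entry (r : ℤ))).Finite :=
    (Finset.range n).finite_toSet.biUnion fun r _ => (A.finite r).image _
  obtain ⟨k, hk⟩ := hfin.bddAbove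
  refine ⟨k, fun i j hij => ?_⟩
  have hn : (n : ℤ) ≠ 0 := by exact_mod_cast NeZero.ne n
  have h0 := Int.emod_nonneg i hn
  have h1 := Int.emod_lt_of_pos i (b := (n : ℤ)) (by omega)
  have hr : (((i % n).toNat : ℕ) : ℤ) = i % n := Int.toNat_of_nonneg h0
  have hi : i = i % n + (i / n) * n := by rw [mul_comm]; exact (Int.emod_add_mul_ediv i n).symm
  have hj : j = (j - (i / n) * n) + (i / n) * n := by ring
  have hne : A.entry (i % n) (j - (i / n) * n) ≠ 0 := by
    rw [← A.periodic_int (i % n) (j - (i / n) * n) (i / n), ← hi, ← hj]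
    exact hij
  have hmem : (j - (i / n) * n - i % n).natAbs ≤ k := by
    apply hk
    simp only [Set.mem_iUnion]
    refine ⟨(i % n).toNat, Finset.mem_range.mpr (by omega), j - (i / n) * n, ?_, ?_⟩
    · rw [hr]; exact hne
    · simp only [hr]
  have e : j - (i / n) * n - i % n = j - i := by
    conv_rhs => rw [hi]
    ring
  rw [e] at hmem
  rw [Int.abs_eq_natAbs]
  exact_mod_cast hmem

theorem le_upperWidth [NeZero n] (A : Theta n d) (i j : ℤ) (h : A.entry i j ≠ 0) :
    j - i ≤ A.upperWidth := by
  have hne : {k : ℕ | ∀ i j : ℤ, A.entry i j ≠ 0 → j - i ≤ k}.Nonempty := by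
    obtain ⟨k, hk⟩ := A.exists_width
    exact ⟨k, fun i j h => (le_abs_self _).trans (hk i j h)⟩
  exact Nat.sInf_mem hne i j h

theorem le_lowerWidth [NeZero n] (A : Theta n d) (i j : ℤ) (h : A.entry i j ≠ 0) :
    i - j ≤ A.lowerWidth := by
  have hne : {k : ℕ | ∀ i j : ℤ, A.entry i j ≠ 0 → i - j ≤ k}.Nonempty := by
    obtain ⟨k, hk⟩ := A.exists_width
    refine ⟨k, fun i j h => ?_⟩
    have := neg_abs_le (j - i)
    have := hk i j h
    omega
  exact Nat.sInf_mem hne i j h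

theorem upperWidth_shiftDiag_lt [NeZero n] (A : Theta n d) (h : A.upperWidth ≠ 0) :
    (A.shiftDiag A.upperWidth 1).upperWidth < A.upperWidth := by
  have : (A.shiftDiag A.upperWidth 1).upperWidth ≤ A.upperWidth - 1 := by
    apply Nat.sInf_le
    intro i j hij
    by_contra hlt
    have h1 := A.le_upperWidth i j
    simp only [shiftDiag, diagPart] at hij
    by_cases e1 : j = i + A.upperWidth
    · have e2 : ¬ j = i - 1 + A.upperWidth := by omega
      rw [if_pos e1, if_neg e2, ← e1] at hij
      omega
    · have e2 : ¬ j = i - 1 + A.upperWidth := by omega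
      rw [if_neg e1, if_neg e2] at hij
      have := h1 (by omega)
      omega
  omega

theorem lowerWidth_shiftDiag_lt [NeZero n] (A : Theta n d) (h : A.lowerWidth ≠ 0) :
    (A.shiftDiag (-A.lowerWidth) (-1)).lowerWidth < A.lowerWidth := by
  have : (A.shiftDiag (-A.lowerWidth) (-1)).lowerWidth ≤ A.lowerWidth - 1 := by
    apply Nat.sInf_le
    intro i j hij
    by_contra hlt
    have h1 := A.le_lowerWidth i j
    simp only [shiftDiag, diagPart] at hij
    by_cases e1 : j = i + -A.lowerWidth
    · have e2 : ¬ j = i - -1 + -A.lowerWidth := by omega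
      rw [if_pos e1, if_neg e2, ← e1] at hij
      omega
    · have e2 : ¬ j = i - -1 + -A.lowerWidth := by omega
      rw [if_neg e1, if_neg e2] at hij
      have := h1 (by omega)
      omega
  omega

/-- The matrices `B_(1), …, B_(y)` obtained from a lower triangular matrix `L`: as long as `L` is not
lower bidiagonal, put down the lower bidiagonal matrix of the outermost nonzero lower diagonal and
move that diagonal up by one row; the last matrix is the lower bidiagonal one that is left. -/
noncomputable def lowerFactors [NeZero n] (L : Theta n d) : List (Theta n d) :=
  if _h : L.lowerWidth ≤ 1 then [L]
  else L.bidiag (-L.lowerWidth) (-1) :: lowerFactors (L.shiftDiag (-L.lowerWidth) (-1))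
termination_by L.lowerWidth
decreasing_by exact L.lowerWidth_shiftDiag_lt (by omega)

/-- The matrices `B^(1), …, B^(x), B_(1), …, B_(y)`: as long as `U` is not lower triangular, put down
the upper bidiagonal matrix of the outermost nonzero upper diagonal and move that diagonal down by
one row; then go on with the lower triangular matrix that is left. -/
noncomputable def monomialFactors [NeZero n] (U : Theta n d) : List (Theta n d) :=
  if h : U.upperWidth = 0 then lowerFactors U
  else U.bidiag U.upperWidth 1 :: monomialFactors (U.shiftDiag U.upperWidth 1)
termination_by U.upperWidth
decreasing_by exact U.upperWidth_shiftDiag_lt h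

end Theta

/-! ### The affine `q`-Schur algebra -/

/-- The right ideal `x_l H`, as a right `H`-module. -/
noncomputable def xModule {n d : ℕ} (l : Comp n d) : Submodule (Hecke d)ᵐᵒᵖ (Hecke d) :=
  Submodule.span (Hecke d)ᵐᵒᵖ {xElt l}

/-- The affine `q`-Schur algebra `End_H (⨁_l x_l H)` (endomorphisms of right `H`-modules, with
composition as the product). -/
abbrev Schur (n d : ℕ) : Type :=
  Module.End (Hecke d)ᵐᵒᵖ (DirectSum (Comp n d) fun l => xModule l)

/-- The generator `x_m` of the summand `x_m H`. -/
noncomputable def gen {n d : ℕ} (m : Comp n d) : DirectSum (Comp n d) fun l => xModule l :=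
  DirectSum.of (fun l : Comp n d => xModule l) m ⟨xElt m, Submodule.mem_span_singleton_self _⟩

/-- `F` is the right `H`-linear map `x_m H → x_l H` that sends `x_m` to `T_{W_l g W_m}`, extended by
zero to the other summands. -/
def IsPhi {n d : ℕ} (l : Comp n d) (g : ExtWeyl d) (m : Comp n d) (F : Schur n d) : Prop :=
  ∀ p q : Comp n d, ((F (gen p) q : xModule q) : Hecke d) =
    if p = m ∧ q = l then heckeSum (doubleCoset l g m) else 0

open Classical in
/-- The map `φ_{l m}^g`; as the `x_p` generate, `IsPhi` determines it uniquely. -/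
noncomputable def phi {n d : ℕ} (l : Comp n d) (g : ExtWeyl d) (m : Comp n d) : Schur n d :=
  if h : ∃ F : Schur n d, IsPhi l g m F then h.choose else 0

/-- The part `l_i` for `i ∈ ℤ`, with `l_{i+n} = l_i`. -/
def part {n d : ℕ} [NeZero n] (l : Comp n d) (i : ℤ) : ℕ :=
  l.1 (Fin.ofNat n ((i - 1) % n).toNat)

/-- The left end `l_1 + ⋯ + l_{i-1}` of the block `R_i`, extended to `i ∈ ℤ` by
`R_{i+n} = R_i + d`. -/
def blockStart {n d : ℕ} (l : Comp n d) (i : ℤ) : ℤ :=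
  (i - 1) / n * d + ∑ k : Fin n, if (k : ℤ) < (i - 1) % n then (l.1 k : ℤ) else 0

/-- The integer interval `R_i^l = (l_1 + ⋯ + l_{i-1} .. l_1 + ⋯ + l_i]`, for `i ∈ ℤ`. -/
def block {n d : ℕ} [NeZero n] (l : Comp n d) (i : ℤ) : Set ℤ :=
  Set.Ioc (blockStart l i) (blockStart l i + part l i)

/-- `A = κ(l, g, m)`, that is, `a_{ij} = |R_i^l ∩ g R_j^m|`. -/
def IsKappa {n d : ℕ} [NeZero n] (l : Comp n d) (g : ExtWeyl d) (m : Comp n d) (A : Theta n d) :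
    Prop :=
  ∀ i j : ℤ, A.entry i j = (block l i ∩ (g : Equiv.Perm ℤ) '' block m j).ncard

open Classical in
/-- `e_A = φ_{l m}^g` for the triple `(l, g, m)` with `g ∈ D_{l m}` and `A = κ(l, g, m)`. -/
noncomputable def eElt {n d : ℕ} [NeZero n] (A : Theta n d) : Schur n d :=
  if h : ∃ t : Comp n d × ExtWeyl d × Comp n d,
      t.2.1 ∈ distinguishedDouble t.1 t.2.2 ∧ IsKappa t.1 t.2.1 t.2.2 A then
    phi h.choose.1 h.choose.2.1 h.choose.2.2
  else 0

/-- `d_A = ∑_{1 ≤ i ≤ n, j ∈ ℤ} ∑_{x ≤ i, y > j} a_{ij} a_{xy}`. -/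
noncomputable def dStat {n d : ℕ} (A : Theta n d) : ℕ :=
  ∑ i ∈ Finset.Icc (1 : ℤ) n, ∑ᶠ j : ℤ, ∑ᶠ p ∈ {p : ℤ × ℤ | p.1 ≤ i ∧ j < p.2},
    A.entry i j * A.entry p.1 p.2

/-- The standard basis element `[A] = v ^ (-d_A) e_A`. -/
noncomputable def std {n d : ℕ} [NeZero n] (A : Theta n d) : Schur n d :=
  vpow (-(dStat A : ℤ)) • eElt A

/-- The element `m_A = [B^(1)] ⋯ [B^(x)] [B_(1)] ⋯ [B_(y)]`. -/
noncomputable def monomial {n d : ℕ} [NeZero n] (A : Theta n d) : Schur n d :=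
  (A.monomialFactors.map std).prod

/-- `G` is the bar conjugate of `F`: on the component `x_m H → x_l H` it is given by
`x_m h ↦ v ^ (2 ℓ(w_m)) * bar (F x_m) * h`, where `w_m` is the longest element of `W_m`. -/
def IsBar {n d : ℕ} [NeZero d] (F G : Schur n d) : Prop :=
  ∀ m l : Comp n d, ((G (gen m) l : xModule l) : Hecke d) =
    vpow (2 * (longestLen m : ℤ)) • heckeBar d ((F (gen m) l : xModule l) : Hecke d)

open Classical in
/-- The bar involution of the affine `q`-Schur algebra; as the `x_m` generate, `IsBar` determines it
uniquely. -/
noncomputable def bar {n d : ℕ} [NeZero d] (F : Schur n d) : Schur n d :=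
  if h : ∃ G : Schur n d, IsBar F G then h.choose else 0

end AffineSchur

namespace AffineSchur

/-! ### Length and inversions -/

section Length

variable {d : ℕ}

/-! The proof combines a basis `e_A`, the bar invariance of each bidiagonal factor, and a
triangularity argument.

Basis. Length is the number of inversions modulo translation by `d` (`len_eq_inversions`), and the
`T_w` form a basis of the Hecke algebra because left and right multiplication operators on the free
module commute (`leftOp_rightOp_comm`). An endomorphism is determined by its components at the
generators `x_m`. The component in `x_l H` is multiplied by `v²` under every `T_s` with `s` in `W_l`
on the left and in `W_m` on the right, which says that its coefficients are constant on double
cosets. Coloring each integer by the pair of blocks containing it and its preimage identifies double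
cosets with matrices (`mem_stabCoset_of_isKappa`, `exists_isKappa`, `exists_theta`). Hence the `e_A`
form a basis, and the coordinate `schurCoef A` is the coefficient of a single `T_g`.

Bar invariance. Parabolic subgroups are treated as stabilizers of sets of cuts of `ℤ`: intersecting
two of them unites the cuts, and conjugating by a rotation translates the cuts. For bidiagonal `B`
the column blocks can be translated so that they overlap the row blocks as `B` prescribes, so the
double coset contains some `π^z`, of length zero (`IsBidiagonal.exists_isKappa_rot`). Then `x_l
T_{π^z} x_m` is the Poincaré polynomial of `W_l ∩ π^z W_m π^{-z}` times the coset sum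
(`xStab_mul_rot_mul_xStab`). The bar conjugates of all other factors are known, so the coset sum is
bar invariant up to a power of `v`. The exponent is right because `d_B` is the difference of the
lengths of the longest elements of `W_l` and of that intersection (`IsBidiagonal.maxLen_cuts`).
Products of bar invariant elements are bar invariant (`IsBar.mul`).

Triangularity. Let the weight of `A` be the sum of `a_ij (j - i)²` over one period of rows. A term
`C` of `e_B e_{C'}`, with `B` bidiagonal on the side `e = ±1`, arises from `C'` by moving entries
one row, the number moved into each row being prescribed by `B`. A moved entry that ends at signed
distance `x` from the diagonal changes the weight by `x² - (x-1)² = 2x - 1`. If the entries of `C'`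
have signed distance at most `k - 1`, then `x ≤ k`, and the weight of `C` is largest exactly when
every moved entry ends on the diagonal at distance `k`. This is the inverse of one step of the
algorithm. So `A` is the unique term of largest weight in the product for `B` and the shifted
matrix, and its coefficient is `1` (`schurCoef_leading`, `eq_or_weight_lt`). Induction along the
factors gives `m_A` the leading term `e_A` up to a unit, and a family that is triangular with
respect to a weight in `ℕ` is a basis. -/

theorem mul_coe_apply (g h : ExtWeyl d) (t : ℤ) : (g * h).1 t = g.1 (h.1 t) := rfl

theorem inv_coe_apply_self (g : ExtWeyl d) (t : ℤ) : (g⁻¹).1 (g.1 t) = t :=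
  Equiv.symm_apply_apply g.1 t

theorem coe_apply_inv_self (g : ExtWeyl d) (t : ℤ) : g.1 ((g⁻¹).1 t) = t :=
  Equiv.apply_symm_apply g.1 t

theorem apply_add_mul (g : ExtWeyl d) (t k : ℤ) : g.1 (t + k * d) = g.1 t + k * d := by
  induction k using Int.induction_on with
  | zero => simp
  | succ k ih =>
    have := extWeyl_apply_add g (t + k * d)
    rw [ih] at this
    rw [show t + ((k : ℤ) + 1) * d = t + k * d + d by ring, this]
    ring
  | pred k ih =>
    have := extWeyl_apply_add g (t + (-(k : ℤ) - 1) * d)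
    rw [show t + (-(k : ℤ) - 1) * d + d = t + -(k : ℤ) * d by ring, ih] at this
    linarith

theorem natCast_pos_of_neZero [NeZero d] : (0 : ℤ) < d := by
  exact_mod_cast NeZero.pos d

theorem exists_displacement_le [NeZero d] (g : ExtWeyl d) : ∃ K : ℤ, ∀ t, |g.1 t - t| ≤ K := by
  have hd := natCast_pos_of_neZero (d := d)
  refine ⟨∑ j ∈ Finset.range d, |g.1 j - j|, fun t => ?_⟩
  have h0 := Int.emod_nonneg t hd.ne'
  have h1 := Int.emod_lt_of_pos t hd
  have ht : t = t % d + t / d * d := by rw [mul_comm]; exact (Int.emod_add_mul_ediv t d).symm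
  have e : g.1 t - t = g.1 ((t % d).toNat : ℤ) - ((t % d).toNat : ℤ) := by
    rw [Int.toNat_of_nonneg h0]
    conv_lhs => rw [ht, apply_add_mul]
    ring
  rw [e]
  exact Finset.single_le_sum (f := fun j : ℕ => |g.1 (j : ℤ) - j|) (fun _ _ => abs_nonneg _)
    (Finset.mem_range.mpr (by omega))

/-- The positions `j > t` that are inverted with `t`. -/
def invSet (g : ExtWeyl d) (t : ℤ) : Set ℤ := {j | t < j ∧ g.1 j < g.1 t}

theorem finite_invSet [NeZero d] (g : ExtWeyl d) (t : ℤ) : (invSet g t).Finite := by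
  obtain ⟨K, hK⟩ := exists_displacement_le g
  apply (Set.finite_Icc t (t + 2 * K)).subset
  rintro j ⟨h1, h2⟩
  have h3 := abs_le.mp (hK j)
  have h4 := abs_le.mp (hK t)
  constructor <;> omega

/-- The number of inversions of `g`, up to translation by `d`. -/
noncomputable def inversions (g : ExtWeyl d) : ℕ :=
  ∑ j ∈ Finset.range d, (invSet g (0 + j)).ncard

theorem ncard_invSet_add (g : ExtWeyl d) (t : ℤ) :
    (invSet g (t + d)).ncard = (invSet g t).ncard := by
  have : invSet g (t + d) = (fun j : ℤ => j + d) '' invSet g t := by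
    ext j
    simp only [invSet, Set.mem_image, Set.mem_ofPred_eq]
    constructor
    · rintro ⟨h1, h2⟩
      refine ⟨j - d, ⟨by omega, ?_⟩, by ring⟩
      have := extWeyl_apply_add g (j - d)
      rw [sub_add_cancel] at this
      rw [extWeyl_apply_add] at h2
      omega
    · rintro ⟨j, ⟨h1, h2⟩, rfl⟩
      rw [extWeyl_apply_add, extWeyl_apply_add]
      omega
  rw [this, Set.ncard_image_of_injective _ (add_left_injective _)]

theorem inversions_eq (g : ExtWeyl d) (a : ℤ) :
    inversions g = ∑ j ∈ Finset.range d, (invSet g (a + j)).ncard :=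
  (sum_window d (fun t => (invSet g t).ncard) (ncard_invSet_add g) a).symm

theorem simple_inv (i : ℤ) : (simple d i)⁻¹ = simple d i :=
  inv_eq_of_mul_eq_one_left (simple_mul_self i)

theorem two_le_of_descent [NeZero d] {g : ExtWeyl d} {i : ℤ} (h : g.1 (i + 1) < g.1 i) :
    2 ≤ d := by
  have h0 := NeZero.ne d
  by_contra hd
  obtain rfl : d = 1 := by omega
  have := extWeyl_apply_add g i
  push_cast at this
  omega

theorem apply_succ_ne (g : ExtWeyl d) (i : ℤ) : g.1 i ≠ g.1 (i + 1) := fun h => by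
  have := g.1.injective h
  omega

/-- Right multiplication by `s_i` exchanges the values at `i` and `i + 1` and permutes the positions
after `i + 1`. So the inversion counts at these two positions trade places, and the only new
inversion is the pair `(i, i + 1)`. -/
theorem inversions_mul_simple [NeZero d] (hd : 2 ≤ d) (g : ExtWeyl d) (i : ℤ)
    (h : g.1 i < g.1 (i + 1)) : inversions (g * simple d i) = inversions g + 1 := by
  have hs0 := simple_apply_self hd i
  have hs1 := simple_apply_succ hd i
  have hbig : ∀ j, i + 1 < j ↔ i + 1 < (simple d i).1 j := by
    intro j
    rcases lt_trichotomy j i with hj | rfl | hj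
    · rw [simple_apply hd]
      split_ifs <;> omega
    · rw [hs0]; omega
    · rcases eq_or_lt_of_le (Int.add_one_le_iff.mpr hj) with rfl | hj
      · rw [hs1]; omega
      · rw [simple_apply hd]
        split_ifs with h1 h2
        · omega
        · have : ¬ j = i + 2 := by
            rintro rfl
            have := Int.le_of_dvd (by omega) h2
            omega
          omega
        · omega
  have hset : ∀ a : ℤ, {j | i + 1 < j ∧ g.1 ((simple d i).1 j) < a} =
      (simple d i).1 ⁻¹' {j | i + 1 < j ∧ g.1 j < a} := by
    intro a
    ext j
    simp only [Set.mem_preimage, Set.mem_ofPred_eq]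
    rw [hbig j]
  have hpre : ∀ X : Set ℤ, ((simple d i).1 ⁻¹' X).ncard = X.ncard := fun X => by
    rw [← Equiv.image_symm_eq_preimage]
    exact Set.ncard_image_of_injective _ (simple d i).1.symm.injective
  have e1 : (invSet (g * simple d i) (i + 1)).ncard = (invSet g i).ncard := by
    have : invSet (g * simple d i) (i + 1) = (simple d i).1 ⁻¹' {j | i + 1 < j ∧ g.1 j < g.1 i} := by
      rw [← hset]
      simp only [invSet, mul_coe_apply, hs1]
    rw [this, hpre]
    congr 1
    ext j
    simp only [invSet, Set.mem_ofPred_eq]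
    constructor
    · rintro ⟨h1, h2⟩; exact ⟨by omega, h2⟩
    · rintro ⟨h1, h2⟩
      refine ⟨?_, h2⟩
      rcases eq_or_lt_of_le (Int.add_one_le_iff.mpr h1) with rfl | h3
      · omega
      · exact h3
  have e0 : (invSet (g * simple d i) i).ncard = (invSet g (i + 1)).ncard + 1 := by
    have : invSet (g * simple d i) i =
        insert (i + 1) ((simple d i).1 ⁻¹' (invSet g (i + 1))) := by
      unfold invSet
      rw [← hset]
      ext j
      simp only [mul_coe_apply, hs0, Set.mem_insert_iff, Set.mem_ofPred_eq]
      constructor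
      · rintro ⟨h1, h2⟩
        rcases eq_or_lt_of_le (Int.add_one_le_iff.mpr h1) with rfl | h3
        · exact Or.inl rfl
        · exact Or.inr ⟨h3, h2⟩
      · rintro (rfl | ⟨h1, h2⟩)
        · rw [hs1]; exact ⟨by omega, h⟩
        · exact ⟨by omega, h2⟩
    rw [this, Set.ncard_insert_of_notMem _
      ((finite_invSet g (i + 1)).preimage (simple d i).1.injective.injOn), hpre]
    simp [invSet, hs1]
  -- At any other position `t`, a reflection that fixes `t` and moves points by at most one cannot
  -- carry a point across `t`.
  have er : ∀ t, ¬ (d : ℤ) ∣ t - i → ¬ (d : ℤ) ∣ t - (i + 1) →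
      (invSet (g * simple d i) t).ncard = (invSet g t).ncard := by
    intro t h1 h2
    rw [← hpre (invSet g t)]
    congr 1
    have hst : (simple d i).1 t = t := by rw [simple_apply hd, if_neg h1, if_neg h2]
    ext j
    simp only [invSet, mul_coe_apply, hst, Set.mem_preimage, Set.mem_ofPred_eq]
    have : t < j ↔ t < (simple d i).1 j := by
      have hne : ∀ j, j ≠ t ↔ (simple d i).1 j ≠ t := fun j => by
        rw [← hst, (simple d i).1.injective.ne_iff, hst]
      have := hne j
      have hle : (simple d i).1 j ≤ j + 1 ∧ j - 1 ≤ (simple d i).1 j := by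
        rw [simple_apply hd]; split_ifs <;> omega
      have hj := simple_apply hd i j
      split_ifs at hj with h3 h4
      · omega
      · omega
      · omega
    rw [this]
  -- Starting the period at `i` puts the two exceptional positions first, and no later position in
  -- it is congruent to either.
  rw [inversions_eq _ i, inversions_eq g i]
  obtain ⟨e, rfl⟩ : ∃ e, d = e + 2 := ⟨d - 2, by omega⟩
  rw [Finset.sum_range_succ', Finset.sum_range_succ', Finset.sum_range_succ',
    Finset.sum_range_succ']
  rw [Finset.sum_congr rfl fun j hj => er (i + ((j + 1 + 1 : ℕ) : ℤ)) ?_ ?_]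
  · simp only [Nat.cast_zero, add_zero, zero_add, Nat.cast_one, e0, e1]
    ring
  all_goals
    rw [Finset.mem_range] at hj
    intro h
    have := Int.le_of_dvd (by push_cast; omega) h
    push_cast at this
    omega

theorem inversions_mul_simple_of_gt [NeZero d] (g : ExtWeyl d) (i : ℤ)
    (h : g.1 (i + 1) < g.1 i) : inversions (g * simple d i) + 1 = inversions g := by
  have hd := two_le_of_descent h
  rw [← inversions_mul_simple hd (g * simple d i) i, mul_assoc, simple_mul_self, mul_one]
  rw [mul_coe_apply, mul_coe_apply, simple_apply_self hd, simple_apply_succ hd]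
  exact h

/-- An increasing bijection of `ℤ` skips no value, so consecutive values differ by one and the map
is a translation. -/
theorem eq_rot_zpow_of_ascending (g : ExtWeyl d) (h : ∀ i, g.1 i < g.1 (i + 1)) :
    g = rot d ^ (g.1 0) := by
  have hm : StrictMono g.1 := strictMono_int_of_lt_succ h
  have hs : ∀ i : ℤ, g.1 (i + 1) = g.1 i + 1 := by
    intro i
    obtain ⟨j, hj⟩ := g.1.surjective (g.1 i + 1)
    have h1 : i < j := hm.lt_iff_lt.mp (by omega)
    have h2 : g.1 (i + 1) ≤ g.1 j := hm.monotone (by omega)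
    have := h i
    omega
  ext t
  rw [rot_zpow_apply]
  induction t using Int.induction_on with
  | zero => simp
  | succ i ih => rw [hs, ih]; ring
  | pred i ih =>
    have := hs (-(i : ℤ) - 1)
    rw [sub_add_cancel] at this
    omega

theorem inversions_rot_zpow (z : ℤ) : inversions (rot d ^ z) = 0 := by
  apply Finset.sum_eq_zero
  intro j _
  have : invSet (rot d ^ z) (0 + j) = ∅ := by
    ext t
    simp only [invSet, rot_zpow_apply, Set.mem_ofPred_eq, Set.mem_empty_iff_false, iff_false]
    omega
  rw [this, Set.ncard_empty]

theorem inversions_mul_simple_le [NeZero d] (hd : 2 ≤ d) (g : ExtWeyl d) (i : ℤ) :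
    inversions (g * simple d i) ≤ inversions g + 1 := by
  rcases lt_or_gt_of_ne (apply_succ_ne g i) with h | h
  · exact (inversions_mul_simple hd g i h).le
  · have := inversions_mul_simple_of_gt g i h
    omega

theorem inversions_le_length [NeZero d] (z : ℤ) (l : List (ExtWeyl d))
    (hl : ∀ s ∈ l, s ∈ simples d) : inversions (rot d ^ z * l.prod) ≤ l.length := by
  induction l using List.reverseRecOn with
  | nil => simp [inversions_rot_zpow]
  | append_singleton l s ih =>
    obtain ⟨hd, i, rfl⟩ := hl s (by simp)
    have := ih fun t ht => hl t (by simp [ht])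
    rw [List.prod_append, List.prod_singleton, ← mul_assoc, List.length_append]
    exact (inversions_mul_simple_le hd _ i).trans (by simpa using this)

theorem exists_word_length_inversions [NeZero d] (k : ℕ) (g : ExtWeyl d) (hk : inversions g = k) :
    ∃ (z : ℤ) (l : List (ExtWeyl d)),
      (∀ s ∈ l, s ∈ simples d) ∧ l.length = k ∧ g = rot d ^ z * l.prod := by
  induction k generalizing g with
  | zero =>
    refine ⟨g.1 0, [], by simp, rfl, ?_⟩
    rw [List.prod_nil, mul_one]
    apply eq_rot_zpow_of_ascending
    intro i
    refine lt_of_le_of_ne (not_lt.mp fun h => ?_) (apply_succ_ne g i)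
    have := inversions_mul_simple_of_gt g i h
    omega
  | succ k ih =>
    by_cases hg : ∃ i : ℤ, g.1 (i + 1) < g.1 i
    · obtain ⟨i, hi⟩ := hg
      have h1 := inversions_mul_simple_of_gt g i hi
      obtain ⟨z, l, hl, hlen, e⟩ := ih (g * simple d i) (by omega)
      refine ⟨z, l ++ [simple d i], ?_, by simp [hlen], ?_⟩
      · intro s hs
        rcases List.mem_append.mp hs with hs | hs
        · exact hl s hs
        · rw [List.mem_singleton] at hs
          exact ⟨two_le_of_descent hi, i, hs⟩
      · rw [List.prod_append, List.prod_singleton, ← mul_assoc, ← e, mul_assoc, simple_mul_self,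
          mul_one]
    · push Not at hg
      have := eq_rot_zpow_of_ascending g fun i => lt_of_le_of_ne (hg i) (apply_succ_ne g i)
      rw [this, inversions_rot_zpow] at hk
      omega

/-- Each simple reflection in a word adds at most one inversion, which bounds the length below.
Removing descents one at a time removes exactly one inversion each and ends at a rotation, which
gives a word of that length. -/
theorem len_eq_inversions [NeZero d] (g : ExtWeyl d) : len g = inversions g := by
  apply le_antisymm
  · obtain ⟨z, l, hl, hlen, e⟩ := exists_word_length_inversions _ g rfl
    rw [← hlen]
    conv_lhs => rw [e]
    exact len_le z l hl
  · obtain ⟨z, l, hl, hlen, e⟩ := exists_reduced g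
    rw [← hlen]
    conv_lhs => rw [e]
    exact inversions_le_length z l hl

theorem len_mul_simple_of_lt [NeZero d] (hd : 2 ≤ d) {g : ExtWeyl d} {i : ℤ}
    (h : g.1 i < g.1 (i + 1)) : len (g * simple d i) = len g + 1 := by
  rw [len_eq_inversions, len_eq_inversions, inversions_mul_simple hd g i h]

theorem len_mul_simple_of_gt [NeZero d] {g : ExtWeyl d} {i : ℤ}
    (h : g.1 (i + 1) < g.1 i) : len (g * simple d i) + 1 = len g := by
  rw [len_eq_inversions, len_eq_inversions, inversions_mul_simple_of_gt g i h]

theorem len_simple_mul_of_lt [NeZero d] (hd : 2 ≤ d) {g : ExtWeyl d} {i : ℤ}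
    (h : (g⁻¹).1 i < (g⁻¹).1 (i + 1)) : len (simple d i * g) = len g + 1 := by
  rw [← len_inv, ← len_inv g, ← len_mul_simple_of_lt hd h, mul_inv_rev, simple_inv]

theorem len_simple_mul_of_gt [NeZero d] {g : ExtWeyl d} {i : ℤ}
    (h : (g⁻¹).1 (i + 1) < (g⁻¹).1 i) : len (simple d i * g) + 1 = len g := by
  rw [← len_inv, ← len_inv g, ← len_mul_simple_of_gt h, mul_inv_rev, simple_inv]

theorem eq_rot_zpow_of_len_eq_zero [NeZero d] {g : ExtWeyl d} (h : len g = 0) :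
    g = rot d ^ (g.1 0) := by
  apply eq_rot_zpow_of_ascending
  intro i
  refine lt_of_le_of_ne (not_lt.mp fun hi => ?_) (apply_succ_ne g i)
  have := len_mul_simple_of_gt hi
  omega

theorem len_rot_zpow_mul [NeZero d] (z : ℤ) (g : ExtWeyl d) : len (rot d ^ z * g) = len g := by
  rw [len_eq_inversions, len_eq_inversions]
  apply Finset.sum_congr rfl
  intro j _
  congr 1
  ext t
  simp only [invSet, mul_coe_apply, rot_zpow_apply, Set.mem_ofPred_eq, add_lt_add_iff_right]

theorem len_mul_rot_zpow [NeZero d] (z : ℤ) (g : ExtWeyl d) : len (g * rot d ^ z) = len g := by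
  rw [← len_inv, mul_inv_rev, ← zpow_neg, len_rot_zpow_mul, len_inv]

theorem len_one [NeZero d] : len (1 : ExtWeyl d) = 0 := by
  simpa using len_rot_zpow (d := d) 0

theorem len_mul_le [NeZero d] (g h : ExtWeyl d) : len (g * h) ≤ len g + len h := by
  obtain ⟨z, l, hl, hlen, e⟩ := exists_reduced h
  have key : ∀ l : List (ExtWeyl d), (∀ s ∈ l, s ∈ simples d) →
      len (g * (rot d ^ z * l.prod)) ≤ len g + l.length := by
    intro l
    induction l using List.reverseRecOn with
    | nil => intro _; simp [len_mul_rot_zpow]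
    | append_singleton l s ih =>
      intro hl
      obtain ⟨hd, i, rfl⟩ := hl s (by simp)
      have := ih fun t ht => hl t (by simp [ht])
      rw [List.prod_append, List.prod_singleton, ← mul_assoc, ← mul_assoc, List.length_append,
        mul_assoc g]
      have h2 := inversions_mul_simple_le hd (g * (rot d ^ z * l.prod)) i
      rw [← len_eq_inversions, ← len_eq_inversions] at h2
      simp only [List.length_singleton]
      omega
  rw [← hlen, e]
  exact key l hl

end Length

end AffineSchur
namespace AffineSchur

/-! ### Stabilizers of cuts -/

section Stab

variable {d : ℕ}

/-- A set of integers invariant under translation by `d`. -/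
def PeriodicSet (d : ℕ) (Z : Set ℤ) : Prop := ∀ z : ℤ, z + d ∈ Z ↔ z ∈ Z

theorem PeriodicSet.add_mul {Z : Set ℤ} (hZ : PeriodicSet d Z) (z k : ℤ) :
    z + k * d ∈ Z ↔ z ∈ Z := by
  induction k using Int.induction_on with
  | zero => simp
  | succ k ih => rw [← ih, ← hZ (z + k * d)]; ring_nf
  | pred k ih =>
    rw [← ih, ← hZ (z + (-(k : ℤ) - 1) * d)]
    ring_nf

theorem PeriodicSet.mem_iff_of_dvd {Z : Set ℤ} (hZ : PeriodicSet d Z) {t i : ℤ}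
    (h : (d : ℤ) ∣ t - i) : t ∈ Z ↔ i ∈ Z := by
  obtain ⟨k, hk⟩ := h
  rw [show t = i + k * d by linarith, hZ.add_mul]

/-- The permutations that preserve each cut of `ℤ` into `t ≤ z` and `t > z`, for `z ∈ Z`. -/
def stab (d : ℕ) (Z : Set ℤ) : Subgroup (ExtWeyl d) where
  carrier := {g | ∀ z ∈ Z, ∀ t, g.1 t ≤ z ↔ t ≤ z}
  mul_mem' := by
    intro a b ha hb z hz t
    rw [mul_coe_apply, ha z hz, hb z hz]
  one_mem' := by intro z _ t; rfl
  inv_mem' := by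
    intro a ha z hz t
    rw [← ha z hz, coe_apply_inv_self]

theorem mem_stab {Z : Set ℤ} {g : ExtWeyl d} :
    g ∈ stab d Z ↔ ∀ z ∈ Z, ∀ t, g.1 t ≤ z ↔ t ≤ z := Iff.rfl

theorem simple_mem_stab {Z : Set ℤ} (hZ : PeriodicSet d Z) (hd : 2 ≤ d) {i : ℤ} (hi : i ∉ Z) :
    simple d i ∈ stab d Z := by
  intro z hz t
  rw [simple_apply hd]
  split_ifs with h1 h2
  · have : t ≠ z := by
      rintro rfl
      exact hi ((hZ.mem_iff_of_dvd h1).mp hz)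
    omega
  · have : t - 1 ≠ z := by
      rintro rfl
      exact hi ((hZ.mem_iff_of_dvd (by rwa [sub_sub, add_comm 1 i])).mp hz)
    omega
  · rfl

theorem notMem_of_simple_mem_stab {Z : Set ℤ} (hd : 2 ≤ d) {i : ℤ}
    (h : simple d i ∈ stab d Z) : i ∉ Z := by
  intro hi
  have := h i hi i
  rw [simple_apply_self hd] at this
  omega

theorem stab_apply_lt_of_mem {Z : Set ℤ} {g : ExtWeyl d} (hg : g ∈ stab d Z) {i : ℤ} (hi : i ∈ Z) :
    g.1 i < g.1 (i + 1) := by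
  have h1 := hg i hi i
  have h2 := hg i hi (i + 1)
  omega

/-- A translation that preserves even one cut is trivial. This is why the set of cuts is assumed
nonempty from here on: stabilizers then contain no nontrivial element of length zero. -/
theorem rot_zpow_mem_stab {Z : Set ℤ} (hne : Z.Nonempty) {z : ℤ} (h : rot d ^ z ∈ stab d Z) :
    rot d ^ z = 1 := by
  obtain ⟨a, ha⟩ := hne
  have h1 := h a ha a
  have h2 := h a ha (a + 1)
  have h3 := h a ha (a - z)
  rw [rot_zpow_apply] at h1 h2 h3
  obtain rfl : z = 0 := by omega
  exact zpow_zero _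

theorem eq_one_of_mem_stab {Z : Set ℤ} (hne : Z.Nonempty) {g : ExtWeyl d} (hg : g ∈ stab d Z)
    (h : ∀ i ∉ Z, g.1 i < g.1 (i + 1)) : g = 1 := by
  have e := eq_rot_zpow_of_ascending g fun i => by
    by_cases hi : i ∈ Z
    · exact stab_apply_lt_of_mem hg hi
    · exact h i hi
  rw [e] at hg ⊢
  exact rot_zpow_mem_stab hne hg

theorem eq_one_of_mem_stab_of_len [NeZero d] {Z : Set ℤ} (hne : Z.Nonempty) {g : ExtWeyl d}
    (hg : g ∈ stab d Z) (h : len g = 0) : g = 1 := by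
  have e := eq_rot_zpow_of_len_eq_zero h
  rw [e] at hg ⊢
  exact rot_zpow_mem_stab hne hg

/-- Induction along the ascending right multiplications by simple reflections in a stabilizer. -/
theorem stab_induction [NeZero d] {Z : Set ℤ} (hZ : PeriodicSet d Z) (hne : Z.Nonempty)
    {P : ExtWeyl d → Prop} (one : P 1)
    (mul : ∀ x ∈ stab d Z, ∀ i ∉ Z, 2 ≤ d → x.1 i < x.1 (i + 1) → P x → P (x * simple d i))
    (g : ExtWeyl d) (hg : g ∈ stab d Z) : P g := by
  obtain ⟨k, hk⟩ : ∃ k, len g = k := ⟨_, rfl⟩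
  induction k generalizing g with
  | zero => rw [eq_one_of_mem_stab_of_len hne hg hk]; exact one
  | succ k ih =>
    by_cases h : ∃ i ∉ Z, g.1 (i + 1) < g.1 i
    · obtain ⟨i, hi, h⟩ := h
      have hd := two_le_of_descent h
      have hs := simple_mem_stab hZ hd hi
      have e : g = g * simple d i * simple d i := by rw [mul_assoc, simple_mul_self, mul_one]
      have hl := len_mul_simple_of_gt h
      rw [e]
      refine mul _ ((stab d Z).mul_mem hg hs) i hi hd ?_
        (ih _ ((stab d Z).mul_mem hg hs) (by omega))
      rwa [mul_coe_apply, mul_coe_apply, simple_apply_self hd, simple_apply_succ hd]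
    · push Not at h
      rw [eq_one_of_mem_stab hne hg fun i hi => lt_of_le_of_ne (h i hi) (apply_succ_ne g i)]
      exact one

/-- An element preserving the cuts `a` and `a + d` permutes the interval between them, and by
periodicity it is determined by its values there. -/
theorem finite_stab [NeZero d] {Z : Set ℤ} (hZ : PeriodicSet d Z) (hne : Z.Nonempty) :
    (stab d Z : Set (ExtWeyl d)).Finite := by
  obtain ⟨a, ha⟩ := hne
  have ha' : a + d ∈ Z := (hZ a).mpr ha
  have hd := natCast_pos_of_neZero (d := d)
  let f : stab d Z → (Fin d → Set.Ioc a (a + d)) := fun g k =>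
    ⟨g.1.1 (a + 1 + k), by
      have h1 := g.2 a ha (a + 1 + k)
      have h2 := g.2 (a + d) ha' (a + 1 + k)
      have := k.2
      constructor <;> omega⟩
  have hf : Function.Injective f := by
    intro g h e
    apply Subtype.ext
    apply Subtype.ext
    ext t
    have h0 := Int.emod_nonneg (t - a - 1) hd.ne'
    have h1 := Int.emod_lt_of_pos (t - a - 1) hd
    have h2 := Int.emod_add_mul_ediv (t - a - 1) d
    have e1 := congrArg Subtype.val (congrFun e ⟨((t - a - 1) % d).toNat, by omega⟩)
    simp only [f, Int.toNat_of_nonneg h0] at e1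
    have ht : t = a + 1 + (t - a - 1) % d + (t - a - 1) / d * d := by linarith
    rw [ht, apply_add_mul, apply_add_mul, e1]
  exact Set.finite_coe_iff.mp (Finite.of_injective f hf)

/-- `y` is the shortest element of its right coset of the stabilizer of `Z`. -/
def IsLeftMin (Z : Set ℤ) (y : ExtWeyl d) : Prop := ∀ i ∉ Z, (y⁻¹).1 i < (y⁻¹).1 (i + 1)

theorem lt_of_forall_lt_succ {f : ℤ → ℤ} {a b : ℤ} (hab : a < b)
    (h : ∀ t, a ≤ t → t < b → f t < f (t + 1)) : f a < f b := by
  obtain ⟨k, rfl⟩ : ∃ k : ℕ, b = a + 1 + k := ⟨(b - a - 1).toNat, by omega⟩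
  induction k with
  | zero => simpa using h a le_rfl (by omega)
  | succ k ih =>
    refine (ih (by omega) fun t h1 h2 => h t h1 (by omega)).trans ?_
    have := h (a + 1 + k) (by omega) (by push_cast; omega)
    rwa [show a + 1 + ((k + 1 : ℕ) : ℤ) = a + 1 + k + 1 by push_cast; ring]

theorem IsLeftMin.lt {Z : Set ℤ} {y : ExtWeyl d} (hy : IsLeftMin Z y) {a b : ℤ} (hab : a < b)
    (h : ∀ z ∈ Z, z < a ∨ b ≤ z) : (y⁻¹).1 a < (y⁻¹).1 b :=
  lt_of_forall_lt_succ hab fun t h1 h2 => hy t fun ht => by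
    have := h t ht
    omega

theorem stab_no_cut {Z : Set ℤ} {x : ExtWeyl d} (hx : x ∈ stab d Z) {a b : ℤ}
    (h : ∀ z ∈ Z, z < a ∨ b ≤ z) : ∀ z ∈ Z, z < x.1 a ∨ x.1 b ≤ z := by
  intro z hz
  have h1 := hx z hz a
  have h2 := hx z hz b
  have := h z hz
  omega

theorem no_cut_succ {Z : Set ℤ} {i : ℤ} (hi : i ∉ Z) : ∀ z ∈ Z, z < i ∨ i + 1 ≤ z := by
  intro z hz
  have : z ≠ i := fun h => hi (h ▸ hz)
  omega

/-- Passing from `x` to `x s_i` multiplies `x⁻¹ y` by `s_i` on the left. Since `x i < x (i + 1)` and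
no cut separates these two values, `y⁻¹`, which increases between cuts, keeps their order, so the
length goes up. The inverse turns the right-handed induction principle into a left multiplication.
-/
theorem len_inv_mul_of_isLeftMin [NeZero d] {Z : Set ℤ} (hZ : PeriodicSet d Z) (hne : Z.Nonempty)
    {y : ExtWeyl d} (hy : IsLeftMin Z y) (x : ExtWeyl d) (hx : x ∈ stab d Z) :
    len (x⁻¹ * y) = len x + len y := by
  refine stab_induction (P := fun x => len (x⁻¹ * y) = len x + len y) hZ hne
    (by simp [len_one]) ?_ x hx
  intro x hx i hi hd hlt ih
  rw [mul_inv_rev, simple_inv, mul_assoc, len_simple_mul_of_lt hd, ih, len_mul_simple_of_lt hd hlt]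
  · ring
  · rw [mul_inv_rev, inv_inv, mul_coe_apply, mul_coe_apply]
    exact hy.lt hlt (stab_no_cut hx (no_cut_succ hi))

theorem len_mul_of_isLeftMin [NeZero d] {Z : Set ℤ} (hZ : PeriodicSet d Z) (hne : Z.Nonempty)
    {y : ExtWeyl d} (hy : IsLeftMin Z y) {x : ExtWeyl d} (hx : x ∈ stab d Z) :
    len (x * y) = len x + len y := by
  have := len_inv_mul_of_isLeftMin hZ hne hy x⁻¹ ((stab d Z).inv_mem hx)
  rwa [inv_inv, len_inv] at this

theorem exists_isLeftMin [NeZero d] {Z : Set ℤ} (hZ : PeriodicSet d Z) (w : ExtWeyl d) :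
    ∃ x ∈ stab d Z, ∃ y, IsLeftMin Z y ∧ w = x * y := by
  obtain ⟨k, hk⟩ : ∃ k, len w = k := ⟨_, rfl⟩
  induction k using Nat.strong_induction_on generalizing w with
  | _ k ih =>
    by_cases h : ∃ i ∉ Z, (w⁻¹).1 (i + 1) < (w⁻¹).1 i
    · obtain ⟨i, hi, h⟩ := h
      have hl := len_simple_mul_of_gt h
      obtain ⟨x, hx, y, hy, e⟩ := ih (len (simple d i * w)) (by omega) _ rfl
      refine ⟨simple d i * x, (stab d Z).mul_mem
        (simple_mem_stab hZ (two_le_of_descent h) hi) hx, y, hy, ?_⟩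
      rw [mul_assoc, ← e, ← mul_assoc, simple_mul_self, one_mul]
    · push Not at h
      exact ⟨1, (stab d Z).one_mem, w, fun i hi =>
        lt_of_le_of_ne (h i hi) (apply_succ_ne _ i), (one_mul w).symm⟩

/-- Both `y` and `x y` are shortest in the same coset, so length additivity in both directions
forces `len x = 0`. Shortest representatives are therefore unique. -/
theorem IsLeftMin.eq_one_of_mul [NeZero d] {Z : Set ℤ} (hZ : PeriodicSet d Z) (hne : Z.Nonempty)
    {x y : ExtWeyl d} (hy : IsLeftMin Z y) (hx : x ∈ stab d Z) (hxy : IsLeftMin Z (x * y)) :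
    x = 1 := by
  have h1 := len_mul_of_isLeftMin hZ hne hy hx
  have h2 := len_mul_of_isLeftMin hZ hne hxy ((stab d Z).inv_mem hx)
  rw [inv_mul_cancel_left, len_inv] at h2
  exact eq_one_of_mem_stab_of_len hne hx (by omega)

/-! ### Longest elements of stabilizers. -/

theorem exists_longest [NeZero d] {Z : Set ℤ} (hZ : PeriodicSet d Z) (hne : Z.Nonempty) :
    ∃ w ∈ stab d Z, ∀ i ∉ Z, 2 ≤ d → w.1 (i + 1) < w.1 i := by
  obtain ⟨w, hw, hmax⟩ := Set.exists_max_image (stab d Z : Set (ExtWeyl d)) len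
    (finite_stab hZ hne) ⟨1, (stab d Z).one_mem⟩
  refine ⟨w, hw, fun i hi hd => ?_⟩
  by_contra h
  have h1 := len_mul_simple_of_lt hd (lt_of_le_of_ne (not_lt.mp h) (apply_succ_ne w i))
  have h2 := hmax _ ((stab d Z).mul_mem hw (simple_mem_stab hZ hd hi))
  omega

theorem lt_of_forall_succ_lt {f : ℤ → ℤ} {a b : ℤ} (hab : a < b)
    (h : ∀ t, a ≤ t → t < b → f (t + 1) < f t) : f b < f a := by
  have := lt_of_forall_lt_succ (f := fun t => - f t) hab fun t h1 h2 => by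
    have := h t h1 h2
    simpa using this
  simpa using this

theorem two_le_of_notMem [NeZero d] {Z : Set ℤ} (hZ : PeriodicSet d Z) (hne : Z.Nonempty) {i : ℤ}
    (hi : i ∉ Z) : 2 ≤ d := by
  have h0 := NeZero.ne d
  by_contra hd
  obtain rfl : d = 1 := by omega
  obtain ⟨a, ha⟩ := hne
  exact hi ((hZ.mem_iff_of_dvd (by simp)).mp ha)

/-- The positions after `t` that no cut separates from `t`. -/
def afterSet (Z : Set ℤ) (t : ℤ) : Set ℤ := {j | t < j ∧ ∀ z ∈ Z, z < t ∨ j ≤ z}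

/-- The longest element reverses every interval between cuts and preserves the cuts, so it inverts
exactly the pairs that no cut separates. -/
theorem len_longest [NeZero d] {Z : Set ℤ} (hZ : PeriodicSet d Z) (hne : Z.Nonempty)
    {w : ExtWeyl d} (hw : w ∈ stab d Z) (h : ∀ i ∉ Z, 2 ≤ d → w.1 (i + 1) < w.1 i) (a : ℤ) :
    len w = ∑ j ∈ Finset.range d, (afterSet Z (a + j)).ncard := by
  rw [len_eq_inversions, inversions_eq w a]
  apply Finset.sum_congr rfl
  intro k _
  congr 1
  ext j
  simp only [invSet, afterSet, Set.mem_ofPred_eq]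
  refine and_congr_right fun hj => ⟨fun h1 z hz => ?_, fun h1 => ?_⟩
  · have h2 := hw z hz (a + k)
    have h3 := hw z hz j
    omega
  · apply lt_of_forall_succ_lt hj
    intro t h2 h3
    have ht : t ∉ Z := fun ht => by
      have := h1 t ht
      omega
    exact h t ht (two_le_of_notMem hZ hne ht)

/-- Each ascending step `x` to `x s_i` stays inside an interval that `w` reverses, so it is a
descending step for `w x`. -/
theorem len_longest_mul [NeZero d] {Z : Set ℤ} (hZ : PeriodicSet d Z) (hne : Z.Nonempty)
    {w : ExtWeyl d} (h : ∀ i ∉ Z, 2 ≤ d → w.1 (i + 1) < w.1 i)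
    (x : ExtWeyl d) (hx : x ∈ stab d Z) : len (w * x) + len x = len w := by
  refine stab_induction (P := fun x => len (w * x) + len x = len w) hZ hne
    (by simp [len_one]) ?_ x hx
  intro x hx i hi hd hlt ih
  have h1 : (w * x).1 (i + 1) < (w * x).1 i := by
    rw [mul_coe_apply, mul_coe_apply]
    apply lt_of_forall_succ_lt hlt
    intro t h1 h2
    refine h t (fun ht => ?_) hd
    have := stab_no_cut hx (no_cut_succ hi) t ht
    omega
  have h2 := len_mul_simple_of_gt h1
  rw [← mul_assoc, len_mul_simple_of_lt hd hlt]
  omega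

theorem sSup_len_stab [NeZero d] {Z : Set ℤ} (hZ : PeriodicSet d Z) (hne : Z.Nonempty)
    {w : ExtWeyl d} (hw : w ∈ stab d Z) (h : ∀ i ∉ Z, 2 ≤ d → w.1 (i + 1) < w.1 i) :
    sSup (len '' (stab d Z : Set (ExtWeyl d))) = len w := by
  apply IsGreatest.csSup_eq
  refine ⟨⟨w, hw, rfl⟩, ?_⟩
  rintro _ ⟨x, hx, rfl⟩
  have := len_longest_mul hZ hne h x hx
  omega

theorem stab_union (Z Z' : Set ℤ) : stab d (Z ∪ Z') = stab d Z ⊓ stab d Z' := by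
  ext g
  simp only [Subgroup.mem_inf, mem_stab]
  constructor
  · exact fun h => ⟨fun z hz => h z (Or.inl hz), fun z hz => h z (Or.inr hz)⟩
  · rintro ⟨h1, h2⟩ z (hz | hz)
    · exact h1 z hz
    · exact h2 z hz

/-- Together with `stab_union`, this identifies `W_l ∩ π^z W_m π^{-z}` as the stabilizer of one set
of cuts, to which all results on stabilizers apply. -/
theorem mem_stab_image_add (Z : Set ℤ) (z : ℤ) (g : ExtWeyl d) :
    g ∈ stab d ((fun t => t + z) '' Z) ↔ (rot d ^ z)⁻¹ * g * rot d ^ z ∈ stab d Z := by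
  simp only [mem_stab, Set.forall_mem_image, ← zpow_neg, mul_coe_apply, rot_zpow_apply]
  refine forall_congr' fun a => forall_congr' fun ha => ?_
  constructor
  · intro h t
    have := h (t + z)
    omega
  · intro h t
    have := h (t - z)
    rw [sub_add_cancel] at this
    omega

theorem PeriodicSet.union {Z Z' : Set ℤ} (hZ : PeriodicSet d Z) (hZ' : PeriodicSet d Z') :
    PeriodicSet d (Z ∪ Z') := fun z => or_congr (hZ z) (hZ' z)

theorem PeriodicSet.image_add {Z : Set ℤ} (hZ : PeriodicSet d Z) (a : ℤ) :
    PeriodicSet d ((fun t => t + a) '' Z) := by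
  have h : ∀ t, t ∈ (fun t => t + a) '' Z ↔ t - a ∈ Z := fun t => by
    simp [sub_eq_add_neg]
  intro z
  rw [h, h, ← hZ (z - a)]
  ring_nf

end Stab

end AffineSchur
namespace AffineSchur

/-! ### The standard basis of the Hecke algebra -/

section HeckeBasis

variable {d : ℕ}

/-- The free module on `ExtWeyl d`. -/
abbrev FreeMod (d : ℕ) : Type := ExtWeyl d →₀ Coeff

open Classical in
/-- Left multiplication by `T_{s_i}` on the free module. -/
noncomputable def leftOp (d : ℕ) (i : ℤ) : Module.End Coeff (FreeMod d) :=
  Finsupp.linearCombination Coeff fun w : ExtWeyl d =>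
    if (w⁻¹).1 i < (w⁻¹).1 (i + 1) then Finsupp.single (simple d i * w) (1 : Coeff)
    else (vpow 2 - 1) • Finsupp.single w (1 : Coeff) +
      vpow 2 • Finsupp.single (simple d i * w) (1 : Coeff)

open Classical in
/-- Right multiplication by `T_{s_i}` on the free module. -/
noncomputable def rightOp (d : ℕ) (i : ℤ) : Module.End Coeff (FreeMod d) :=
  Finsupp.linearCombination Coeff fun w : ExtWeyl d =>
    if w.1 i < w.1 (i + 1) then Finsupp.single (w * simple d i) (1 : Coeff)
    else (vpow 2 - 1) • Finsupp.single w (1 : Coeff) +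
      vpow 2 • Finsupp.single (w * simple d i) (1 : Coeff)

/-- Left multiplication by `T_{π^z}` on the free module. -/
noncomputable def leftRot (d : ℕ) (z : ℤ) : Module.End Coeff (FreeMod d) :=
  Finsupp.lmapDomain Coeff Coeff fun w => rot d ^ z * w

/-- Right multiplication by `T_{π^z}` on the free module. -/
noncomputable def rightRot (d : ℕ) (z : ℤ) : Module.End Coeff (FreeMod d) :=
  Finsupp.lmapDomain Coeff Coeff fun w => w * rot d ^ z

/-- The basis vector at `w`. -/
noncomputable def delta (w : ExtWeyl d) : FreeMod d := Finsupp.single w 1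

theorem leftOp_delta_of_lt {w : ExtWeyl d} {i : ℤ} (h : (w⁻¹).1 i < (w⁻¹).1 (i + 1)) :
    leftOp d i (delta w) = delta (simple d i * w) := by
  simp only [leftOp, delta, Finsupp.linearCombination_single, if_pos h, one_smul]

theorem leftOp_delta_of_gt {w : ExtWeyl d} {i : ℤ} (h : (w⁻¹).1 (i + 1) < (w⁻¹).1 i) :
    leftOp d i (delta w) = (vpow 2 - 1) • delta w + vpow 2 • delta (simple d i * w) := by
  simp only [leftOp, delta, Finsupp.linearCombination_single, if_neg h.not_gt, one_smul]

theorem rightOp_delta_of_lt {w : ExtWeyl d} {i : ℤ} (h : w.1 i < w.1 (i + 1)) :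
    rightOp d i (delta w) = delta (w * simple d i) := by
  simp only [rightOp, delta, Finsupp.linearCombination_single, if_pos h, one_smul]

theorem rightOp_delta_of_gt {w : ExtWeyl d} {i : ℤ} (h : w.1 (i + 1) < w.1 i) :
    rightOp d i (delta w) = (vpow 2 - 1) • delta w + vpow 2 • delta (w * simple d i) := by
  simp only [rightOp, delta, Finsupp.linearCombination_single, if_neg h.not_gt, one_smul]

theorem leftRot_delta (w : ExtWeyl d) (z : ℤ) :
    leftRot d z (delta w) = delta (rot d ^ z * w) := by
  simp [leftRot, delta]

theorem rightRot_delta (w : ExtWeyl d) (z : ℤ) :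
    rightRot d z (delta w) = delta (w * rot d ^ z) := by
  simp [rightRot, delta]

theorem end_ext {f g : Module.End Coeff (FreeMod d)} (h : ∀ w, f (delta w) = g (delta w)) :
    f = g :=
  Finsupp.lhom_ext' fun w => LinearMap.ext_ring (h w)

theorem simple_apply_lt_of_lt (hd : 2 ≤ d) {j a b : ℤ} (hab : a < b)
    (h : ¬ ((d : ℤ) ∣ a - j ∧ b = a + 1)) : (simple d j).1 a < (simple d j).1 b := by
  have hne : (simple d j).1 a ≠ (simple d j).1 b := (simple d j).1.injective.ne hab.ne
  have hb : ∀ t, (simple d j).1 t ≤ t + 1 ∧ t - 1 ≤ (simple d j).1 t := fun t => by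
    rw [simple_apply hd]; split_ifs <;> omega
  have h1 := hb a
  have h2 := hb b
  by_cases e : b = a + 1
  · have : (simple d j).1 a ≤ a := by
      have h3 : ¬ (d : ℤ) ∣ a - j := fun h' => h ⟨h', e⟩
      rw [simple_apply hd, if_neg h3]
      split_ifs <;> omega
    omega
  · omega

/-- The two operators interfere only if `s_i` exchanges precisely the values that `w` takes at the
positions exchanged by `s_j`. In that case `s_i w = w s_j`, and `w` ascends on the left exactly when
it ascends on the right. Otherwise neither multiplication changes the ascent seen by the other, and
the four cases are checked directly. -/
theorem leftOp_rightOp_comm (hd : 2 ≤ d) (i j : ℤ) :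
    leftOp d i * rightOp d j = rightOp d j * leftOp d i := by
  have aR : ∀ w : ExtWeyl d, (w * simple d j).1 j = w.1 (j + 1) := fun w => by
    rw [mul_coe_apply, simple_apply_self hd]
  have aR' : ∀ w : ExtWeyl d, (w * simple d j).1 (j + 1) = w.1 j := fun w => by
    rw [mul_coe_apply, simple_apply_succ hd]
  have aL : ∀ w : ExtWeyl d, ((simple d i * w)⁻¹).1 i = (w⁻¹).1 (i + 1) := fun w => by
    rw [mul_inv_rev, simple_inv, mul_coe_apply, simple_apply_self hd]
  have aL' : ∀ w : ExtWeyl d, ((simple d i * w)⁻¹).1 (i + 1) = (w⁻¹).1 i := fun w => by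
    rw [mul_inv_rev, simple_inv, mul_coe_apply, simple_apply_succ hd]
  -- the case in which the two multiplications agree
  have special : ∀ w : ExtWeyl d, simple d i * w = w * simple d j →
      ((w⁻¹).1 i < (w⁻¹).1 (i + 1) ↔ w.1 j < w.1 (j + 1)) →
      leftOp d i (rightOp d j (delta w)) = rightOp d j (leftOp d i (delta w)) := by
    intro w hw hiff
    have hw' : simple d i * (simple d i * w) = w := by
      rw [← mul_assoc, simple_mul_self, one_mul]
    have hw'' : simple d i * w * simple d j = w := by
      rw [hw, mul_assoc, simple_mul_self, mul_one]
    rcases lt_or_gt_of_ne (apply_succ_ne w j) with h | h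
    · have h' := hiff.mpr h
      rw [rightOp_delta_of_lt h, leftOp_delta_of_lt h', ← hw,
        leftOp_delta_of_gt (by rw [aL, aL']; exact h'),
        rightOp_delta_of_gt (by rw [hw, aR, aR']; exact h), hw', hw'']
    · have h' : (w⁻¹).1 (i + 1) < (w⁻¹).1 i :=
        lt_of_le_of_ne (not_lt.mp fun h' => absurd (hiff.mp h') h.not_gt) (apply_succ_ne _ i).symm
      rw [rightOp_delta_of_gt h, leftOp_delta_of_gt h', ← hw, map_add, map_add, map_smul, map_smul,
        map_smul, map_smul, rightOp_delta_of_gt h, leftOp_delta_of_gt h',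
        leftOp_delta_of_lt (by rw [aL, aL']; exact h'),
        rightOp_delta_of_lt (by rw [hw, aR, aR']; exact h), hw', hw'', hw]
  -- the case in which the two multiplications are independent
  have generic : ∀ w : ExtWeyl d,
      ((w⁻¹).1 i < (w⁻¹).1 (i + 1) ↔ ((w * simple d j)⁻¹).1 i < ((w * simple d j)⁻¹).1 (i + 1)) →
      (w.1 j < w.1 (j + 1) ↔ (simple d i * w).1 j < (simple d i * w).1 (j + 1)) →
      leftOp d i (rightOp d j (delta w)) = rightOp d j (leftOp d i (delta w)) := by
    intro w h1 h2
    have gt_iff : ∀ (u : ExtWeyl d) (k : ℤ), u.1 (k + 1) < u.1 k ↔ ¬ u.1 k < u.1 (k + 1) :=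
      fun u k => by
        have := apply_succ_ne u k
        omega
    rcases lt_or_gt_of_ne (apply_succ_ne w j) with h | h <;>
      rcases lt_or_gt_of_ne (apply_succ_ne w⁻¹ i) with h' | h'
    · rw [rightOp_delta_of_lt h, leftOp_delta_of_lt h', leftOp_delta_of_lt (h1.mp h'),
        rightOp_delta_of_lt (h2.mp h), mul_assoc]
    · have h1' := (gt_iff _ _).mpr (mt h1.mpr h'.not_gt)
      rw [rightOp_delta_of_lt h, leftOp_delta_of_gt h', leftOp_delta_of_gt h1', map_add, map_smul,
        map_smul, rightOp_delta_of_lt h, rightOp_delta_of_lt (h2.mp h), mul_assoc]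
    · have h2' := (gt_iff _ _).mpr (mt h2.mpr h.not_gt)
      rw [rightOp_delta_of_gt h, leftOp_delta_of_lt h', rightOp_delta_of_gt h2', map_add, map_smul,
        map_smul, leftOp_delta_of_lt h', leftOp_delta_of_lt (h1.mp h'), mul_assoc]
    · have h1' := (gt_iff _ _).mpr (mt h1.mpr h'.not_gt)
      have h2' := (gt_iff _ _).mpr (mt h2.mpr h.not_gt)
      rw [rightOp_delta_of_gt h, leftOp_delta_of_gt h', map_add, map_add, map_smul, map_smul,
        map_smul, map_smul, leftOp_delta_of_gt h', rightOp_delta_of_gt h, leftOp_delta_of_gt h1',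
        rightOp_delta_of_gt h2', mul_assoc]
      module
  apply end_ext
  intro w
  change leftOp d i (rightOp d j (delta w)) = rightOp d j (leftOp d i (delta w))
  -- `s_i w = w s_j` as soon as the swapped positions match the swapped values
  have match_eq : ∀ k : ℤ, ((w.1 j = i + k * d ∧ w.1 (j + 1) = i + 1 + k * d) ∨
      (w.1 (j + 1) = i + k * d ∧ w.1 j = i + 1 + k * d)) → simple d i * w = w * simple d j := by
    intro k hk
    ext t
    change (simple d i).1 (w.1 t) = w.1 ((simple d j).1 t)
    have per : ∀ a m : ℤ, (simple d i).1 (a + m * d) = (simple d i).1 a + m * d :=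
      apply_add_mul _
    have s0 := simple_apply_self hd i
    have s1 := simple_apply_succ hd i
    by_cases h1 : (d : ℤ) ∣ t - j
    · obtain ⟨m, hm⟩ := h1
      obtain rfl : t = j + m * d := by linarith
      rw [apply_add_mul, apply_add_mul, apply_add_mul, simple_apply_self hd, apply_add_mul]
      rcases hk with ⟨h3, h4⟩ | ⟨h3, h4⟩ <;> rw [h3, h4, per]
      · rw [s0]
      · rw [s1]
    · by_cases h2 : (d : ℤ) ∣ t - (j + 1)
      · obtain ⟨m, hm⟩ := h2
        obtain rfl : t = j + 1 + m * d := by linarith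
        rw [apply_add_mul, apply_add_mul, apply_add_mul, simple_apply_succ hd, apply_add_mul]
        rcases hk with ⟨h3, h4⟩ | ⟨h3, h4⟩ <;> rw [h3, h4, per]
        · rw [s1]
        · rw [s0]
      · have ht : (simple d j).1 t = t := by rw [simple_apply hd, if_neg h1, if_neg h2]
        rw [ht]
        have key : ∀ a b m : ℤ, w.1 a = b → w.1 t - b = m * d → (d : ℤ) ∣ t - a := by
          intro a b m e1 e2
          have : w.1 t = w.1 (a + m * d) := by rw [apply_add_mul, e1]; linarith
          have := w.1.injective this
          exact ⟨m, by rw [this]; ring⟩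
        rw [simple_apply hd, if_neg, if_neg]
        · rintro ⟨m, hm⟩
          rcases hk with ⟨h3, h4⟩ | ⟨h3, h4⟩
          · exact h2 (key (j + 1) _ (m - k) h4 (by linarith))
          · exact h1 (key j _ (m - k) h4 (by linarith))
        · rintro ⟨m, hm⟩
          rcases hk with ⟨h3, h4⟩ | ⟨h3, h4⟩
          · exact h1 (key j _ (m - k) h3 (by linarith))
          · exact h2 (key (j + 1) _ (m - k) h3 (by linarith))
  by_cases hsp : ∃ k : ℤ, ((w.1 j = i + k * d ∧ w.1 (j + 1) = i + 1 + k * d) ∨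
      (w.1 (j + 1) = i + k * d ∧ w.1 j = i + 1 + k * d))
  · obtain ⟨k, hk⟩ := hsp
    apply special w (match_eq k hk)
    have inv_eq : ∀ a b : ℤ, w.1 a = b + k * d → (w⁻¹).1 b = a - k * d := by
      intro a b h
      have h1 : w.1 (a - k * d) = b := by
        have := apply_add_mul w a (-k)
        rw [h, show a + -k * d = a - k * d by ring] at this
        rw [this]; ring
      rw [← h1, inv_coe_apply_self]
    rcases hk with ⟨h3, h4⟩ | ⟨h3, h4⟩
    · rw [inv_eq _ _ h3, inv_eq _ _ h4, h3, h4]; omega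
    · rw [inv_eq _ _ h3, inv_eq _ _ h4, h3, h4]; omega
  · push Not at hsp
    have hcut : ∀ (u : ExtWeyl d) (i j : ℤ), u.1 i ≠ u.1 (i + 1) →
        (∀ k : ℤ, ¬ (u.1 i = j + k * d ∧ u.1 (i + 1) = j + 1 + k * d)) →
        (∀ k : ℤ, ¬ (u.1 (i + 1) = j + k * d ∧ u.1 i = j + 1 + k * d)) →
        (u.1 i < u.1 (i + 1) ↔ (simple d j).1 (u.1 i) < (simple d j).1 (u.1 (i + 1))) := by
      intro u i j hne h1 h2
      rcases lt_or_gt_of_ne hne with h | h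
      · refine iff_of_true h (simple_apply_lt_of_lt hd h ?_)
        rintro ⟨⟨k, hk⟩, e⟩
        exact h1 k ⟨by linarith, by linarith⟩
      · refine iff_of_false h.not_gt (simple_apply_lt_of_lt hd h ?_).not_gt
        rintro ⟨⟨k, hk⟩, e⟩
        exact h2 k ⟨by linarith, by linarith⟩
    have back : ∀ a b k : ℤ, (w⁻¹).1 a = b + k * d → w.1 b = a + (-k) * d := by
      intro a b k h
      have : w.1 (b + k * d) = a := by rw [← h, coe_apply_inv_self]
      rw [apply_add_mul] at this
      linarith
    apply generic w
    · rw [mul_inv_rev, simple_inv, mul_coe_apply, mul_coe_apply]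
      apply hcut w⁻¹ i j (apply_succ_ne _ i)
      · rintro k ⟨h1, h2⟩
        exact (hsp (-k)).1 (back _ _ _ h1) (back _ _ _ h2)
      · rintro k ⟨h1, h2⟩
        exact (hsp (-k)).2 (back _ _ _ h2) (back _ _ _ h1)
    · rw [mul_coe_apply, mul_coe_apply]
      exact hcut w j i (apply_succ_ne _ j) (fun k h => (hsp k).1 h.1 h.2)
        (fun k h => (hsp k).2 h.1 h.2)

theorem leftRot_rightOp_comm (z j : ℤ) : leftRot d z * rightOp d j = rightOp d j * leftRot d z := by
  apply end_ext
  intro w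
  change leftRot d z (rightOp d j (delta w)) = rightOp d j (leftRot d z (delta w))
  have e : ∀ t, (rot d ^ z * w).1 t = w.1 t + z := fun t => by rw [mul_coe_apply, rot_zpow_apply]
  rcases lt_or_gt_of_ne (apply_succ_ne w j) with h | h
  · rw [rightOp_delta_of_lt h, leftRot_delta, leftRot_delta,
      rightOp_delta_of_lt (by rw [e, e]; omega), mul_assoc]
  · rw [rightOp_delta_of_gt h, map_add, map_smul, map_smul, leftRot_delta, leftRot_delta,
      rightOp_delta_of_gt (by rw [e, e]; omega), mul_assoc]

theorem leftOp_rightRot_comm (z i : ℤ) : leftOp d i * rightRot d z = rightRot d z * leftOp d i := by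
  apply end_ext
  intro w
  change leftOp d i (rightRot d z (delta w)) = rightRot d z (leftOp d i (delta w))
  have e : ∀ t, ((w * rot d ^ z)⁻¹).1 t = (w⁻¹).1 t - z := fun t => by
    rw [mul_inv_rev, ← zpow_neg, mul_coe_apply, rot_zpow_apply, sub_eq_add_neg]
  rcases lt_or_gt_of_ne (apply_succ_ne w⁻¹ i) with h | h
  · rw [leftOp_delta_of_lt h, rightRot_delta, rightRot_delta,
      leftOp_delta_of_lt (by rw [e, e]; omega), mul_assoc]
  · rw [leftOp_delta_of_gt h, map_add, map_smul, map_smul, rightRot_delta, rightRot_delta,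
      leftOp_delta_of_gt (by rw [e, e]; omega), mul_assoc]

theorem leftRot_rightRot_comm (z z' : ℤ) :
    leftRot d z * rightRot d z' = rightRot d z' * leftRot d z := by
  apply end_ext
  intro w
  change leftRot d z (rightRot d z' (delta w)) = rightRot d z' (leftRot d z (delta w))
  rw [leftRot_delta, rightRot_delta, rightRot_delta, leftRot_delta, mul_assoc]

/-- `X` commutes with all right multiplications. -/
def CommutesRight (X : Module.End Coeff (FreeMod d)) : Prop :=
  (∀ z, X * rightRot d z = rightRot d z * X) ∧ (2 ≤ d → ∀ i, X * rightOp d i = rightOp d i * X)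

theorem CommutesRight.mul {X Y : Module.End Coeff (FreeMod d)} (hX : CommutesRight X)
    (hY : CommutesRight Y) : CommutesRight (X * Y) := by
  refine ⟨fun z => ?_, fun hd i => ?_⟩
  · rw [mul_assoc, hY.1, ← mul_assoc, hX.1, mul_assoc]
  · rw [mul_assoc, hY.2 hd, ← mul_assoc, hX.2 hd, mul_assoc]

theorem commutesRight_leftRot (z : ℤ) : CommutesRight (leftRot d z) :=
  ⟨fun z' => leftRot_rightRot_comm z z', fun _ i => leftRot_rightOp_comm z i⟩

theorem commutesRight_leftOp (hd : 2 ≤ d) (i : ℤ) : CommutesRight (leftOp d i) :=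
  ⟨fun z' => leftOp_rightRot_comm z' i, fun _ j => leftOp_rightOp_comm hd i j⟩

/-- Induction on `w` along ascending right multiplications. -/
theorem right_induction [NeZero d] {P : ExtWeyl d → Prop} (rot : ∀ z : ℤ, P (rot d ^ z))
    (mul : ∀ x i, 2 ≤ d → x.1 i < x.1 (i + 1) → P x → P (x * simple d i)) (g : ExtWeyl d) : P g := by
  obtain ⟨k, hk⟩ : ∃ k, len g = k := ⟨_, rfl⟩
  induction k generalizing g with
  | zero => rw [eq_rot_zpow_of_len_eq_zero hk]; exact rot _
  | succ k ih =>
    by_cases h : ∃ i, g.1 (i + 1) < g.1 i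
    · obtain ⟨i, h⟩ := h
      have hd := two_le_of_descent h
      have e : g = g * simple d i * simple d i := by rw [mul_assoc, simple_mul_self, mul_one]
      have hl := len_mul_simple_of_gt h
      rw [e]
      refine mul _ i hd ?_ (ih _ (by omega))
      rwa [mul_coe_apply, mul_coe_apply, simple_apply_self hd, simple_apply_succ hd]
    · push Not at h
      rw [eq_rot_zpow_of_ascending g fun i => lt_of_le_of_ne (h i) (apply_succ_ne g i)]
      exact rot _

/-- Induction on `w` along ascending left multiplications. -/
theorem left_induction [NeZero d] {P : ExtWeyl d → Prop} (rot : ∀ z : ℤ, P (rot d ^ z))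
    (mul : ∀ x i, 2 ≤ d → (x⁻¹).1 i < (x⁻¹).1 (i + 1) → P x → P (simple d i * x))
    (g : ExtWeyl d) : P g := by
  have := right_induction (P := fun g => P g⁻¹) (fun z => by rw [← zpow_neg]; exact rot _)
    (fun x i hd h hx => by
      rw [mul_inv_rev, simple_inv]
      exact mul _ i hd (by rwa [inv_inv]) hx) g⁻¹
  rwa [inv_inv] at this

/-- Ascending right multiplications reach every basis vector from `delta 1`, so an operator
commuting with them is determined by its value there. This makes `leftMul` independent of choices
and reduces the relations for it to a check at one vector. -/
theorem CommutesRight.ext [NeZero d] {X Y : Module.End Coeff (FreeMod d)} (hX : CommutesRight X)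
    (hY : CommutesRight Y) (h : X (delta 1) = Y (delta 1)) : X = Y := by
  apply end_ext
  intro w
  induction w using right_induction with
  | rot z =>
    have hX' := LinearMap.congr_fun (hX.1 z) (delta 1)
    have hY' := LinearMap.congr_fun (hY.1 z) (delta 1)
    simp only [Module.End.mul_apply, rightRot_delta, one_mul] at hX' hY'
    rw [hX', hY', h]
  | mul x i hd hlt ih =>
    have hX' := LinearMap.congr_fun (hX.2 hd i) (delta x)
    have hY' := LinearMap.congr_fun (hY.2 hd i) (delta x)
    simp only [Module.End.mul_apply, rightOp_delta_of_lt hlt] at hX' hY'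
    rw [hX', hY', ih]

theorem exists_commutesRight [NeZero d] (w : ExtWeyl d) :
    ∃ X : Module.End Coeff (FreeMod d), CommutesRight X ∧ X (delta 1) = delta w := by
  induction w using left_induction with
  | rot z => exact ⟨leftRot d z, commutesRight_leftRot z, by rw [leftRot_delta, mul_one]⟩
  | mul x i hd hlt ih =>
    obtain ⟨X, hX, e⟩ := ih
    refine ⟨leftOp d i * X, (commutesRight_leftOp hd i).mul hX, ?_⟩
    rw [Module.End.mul_apply, e, leftOp_delta_of_lt hlt]

/-- Left multiplication by `T_w` on the free module. -/
noncomputable def leftMul [NeZero d] (w : ExtWeyl d) : Module.End Coeff (FreeMod d) :=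
  (exists_commutesRight w).choose

theorem commutesRight_leftMul [NeZero d] (w : ExtWeyl d) : CommutesRight (leftMul w) :=
  (exists_commutesRight w).choose_spec.1

theorem leftMul_delta_one [NeZero d] (w : ExtWeyl d) : leftMul w (delta 1) = delta w :=
  (exists_commutesRight w).choose_spec.2

theorem leftMul_rot [NeZero d] (z : ℤ) : leftMul (rot d ^ z) = leftRot d z :=
  (commutesRight_leftMul _).ext (commutesRight_leftRot z) (by
    rw [leftMul_delta_one, leftRot_delta, mul_one])

theorem leftMul_simple_mul [NeZero d] (hd : 2 ≤ d) {w : ExtWeyl d} {i : ℤ}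
    (h : (w⁻¹).1 i < (w⁻¹).1 (i + 1)) : leftMul (simple d i * w) = leftOp d i * leftMul w :=
  (commutesRight_leftMul _).ext ((commutesRight_leftOp hd i).mul (commutesRight_leftMul w)) (by
    rw [leftMul_delta_one, Module.End.mul_apply, leftMul_delta_one, leftOp_delta_of_lt h])

theorem leftMul_simple [NeZero d] (hd : 2 ≤ d) (i : ℤ) : leftMul (simple d i) = leftOp d i := by
  have := leftMul_simple_mul hd (w := 1) (i := i) (by rw [inv_one]; exact lt_add_one i)
  rw [mul_one] at this
  rw [this]
  have h1 : leftMul (1 : ExtWeyl d) = 1 := by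
    have := leftMul_rot (d := d) 0
    rw [zpow_zero] at this
    rw [this]
    apply end_ext
    intro w
    rw [leftRot_delta, zpow_zero, one_mul]
    rfl
  rw [h1, mul_one]

/-- If some left factor `s_i` of `w` descended when applied to `x w'`, then subadditivity would make
`w w'` too short. So additivity of lengths forces every step to be an ascent, where `leftOp` is a
plain translation. -/
theorem leftMul_delta [NeZero d] (w w' : ExtWeyl d) (h : len w + len w' = len (w * w')) :
    leftMul w (delta w') = delta (w * w') := by
  induction w using left_induction with
  | rot z => rw [leftMul_rot, leftRot_delta]
  | mul x i hd hlt ih =>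
    rw [len_simple_mul_of_lt hd hlt, mul_assoc] at h
    have h1 := len_mul_le x w'
    rcases lt_or_gt_of_ne (apply_succ_ne (x * w')⁻¹ i) with h2 | h2
    · have h3 := len_simple_mul_of_lt hd h2
      rw [leftMul_simple_mul hd hlt, Module.End.mul_apply, ih (by omega), leftOp_delta_of_lt h2,
        mul_assoc]
    · have h3 := len_simple_mul_of_gt h2
      omega

theorem leftOp_quad (hd : 2 ≤ d) (i : ℤ) :
    (leftOp d i + 1) * (leftOp d i - algebraMap Coeff _ (vpow 2)) = 0 := by
  apply end_ext
  intro w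
  have aL : ((simple d i * w)⁻¹).1 i = (w⁻¹).1 (i + 1) := by
    rw [mul_inv_rev, simple_inv, mul_coe_apply, simple_apply_self hd]
  have aL' : ((simple d i * w)⁻¹).1 (i + 1) = (w⁻¹).1 i := by
    rw [mul_inv_rev, simple_inv, mul_coe_apply, simple_apply_succ hd]
  have e : simple d i * (simple d i * w) = w := by rw [← mul_assoc, simple_mul_self, one_mul]
  simp only [Module.End.mul_apply, LinearMap.add_apply, LinearMap.sub_apply, Module.End.one_apply,
    Module.algebraMap_end_apply, LinearMap.zero_apply]
  rcases lt_or_gt_of_ne (apply_succ_ne w⁻¹ i) with h | h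
  · rw [leftOp_delta_of_lt h, map_sub, map_smul, leftOp_delta_of_lt h,
      leftOp_delta_of_gt (by rw [aL, aL']; exact h), e]
    module
  · rw [leftOp_delta_of_gt h, map_sub, map_add, map_smul, map_smul, map_smul,
      leftOp_delta_of_gt h, leftOp_delta_of_lt (by rw [aL, aL']; exact h), e]
    module

/-- The left regular representation of the Hecke algebra on the free module. -/
noncomputable def heckeRep (d : ℕ) [NeZero d] : Hecke d →ₐ[Coeff] Module.End Coeff (FreeMod d) :=
  RingQuot.liftAlgHom Coeff ⟨FreeAlgebra.lift Coeff leftMul, by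
    intro a b h
    cases h with
    | one =>
      rw [FreeAlgebra.lift_ι_apply, map_one]
      apply end_ext
      intro w
      rw [leftMul_delta 1 w (by simp [len_one]), one_mul]
      rfl
    | mul w w' h =>
      rw [map_mul, FreeAlgebra.lift_ι_apply, FreeAlgebra.lift_ι_apply, FreeAlgebra.lift_ι_apply]
      exact ((commutesRight_leftMul w).mul (commutesRight_leftMul w')).ext
        (commutesRight_leftMul _) (by
          rw [Module.End.mul_apply, leftMul_delta_one, leftMul_delta_one, leftMul_delta _ _ h])
    | quad s hs =>
      obtain ⟨hd, i, rfl⟩ := hs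
      rw [map_mul, map_add, map_sub, map_one, map_zero, AlgHom.commutes, FreeAlgebra.lift_ι_apply,
        leftMul_simple hd]
      exact leftOp_quad hd i⟩

theorem heckeRep_heckeT [NeZero d] (w : ExtWeyl d) : heckeRep d (heckeT w) = leftMul w := by
  have : heckeRep d (heckeT w) = FreeAlgebra.lift Coeff leftMul (FreeAlgebra.ι Coeff w) :=
    RingQuot.liftAlgHom_mkAlgHom_apply (B := Module.End Coeff (FreeMod d)) Coeff
      (FreeAlgebra.lift Coeff leftMul) _ _
  rw [this, FreeAlgebra.lift_ι_apply]

/-- The coefficients of an element of the Hecke algebra in the basis `T_w`. -/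
noncomputable def heckeCoeff (d : ℕ) [NeZero d] : Hecke d →ₗ[Coeff] FreeMod d :=
  (LinearMap.applyₗ (delta 1)).comp (heckeRep d).toLinearMap

theorem heckeCoeff_heckeT [NeZero d] (w : ExtWeyl d) : heckeCoeff d (heckeT w) = delta w := by
  change heckeRep d (heckeT w) (delta 1) = _
  rw [heckeRep_heckeT, leftMul_delta_one]

/-! ### Multiplication rules for `T_s`, and the basis `T_w`. -/

theorem heckeT_simple_mul_of_lt [NeZero d] (hd : 2 ≤ d) {w : ExtWeyl d} {i : ℤ}
    (h : (w⁻¹).1 i < (w⁻¹).1 (i + 1)) :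
    heckeT (simple d i) * heckeT w = heckeT (simple d i * w) :=
  heckeT_mul (by rw [len_simple_mul_of_lt hd h, len_simple ⟨hd, i, rfl⟩, add_comm])

theorem heckeT_mul_simple_of_lt [NeZero d] (hd : 2 ≤ d) {w : ExtWeyl d} {i : ℤ}
    (h : w.1 i < w.1 (i + 1)) :
    heckeT w * heckeT (simple d i) = heckeT (w * simple d i) :=
  heckeT_mul (by rw [len_mul_simple_of_lt hd h, len_simple ⟨hd, i, rfl⟩])

theorem heckeT_simple_sq (hd : 2 ≤ d) (i : ℤ) :
    heckeT (simple d i) * heckeT (simple d i) =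
      (vpow 2 - 1) • heckeT (simple d i) + vpow 2 • (1 : Hecke d) := by
  have h := heckeT_quad (s := simple d i) ⟨hd, i, rfl⟩
  have e : algebraMap Coeff (Hecke d) (vpow 2) = vpow 2 • (1 : Hecke d) :=
    Algebra.algebraMap_eq_smul_one _
  rw [e, add_mul, mul_sub, one_mul, mul_smul_comm, mul_one] at h
  rw [sub_smul, one_smul, ← sub_eq_zero, ← h]
  abel

theorem heckeT_simple_mul_of_gt [NeZero d] {w : ExtWeyl d} {i : ℤ}
    (h : (w⁻¹).1 (i + 1) < (w⁻¹).1 i) : heckeT (simple d i) * heckeT w =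
      (vpow 2 - 1) • heckeT w + vpow 2 • heckeT (simple d i * w) := by
  have hd := two_le_of_descent h
  have e : simple d i * (simple d i * w) = w := by rw [← mul_assoc, simple_mul_self, one_mul]
  have h1 : heckeT w = heckeT (simple d i) * heckeT (simple d i * w) := by
    rw [heckeT_simple_mul_of_lt hd, e]
    rwa [mul_inv_rev, simple_inv, mul_coe_apply, mul_coe_apply, simple_apply_self hd,
      simple_apply_succ hd]
  conv_lhs => rw [h1, ← mul_assoc, heckeT_simple_sq hd, add_mul, smul_mul_assoc, ← h1,
    smul_mul_assoc, one_mul]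

theorem heckeT_mul_simple_of_gt [NeZero d] {w : ExtWeyl d} {i : ℤ}
    (h : w.1 (i + 1) < w.1 i) : heckeT w * heckeT (simple d i) =
      (vpow 2 - 1) • heckeT w + vpow 2 • heckeT (w * simple d i) := by
  have hd := two_le_of_descent h
  have e : w * simple d i * simple d i = w := by rw [mul_assoc, simple_mul_self, mul_one]
  have h1 : heckeT w = heckeT (w * simple d i) * heckeT (simple d i) := by
    rw [heckeT_mul_simple_of_lt hd, e]
    rwa [mul_coe_apply, mul_coe_apply, simple_apply_self hd, simple_apply_succ hd]
  conv_lhs => rw [h1, mul_assoc, heckeT_simple_sq hd, mul_add, mul_smul_comm, ← h1,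
    mul_smul_comm, mul_one]

theorem heckeT_rot_mul [NeZero d] (z : ℤ) (w : ExtWeyl d) :
    heckeT (rot d ^ z) * heckeT w = heckeT (rot d ^ z * w) :=
  heckeT_mul (by rw [len_rot_zpow_mul, len_rot_zpow, zero_add])

/-- Peeling a reflection off `g` on the right lets it act on `T_w` first, giving a combination of
`T_w` and `T_{s w}`. The induction therefore has to hold for all `w` at once. -/
theorem heckeT_mul_mem_span [NeZero d] (g : ExtWeyl d) (x : Hecke d)
    (hx : x ∈ Submodule.span Coeff (Set.range (heckeT (d := d)))) :
    heckeT g * x ∈ Submodule.span Coeff (Set.range (heckeT (d := d))) := by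
  induction hx using Submodule.span_induction with
  | zero => simp
  | add x y _ _ hx hy => rw [mul_add]; exact Submodule.add_mem _ hx hy
  | smul c x _ hx => rw [mul_smul_comm]; exact Submodule.smul_mem _ c hx
  | mem x hx =>
    obtain ⟨w, rfl⟩ := hx
    induction g using right_induction generalizing w with
    | rot z => rw [heckeT_rot_mul]; exact Submodule.subset_span ⟨_, rfl⟩
    | mul g i hd hlt ih =>
      rw [← heckeT_mul_simple_of_lt hd hlt, mul_assoc]
      rcases lt_or_gt_of_ne (apply_succ_ne w⁻¹ i) with h | h
      · rw [heckeT_simple_mul_of_lt hd h]; exact ih _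
      · rw [heckeT_simple_mul_of_gt h, mul_add, mul_smul_comm, mul_smul_comm]
        exact Submodule.add_mem _ (Submodule.smul_mem _ _ (ih _)) (Submodule.smul_mem _ _ (ih _))

theorem span_heckeT [NeZero d] : Submodule.span Coeff (Set.range (heckeT (d := d))) = ⊤ := by
  rw [eq_top_iff]
  intro x _
  obtain ⟨p, hp, hT⟩ : ∃ p : FreeAlgebra Coeff (ExtWeyl d) →ₐ[Coeff] Hecke d,
      Function.Surjective p ∧ ∀ g, p (FreeAlgebra.ι Coeff g) = heckeT g :=
    ⟨RingQuot.mkAlgHom Coeff (HeckeRel d), RingQuot.mkAlgHom_surjective Coeff (HeckeRel d),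
      fun _ => rfl⟩
  obtain ⟨a, rfl⟩ := hp x
  have key : ∀ (a : FreeAlgebra Coeff (ExtWeyl d)) (y : Hecke d),
      y ∈ Submodule.span Coeff (Set.range (heckeT (d := d))) →
      p a * y ∈ Submodule.span Coeff (Set.range (heckeT (d := d))) := by
    intro a
    induction a using FreeAlgebra.induction with
    | grade0 c =>
      intro y hy
      rw [AlgHom.commutes, ← Algebra.smul_def]
      exact Submodule.smul_mem _ _ hy
    | grade1 g => exact fun y hy => hT g ▸ heckeT_mul_mem_span g y hy
    | mul a b ha hb =>
      intro y hy
      rw [map_mul, mul_assoc]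
      exact ha _ (hb y hy)
    | add a b ha hb =>
      intro y hy
      rw [map_add, add_mul]
      exact Submodule.add_mem _ (ha y hy) (hb y hy)
  have h1 : (1 : Hecke d) ∈ Submodule.span Coeff (Set.range (heckeT (d := d))) :=
    Submodule.subset_span ⟨1, heckeT_one d⟩
  have := key a 1 h1
  rwa [mul_one] at this

theorem linearIndependent_heckeT [NeZero d] :
    LinearIndependent Coeff (heckeT : ExtWeyl d → Hecke d) := by
  apply LinearIndependent.of_comp (heckeCoeff d)
  have : (heckeCoeff d : Hecke d → FreeMod d) ∘ heckeT = delta := funext heckeCoeff_heckeT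
  rw [this]
  exact Finsupp.linearIndependent_single_one Coeff (ExtWeyl d)

/-- The basis `T_w` of the Hecke algebra. -/
noncomputable def heckeBasis (d : ℕ) [NeZero d] : Module.Basis (ExtWeyl d) Coeff (Hecke d) :=
  Module.Basis.mk linearIndependent_heckeT (by rw [span_heckeT])

theorem heckeBasis_apply [NeZero d] (w : ExtWeyl d) : heckeBasis d w = heckeT w := by
  simp [heckeBasis]

end HeckeBasis

end AffineSchur
namespace AffineSchur

/-! ### Sums over stabilizers in the Hecke algebra -/

section StabSum

variable {d : ℕ} [NeZero d]

/-- The coefficient of `T_w`. -/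
noncomputable def hcoef (w : ExtWeyl d) : Hecke d →ₗ[Coeff] Coeff := (heckeBasis d).coord w

open Classical in
theorem hcoef_heckeT (w u : ExtWeyl d) : hcoef w (heckeT u) = if u = w then 1 else 0 := by
  rw [hcoef, ← heckeBasis_apply, Module.Basis.coord_apply, Module.Basis.repr_self,
    Finsupp.single_apply]

theorem hecke_ext {x y : Hecke d} (h : ∀ w, hcoef w x = hcoef w y) : x = y :=
  (heckeBasis d).ext_elem h

theorem hecke_linearMap_ext {M : Type*} [AddCommMonoid M] [Module Coeff M]
    {f g : Hecke d →ₗ[Coeff] M} (h : ∀ w, f (heckeT w) = g (heckeT w)) : f = g :=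
  (heckeBasis d).ext fun w => by rw [heckeBasis_apply]; exact h w

theorem finite_support_hcoef (x : Hecke d) : {w | hcoef w x ≠ 0}.Finite :=
  ((heckeBasis d).repr x).hasFiniteSupport

theorem smul_right_cancel {c : Coeff} (hc : c ≠ 0) {x y : Hecke d} (h : c • x = c • y) : x = y := by
  apply hecke_ext
  intro w
  have := congrArg (hcoef w) h
  rw [map_smul, map_smul, smul_eq_mul, smul_eq_mul] at this
  exact mul_left_cancel₀ hc this

omit [NeZero d] in
theorem heckeSum_eq {X : Set (ExtWeyl d)} (hX : X.Finite) :
    heckeSum X = ∑ w ∈ hX.toFinset, heckeT w :=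
  finsum_mem_eq_finite_toFinset_sum _ hX

open Classical in
theorem hcoef_heckeSum {X : Set (ExtWeyl d)} (hX : X.Finite) (w : ExtWeyl d) :
    hcoef w (heckeSum X) = if w ∈ X then 1 else 0 := by
  rw [heckeSum_eq hX, map_sum]
  simp only [hcoef_heckeT]
  rw [Finset.sum_ite_eq']
  simp

/-- This is the transpose of the multiplication rule: below an ascent, `T_w` occurs in `T_u T_s`
only for `u = w s`, where the rule contributes `v²`. -/
theorem hcoef_mul_simple_of_lt (hd : 2 ≤ d) {w : ExtWeyl d} {i : ℤ} (h : w.1 i < w.1 (i + 1))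
    (x : Hecke d) :
    hcoef w (x * heckeT (simple d i)) = vpow 2 * hcoef (w * simple d i) x := by
  have := hecke_linearMap_ext (d := d)
    (f := (hcoef w).comp (LinearMap.mulRight Coeff (heckeT (simple d i))))
    (g := vpow 2 • hcoef (w * simple d i)) fun u => by
      have e : hcoef (w * simple d i) (heckeT u) = hcoef w (heckeT (u * simple d i)) := by
        have h0 : u = w * simple d i ↔ u * simple d i = w := by rw [← mul_inv_eq_iff_eq_mul, simple_inv]
        rw [hcoef_heckeT, hcoef_heckeT]
        by_cases h1 : u * simple d i = w
        · rw [if_pos h1, if_pos (h0.mpr h1)]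
        · rw [if_neg h1, if_neg (mt h0.mp h1)]
      simp only [LinearMap.comp_apply, LinearMap.mulRight_apply, LinearMap.smul_apply]
      rcases lt_or_gt_of_ne (apply_succ_ne u i) with h1 | h1
      · have h2 : ¬ u * simple d i = w := by
          rintro rfl
          rw [mul_coe_apply, mul_coe_apply, simple_apply_self hd, simple_apply_succ hd] at h
          omega
        rw [heckeT_mul_simple_of_lt hd h1, e, hcoef_heckeT, if_neg h2,
          smul_zero]
      · have h2 : ¬ u = w := by
          rintro rfl
          omega
        rw [heckeT_mul_simple_of_gt h1, map_add, map_smul, map_smul, e, hcoef_heckeT, if_neg h2,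
          smul_zero, zero_add]
  exact LinearMap.congr_fun this x

theorem hcoef_mul_simple_of_gt {w : ExtWeyl d} {i : ℤ} (h : w.1 (i + 1) < w.1 i)
    (x : Hecke d) : hcoef w (x * heckeT (simple d i)) =
      hcoef (w * simple d i) x + (vpow 2 - 1) * hcoef w x := by
  have hd := two_le_of_descent h
  have := hecke_linearMap_ext (d := d)
    (f := (hcoef w).comp (LinearMap.mulRight Coeff (heckeT (simple d i))))
    (g := hcoef (w * simple d i) + (vpow 2 - 1) • hcoef w) fun u => by
      have e : hcoef (w * simple d i) (heckeT u) = hcoef w (heckeT (u * simple d i)) := by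
        have h0 : u = w * simple d i ↔ u * simple d i = w := by rw [← mul_inv_eq_iff_eq_mul, simple_inv]
        rw [hcoef_heckeT, hcoef_heckeT]
        by_cases h1 : u * simple d i = w
        · rw [if_pos h1, if_pos (h0.mpr h1)]
        · rw [if_neg h1, if_neg (mt h0.mp h1)]
      simp only [LinearMap.comp_apply, LinearMap.mulRight_apply, LinearMap.smul_apply,
        LinearMap.add_apply]
      rcases lt_or_gt_of_ne (apply_succ_ne u i) with h1 | h1
      · have h2 : ¬ u = w := by
          rintro rfl
          omega
        rw [heckeT_mul_simple_of_lt hd h1, e, hcoef_heckeT, hcoef_heckeT, if_neg h2,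
          smul_zero, add_zero]
      · have h2 : ¬ u * simple d i = w := by
          rintro rfl
          rw [mul_coe_apply, mul_coe_apply, simple_apply_self hd, simple_apply_succ hd] at h
          omega
        rw [heckeT_mul_simple_of_gt h1, map_add, map_smul, map_smul, e, hcoef_heckeT w (_ * _),
          if_neg h2, smul_zero, add_zero, zero_add]
  exact LinearMap.congr_fun this x

theorem hcoef_simple_mul_of_lt (hd : 2 ≤ d) {w : ExtWeyl d} {i : ℤ}
    (h : (w⁻¹).1 i < (w⁻¹).1 (i + 1)) (x : Hecke d) :
    hcoef w (heckeT (simple d i) * x) = vpow 2 * hcoef (simple d i * w) x := by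
  have := hecke_linearMap_ext (d := d)
    (f := (hcoef w).comp (LinearMap.mulLeft Coeff (heckeT (simple d i))))
    (g := vpow 2 • hcoef (simple d i * w)) fun u => by
      have e : hcoef (simple d i * w) (heckeT u) = hcoef w (heckeT (simple d i * u)) := by
        have h0 : u = simple d i * w ↔ simple d i * u = w := by rw [← inv_mul_eq_iff_eq_mul, simple_inv]
        rw [hcoef_heckeT, hcoef_heckeT]
        by_cases h1 : simple d i * u = w
        · rw [if_pos h1, if_pos (h0.mpr h1)]
        · rw [if_neg h1, if_neg (mt h0.mp h1)]
      simp only [LinearMap.comp_apply, LinearMap.mulLeft_apply, LinearMap.smul_apply]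
      rcases lt_or_gt_of_ne (apply_succ_ne u⁻¹ i) with h1 | h1
      · have h2 : ¬ simple d i * u = w := by
          rintro rfl
          rw [mul_inv_rev, simple_inv, mul_coe_apply, mul_coe_apply, simple_apply_self hd,
            simple_apply_succ hd] at h
          omega
        rw [heckeT_simple_mul_of_lt hd h1, e, hcoef_heckeT, if_neg h2,
          smul_zero]
      · have h2 : ¬ u = w := by
          rintro rfl
          omega
        rw [heckeT_simple_mul_of_gt h1, map_add, map_smul, map_smul, e, hcoef_heckeT, if_neg h2,
          smul_zero, zero_add]
  exact LinearMap.congr_fun this x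

theorem hcoef_simple_mul_of_gt {w : ExtWeyl d} {i : ℤ}
    (h : (w⁻¹).1 (i + 1) < (w⁻¹).1 i) (x : Hecke d) : hcoef w (heckeT (simple d i) * x) =
      hcoef (simple d i * w) x + (vpow 2 - 1) * hcoef w x := by
  have hd := two_le_of_descent h
  have := hecke_linearMap_ext (d := d)
    (f := (hcoef w).comp (LinearMap.mulLeft Coeff (heckeT (simple d i))))
    (g := hcoef (simple d i * w) + (vpow 2 - 1) • hcoef w) fun u => by
      have e : hcoef (simple d i * w) (heckeT u) = hcoef w (heckeT (simple d i * u)) := by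
        have h0 : u = simple d i * w ↔ simple d i * u = w := by rw [← inv_mul_eq_iff_eq_mul, simple_inv]
        rw [hcoef_heckeT, hcoef_heckeT]
        by_cases h1 : simple d i * u = w
        · rw [if_pos h1, if_pos (h0.mpr h1)]
        · rw [if_neg h1, if_neg (mt h0.mp h1)]
      simp only [LinearMap.comp_apply, LinearMap.mulLeft_apply, LinearMap.smul_apply,
        LinearMap.add_apply]
      rcases lt_or_gt_of_ne (apply_succ_ne u⁻¹ i) with h1 | h1
      · have h2 : ¬ u = w := by
          rintro rfl
          omega
        rw [heckeT_simple_mul_of_lt hd h1, e, hcoef_heckeT, hcoef_heckeT, if_neg h2,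
          smul_zero, add_zero]
      · have h2 : ¬ simple d i * u = w := by
          rintro rfl
          rw [mul_inv_rev, simple_inv, mul_coe_apply, mul_coe_apply, simple_apply_self hd,
            simple_apply_succ hd] at h
          omega
        rw [heckeT_simple_mul_of_gt h1, map_add, map_smul, map_smul, e, hcoef_heckeT w (_ * _),
          if_neg h2, smul_zero, add_zero, zero_add]
  exact LinearMap.congr_fun this x

theorem isUnit_vpow (k : ℤ) : IsUnit (vpow k) := LaurentPolynomial.isUnit_T k

theorem vpow_ne_zero (k : ℤ) : vpow k ≠ 0 := (isUnit_vpow k).ne_zero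

/-- Comparing coefficients at the shorter element of a pair `{w, w s}` gives `v²` times the
coefficient at `w s` on one side and at `w` on the other. At the longer element the condition is
then automatic. -/
theorem mul_heckeT_simple_iff (hd : 2 ≤ d) (i : ℤ) (x : Hecke d) :
    x * heckeT (simple d i) = vpow 2 • x ↔ ∀ w, hcoef (w * simple d i) x = hcoef w x := by
  constructor
  · intro h
    have key : ∀ w : ExtWeyl d, w.1 i < w.1 (i + 1) → hcoef (w * simple d i) x = hcoef w x := by
      intro w hw
      have := hcoef_mul_simple_of_lt hd hw x
      rw [h, map_smul, smul_eq_mul] at this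
      exact (mul_left_cancel₀ (vpow_ne_zero 2) this).symm
    intro w
    rcases lt_or_gt_of_ne (apply_succ_ne w i) with h1 | h1
    · exact key w h1
    · have := key (w * simple d i) (by
        rwa [mul_coe_apply, mul_coe_apply, simple_apply_self hd, simple_apply_succ hd])
      rw [mul_assoc, simple_mul_self, mul_one] at this
      exact this.symm
  · intro h
    apply hecke_ext
    intro w
    rw [map_smul, smul_eq_mul]
    rcases lt_or_gt_of_ne (apply_succ_ne w i) with h1 | h1
    · rw [hcoef_mul_simple_of_lt hd h1, h]
    · rw [hcoef_mul_simple_of_gt h1, h]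
      ring

theorem heckeT_simple_mul_iff (hd : 2 ≤ d) (i : ℤ) (x : Hecke d) :
    heckeT (simple d i) * x = vpow 2 • x ↔ ∀ w, hcoef (simple d i * w) x = hcoef w x := by
  constructor
  · intro h
    have key : ∀ w : ExtWeyl d, (w⁻¹).1 i < (w⁻¹).1 (i + 1) →
        hcoef (simple d i * w) x = hcoef w x := by
      intro w hw
      have := hcoef_simple_mul_of_lt hd hw x
      rw [h, map_smul, smul_eq_mul] at this
      exact (mul_left_cancel₀ (vpow_ne_zero 2) this).symm
    intro w
    rcases lt_or_gt_of_ne (apply_succ_ne w⁻¹ i) with h1 | h1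
    · exact key w h1
    · have := key (simple d i * w) (by
        rwa [mul_inv_rev, simple_inv, mul_coe_apply, mul_coe_apply, simple_apply_self hd,
          simple_apply_succ hd])
      rw [← mul_assoc, simple_mul_self, one_mul] at this
      exact this.symm
  · intro h
    apply hecke_ext
    intro w
    rw [map_smul, smul_eq_mul]
    rcases lt_or_gt_of_ne (apply_succ_ne w⁻¹ i) with h1 | h1
    · rw [hcoef_simple_mul_of_lt hd h1, h]
    · rw [hcoef_simple_mul_of_gt h1, h]
      ring

/-- `x T_s = v² x` for all `s` in the stabilizer of `Z`. -/
def RightInvariant (Z : Set ℤ) (x : Hecke d) : Prop :=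
  2 ≤ d → ∀ i ∉ Z, x * heckeT (simple d i) = vpow 2 • x

/-- `T_s x = v² x` for all `s` in the stabilizer of `Z`. -/
def LeftInvariant (Z : Set ℤ) (x : Hecke d) : Prop :=
  2 ≤ d → ∀ i ∉ Z, heckeT (simple d i) * x = vpow 2 • x

variable {Z : Set ℤ} (hZ : PeriodicSet d Z) (hne : Z.Nonempty)

include hZ hne

theorem RightInvariant.hcoef_mul {x : Hecke d} (hx : RightInvariant Z x) {a : ExtWeyl d}
    (ha : a ∈ stab d Z) (w : ExtWeyl d) : hcoef (w * a) x = hcoef w x := by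
  refine stab_induction (P := fun a => hcoef (w * a) x = hcoef w x) hZ hne (by rw [mul_one]) ?_ a ha
  intro a _ i hi hd _ ih
  rw [← mul_assoc, (mul_heckeT_simple_iff hd i x).mp (hx hd i hi), ih]

theorem LeftInvariant.hcoef_mul {x : Hecke d} (hx : LeftInvariant Z x) {a : ExtWeyl d}
    (ha : a ∈ stab d Z) (w : ExtWeyl d) : hcoef (a * w) x = hcoef w x := by
  have key : ∀ w, hcoef (a⁻¹ * w) x = hcoef w x := by
    refine stab_induction (P := fun a => ∀ w, hcoef (a⁻¹ * w) x = hcoef w x) hZ hne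
      (fun w => by rw [inv_one, one_mul]) ?_ a ha
    intro a _ i hi hd _ ih w
    rw [mul_inv_rev, simple_inv, mul_assoc, (heckeT_simple_mul_iff hd i x).mp (hx hd i hi), ih]
  rw [← key, inv_mul_cancel_left]

omit hne in
theorem rightInvariant_heckeSum {X : Set (ExtWeyl d)} (hX : X.Finite)
    (h : ∀ w ∈ X, ∀ a ∈ stab d Z, w * a ∈ X) : RightInvariant Z (heckeSum X) := by
  classical
  intro hd i hi
  rw [mul_heckeT_simple_iff hd]
  intro w
  have hs := simple_mem_stab hZ hd hi
  rw [hcoef_heckeSum hX, hcoef_heckeSum hX]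
  have : w * simple d i ∈ X ↔ w ∈ X := by
    refine ⟨fun h1 => ?_, fun h1 => h _ h1 _ hs⟩
    have := h _ h1 _ hs
    rwa [mul_assoc, simple_mul_self, mul_one] at this
  simp only [this]

omit hne in
theorem leftInvariant_heckeSum {X : Set (ExtWeyl d)} (hX : X.Finite)
    (h : ∀ w ∈ X, ∀ a ∈ stab d Z, a * w ∈ X) : LeftInvariant Z (heckeSum X) := by
  classical
  intro hd i hi
  rw [heckeT_simple_mul_iff hd]
  intro w
  have hs := simple_mem_stab hZ hd hi
  rw [hcoef_heckeSum hX, hcoef_heckeSum hX]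
  have : simple d i * w ∈ X ↔ w ∈ X := by
    refine ⟨fun h1 => ?_, fun h1 => h _ h1 _ hs⟩
    have := h _ h1 _ hs
    rwa [← mul_assoc, simple_mul_self, one_mul] at this
  simp only [this]

theorem RightInvariant.mul_heckeT {x : Hecke d} (hx : RightInvariant Z x) {a : ExtWeyl d}
    (ha : a ∈ stab d Z) : x * heckeT a = vpow (2 * len a) • x := by
  refine stab_induction (P := fun a => x * heckeT a = vpow (2 * len a) • x) hZ hne
    (by simp [heckeT_one, len_one, vpow_zero]) ?_ a ha
  intro a _ i hi hd hlt ih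
  rw [← heckeT_mul_simple_of_lt hd hlt, ← mul_assoc, ih, smul_mul_assoc, hx hd i hi, smul_smul,
    vpow_mul, len_mul_simple_of_lt hd hlt]
  congr 2

theorem LeftInvariant.heckeT_mul {x : Hecke d} (hx : LeftInvariant Z x) {a : ExtWeyl d}
    (ha : a ∈ stab d Z) : heckeT a * x = vpow (2 * len a) • x := by
  refine stab_induction (P := fun a => heckeT a * x = vpow (2 * len a) • x) hZ hne
    (by simp [heckeT_one, len_one, vpow_zero]) ?_ a ha
  intro a _ i hi hd hlt ih
  rw [← heckeT_mul_simple_of_lt hd hlt, mul_assoc, hx hd i hi, mul_smul_comm, ih, smul_smul,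
    vpow_mul, len_mul_simple_of_lt hd hlt]
  congr 2
  push_cast
  ring

/-- The sum of the `T_w` over a stabilizer. -/
noncomputable def xStab (Z : Set ℤ) : Hecke d := heckeSum (stab d Z : Set (ExtWeyl d))

/-- The Poincaré polynomial of a stabilizer. -/
noncomputable def poincare (d : ℕ) (Z : Set ℤ) : Coeff :=
  ∑ᶠ w ∈ (stab d Z : Set (ExtWeyl d)), vpow (2 * len w)

theorem rightInvariant_xStab : RightInvariant Z (xStab Z : Hecke d) :=
  rightInvariant_heckeSum hZ (finite_stab hZ hne) fun _ hw _ ha => (stab d Z).mul_mem hw ha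

theorem leftInvariant_xStab : LeftInvariant Z (xStab Z : Hecke d) :=
  leftInvariant_heckeSum hZ (finite_stab hZ hne) fun _ hw _ ha => (stab d Z).mul_mem ha hw

theorem xStab_eq : (xStab Z : Hecke d) = ∑ w ∈ (finite_stab hZ hne).toFinset, heckeT w :=
  heckeSum_eq _

theorem poincare_eq :
    poincare d Z = ∑ w ∈ (finite_stab hZ hne).toFinset, vpow (2 * len w) :=
  finsum_mem_eq_finite_toFinset_sum _ _

theorem RightInvariant.mul_xStab {x : Hecke d} (hx : RightInvariant Z x) :
    x * xStab Z = poincare d Z • x := by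
  rw [xStab_eq hZ hne, poincare_eq hZ hne, Finset.mul_sum, Finset.sum_smul]
  refine Finset.sum_congr rfl fun a ha => hx.mul_heckeT hZ hne ?_
  simpa using ha

/-- At `v = 1` the polynomial becomes the order of the group. Nonvanishing is what permits
cancelling it later in the torsion-free Hecke algebra. -/
theorem poincare_ne_zero : poincare d Z ≠ 0 := by
  intro h
  have h1 := congrArg (LaurentPolynomial.eval₂ (RingHom.id ℤ) (1 : ℤˣ)) h
  rw [poincare_eq hZ hne, map_sum, map_zero] at h1
  simp only [vpow, LaurentPolynomial.eval₂_T, one_zpow, Units.val_one, Finset.sum_const,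
    nsmul_eq_mul, mul_one, Nat.cast_eq_zero, Finset.card_eq_zero] at h1
  have : (1 : ExtWeyl d) ∈ (finite_stab hZ hne).toFinset := by
    simp
  rw [h1] at this
  simp at this

/-- The length of the longest element of a stabilizer. -/
noncomputable def maxLen (d : ℕ) (Z : Set ℤ) : ℕ := sSup (len '' (stab d Z : Set (ExtWeyl d)))

omit [NeZero d] hZ hne in
theorem invert_vpow (k : ℤ) : LaurentPolynomial.invert (vpow k) = vpow (-k) :=
  LaurentPolynomial.invert_T k

/-- Left multiplication by the longest element replaces each length by its complement, so the
coefficients are symmetric. -/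
theorem invert_poincare :
    LaurentPolynomial.invert (poincare d Z) = vpow (-2 * maxLen d Z) * poincare d Z := by
  obtain ⟨w, hw, h⟩ := exists_longest hZ hne
  rw [maxLen, sSup_len_stab hZ hne hw h, poincare_eq hZ hne, map_sum, Finset.mul_sum]
  refine Finset.sum_bij' (fun x _ => w * x) (fun x _ => w⁻¹ * x) ?_ ?_ ?_ ?_ ?_
  · intro x hx
    simp only [Set.Finite.mem_toFinset, SetLike.mem_coe] at hx ⊢
    exact (stab d Z).mul_mem hw hx
  · intro x hx
    simp only [Set.Finite.mem_toFinset, SetLike.mem_coe] at hx ⊢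
    exact (stab d Z).mul_mem ((stab d Z).inv_mem hw) hx
  · intro x _
    rw [inv_mul_cancel_left]
  · intro x _
    rw [mul_inv_cancel_left]
  · intro x hx
    simp only [Set.Finite.mem_toFinset, SetLike.mem_coe] at hx
    have := len_longest_mul hZ hne h x hx
    rw [invert_vpow, vpow_mul]
    congr 1
    omega

omit hZ hne in
theorem heckeBar_smul (c : Coeff) (x : Hecke d) :
    heckeBar d (c • x) = LaurentPolynomial.invert c • heckeBar d x := by
  rw [Algebra.smul_def, map_mul, heckeBar_algebraMap, ← Algebra.smul_def]

omit [NeZero d] hZ hne in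
theorem inverse_mul_of_mul_eq {t x : Hecke d} {k : ℤ} (ht : IsUnit t) (h : t * x = vpow k • x) :
    Ring.inverse t * x = vpow (-k) • x := by
  have h1 : x = Ring.inverse t * (t * x) := by
    rw [← mul_assoc, Ring.inverse_mul_cancel _ ht, one_mul]
  rw [h, mul_smul_comm] at h1
  conv_rhs => rw [h1, smul_smul, vpow_mul, neg_add_cancel, vpow_zero, one_smul]

/-- The element `bar x * x` is computed in two ways. As `bar x` is again right invariant, it is the
Poincaré polynomial times `bar x`. Expanding `bar x` into inverses of the `T_a` and letting these
act on the left invariant `x` gives the inverted polynomial times `x`. The symmetry of the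
polynomial allows it to be cancelled. -/
theorem heckeBar_xStab :
    heckeBar d (xStab Z) = vpow (-2 * maxLen d Z) • (xStab Z : Hecke d) := by
  have h1 : RightInvariant Z (heckeBar d (xStab Z)) := by
    intro hd i hi
    have hs : simple d i ∈ simples d := ⟨hd, i, rfl⟩
    have h := congrArg (heckeBar d) (rightInvariant_xStab hZ hne hd i hi)
    rw [map_mul, heckeBar_heckeT, simple_inv, heckeBar_smul, invert_vpow] at h
    have h2 := congrArg (fun t => vpow 2 • (t * heckeT (simple d i))) h
    rw [mul_assoc, Ring.inverse_mul_cancel _ (isUnit_heckeT_simple hs), mul_one, smul_mul_assoc,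
      smul_smul, vpow_mul, show (2 : ℤ) + -2 = 0 by norm_num, vpow_zero, one_smul] at h2
    exact h2.symm
  have h2 := h1.mul_xStab hZ hne
  have h3 : heckeBar d (xStab Z) * xStab Z =
      LaurentPolynomial.invert (poincare d Z) • (xStab Z : Hecke d) := by
    conv_lhs => rw [xStab_eq hZ hne, map_sum, ← xStab_eq hZ hne, Finset.sum_mul]
    rw [poincare_eq hZ hne, map_sum, Finset.sum_smul]
    apply Finset.sum_congr rfl
    intro a ha
    simp only [Set.Finite.mem_toFinset, SetLike.mem_coe] at ha
    rw [heckeBar_heckeT, invert_vpow, ← len_inv a]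
    exact inverse_mul_of_mul_eq (isUnit_heckeT _)
      ((leftInvariant_xStab hZ hne).heckeT_mul hZ hne ((stab d Z).inv_mem ha))
  rw [h3, invert_poincare hZ hne, mul_comm, mul_smul] at h2
  exact (smul_right_cancel (poincare_ne_zero hZ hne) h2).symm

open Classical in
/-- The coefficient of `x_Z T_w` at the shortest element of a coset. -/
theorem hcoef_xStab_mul_heckeT {y : ExtWeyl d} (hy : IsLeftMin Z y) (w : ExtWeyl d) :
    hcoef y (xStab Z * heckeT w) =
      if w * y⁻¹ ∈ stab d Z then vpow (2 * len (w * y⁻¹)) else 0 := by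
  -- With `w = b y'` and `y'` shortest in its coset, `x_Z T_b` is a power of `v` times `x_Z`, and
  -- `x_Z T_{y'}` is the plain sum over the coset. The coefficient at `y` thus survives only if `y'
  -- = y`.
  obtain ⟨b, hb, y', hy', rfl⟩ := exists_isLeftMin hZ w
  have e1 : (xStab Z : Hecke d) * heckeT (b * y') =
      vpow (2 * len b) • ∑ a ∈ (finite_stab hZ hne).toFinset, heckeT (a * y') := by
    rw [← heckeT_mul (len_mul_of_isLeftMin hZ hne hy' hb).symm, ← mul_assoc,
      (rightInvariant_xStab hZ hne).mul_heckeT hZ hne hb, smul_mul_assoc, xStab_eq hZ hne,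
      Finset.sum_mul]
    congr 1
    apply Finset.sum_congr rfl
    intro a ha
    simp only [Set.Finite.mem_toFinset, SetLike.mem_coe] at ha
    exact heckeT_mul (len_mul_of_isLeftMin hZ hne hy' ha).symm
  rw [e1, map_smul, map_sum]
  simp only [hcoef_heckeT]
  by_cases h : b * y' * y⁻¹ ∈ stab d Z
  · have h1 : y' * y⁻¹ ∈ stab d Z := by
      rw [mul_assoc] at h
      exact (Subgroup.mul_mem_cancel_left _ hb).mp h
    have h2 : y' * y⁻¹ = 1 :=
      hy.eq_one_of_mul hZ hne h1 (by rwa [inv_mul_cancel_right])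
    obtain rfl : y' = y := mul_inv_eq_one.mp h2
    rw [if_pos h, mul_inv_cancel_right, Finset.sum_eq_single 1]
    · simp
    · intro a _ ha
      rw [if_neg]
      intro h3
      exact ha (mul_eq_right.mp h3)
    · intro h3
      exact absurd (by simp) h3
  · rw [if_neg h, Finset.sum_eq_zero, smul_zero]
    intro a ha
    simp only [Set.Finite.mem_toFinset, SetLike.mem_coe] at ha
    rw [if_neg]
    rintro rfl
    apply h
    rw [mul_inv_rev, ← mul_assoc, mul_inv_cancel_right]
    exact (stab d Z).mul_mem hb ((stab d Z).inv_mem ha)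

open Classical in
theorem hcoef_xStab_mul_heckeSum {y : ExtWeyl d} (hy : IsLeftMin Z y) {X : Set (ExtWeyl d)}
    (hX : X.Finite) : hcoef y (xStab Z * heckeSum X) =
      ∑ b ∈ (finite_stab hZ hne).toFinset with b * y ∈ X, vpow (2 * len b) := by
  rw [heckeSum_eq hX, Finset.mul_sum, map_sum]
  simp only [hcoef_xStab_mul_heckeT hZ hne hy]
  rw [← Finset.sum_filter]
  refine Finset.sum_bij' (fun w _ => w * y⁻¹) (fun b _ => b * y) ?_ ?_ ?_ ?_ ?_
  · intro w hw
    simp only [Finset.mem_filter, Set.Finite.mem_toFinset, SetLike.mem_coe] at hw ⊢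
    exact ⟨hw.2, by rw [inv_mul_cancel_right]; exact hw.1⟩
  · intro b hb
    simp only [Finset.mem_filter, Set.Finite.mem_toFinset, SetLike.mem_coe] at hb ⊢
    exact ⟨hb.2, by rw [mul_inv_cancel_right]; exact hb.1⟩
  · intro w _
    rw [inv_mul_cancel_right]
  · intro b _
    rw [mul_inv_cancel_right]
  · intro w _
    rfl

omit [NeZero d] hne hZ in
theorem isLeftMin_rot_zpow (Z : Set ℤ) (z : ℤ) : IsLeftMin Z (rot d ^ z) := by
  intro i _
  rw [← zpow_neg, rot_zpow_apply, rot_zpow_apply]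
  omega

/-- The double coset of `g` by two stabilizers. -/
def stabCoset (Z : Set ℤ) (g : ExtWeyl d) (Z' : Set ℤ) : Set (ExtWeyl d) :=
  {w | ∃ x ∈ stab d Z, ∃ y ∈ stab d Z', w = x * g * y}

theorem finite_stabCoset {Z' : Set ℤ} (hZ' : PeriodicSet d Z') (hne' : Z'.Nonempty)
    (g : ExtWeyl d) : (stabCoset Z g Z').Finite := by
  apply (Set.Finite.image2 (fun x y => x * g * y) (finite_stab hZ hne)
    (finite_stab hZ' hne')).subset
  rintro w ⟨x, hx, y, hy, rfl⟩
  exact ⟨x, hx, y, hy, rfl⟩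

/-- Both sides are left invariant for `Z` and right invariant for `Z'`, so on the double coset it
suffices to compare them at `π^z`. There the coefficient runs over those `b` in the first group with
`b π^z` in `π^z` times the second, that is, over the stabilizer of the union of cuts. Rotations have
length zero, so no other power of `v` enters. -/
theorem xStab_mul_rot_mul_xStab {Z' : Set ℤ} (hZ' : PeriodicSet d Z') (hne' : Z'.Nonempty)
    (z : ℤ) : (xStab Z : Hecke d) * heckeT (rot d ^ z) * xStab Z' =
      poincare d (Z ∪ (fun t => t + z) '' Z') • heckeSum (stabCoset Z (rot d ^ z) Z') := by
  classical
  set g := rot d ^ z with hg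
  have hfin := finite_stabCoset hZ hne hZ' hne' g
  have hl : LeftInvariant Z (xStab Z * heckeT g * xStab Z') := fun hd i hi => by
    rw [mul_assoc, ← mul_assoc, leftInvariant_xStab hZ hne hd i hi, smul_mul_assoc]
  have hr : RightInvariant Z' (xStab Z * heckeT g * xStab Z') := fun hd i hi => by
    rw [mul_assoc, rightInvariant_xStab hZ' hne' hd i hi, mul_smul_comm]
  have hprod : (xStab Z : Hecke d) * heckeT g * xStab Z' =
      xStab Z * heckeSum ((fun w => g * w) '' (stab d Z' : Set (ExtWeyl d))) := by
    rw [mul_assoc, xStab_eq hZ' hne', Finset.mul_sum,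
      heckeSum_eq ((finite_stab hZ' hne').image _)]
    congr 1
    refine Finset.sum_bij (fun w _ => g * w) ?_ ?_ ?_ ?_
    · intro w hw
      simpa using hw
    · intro a _ b _ h
      exact mul_left_cancel h
    · intro w hw
      obtain ⟨u, hu, rfl⟩ := (Set.Finite.mem_toFinset _).mp hw
      exact ⟨u, (Set.Finite.mem_toFinset _).mpr hu, rfl⟩
    · intro w _
      rw [hg, heckeT_rot_mul]
  apply hecke_ext
  intro w
  rw [map_smul, hcoef_heckeSum hfin]
  split_ifs with hw
  · obtain ⟨x, hx, y, hy, rfl⟩ := hw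
    rw [hr.hcoef_mul hZ' hne' hy, hl.hcoef_mul hZ hne hx, hprod,
      hcoef_xStab_mul_heckeSum hZ hne (isLeftMin_rot_zpow Z z) ((finite_stab hZ' hne').image _),
      smul_eq_mul, mul_one, poincare_eq (hZ.union (hZ'.image_add z)) (hne.mono Set.subset_union_left)]
    apply Finset.sum_congr _ fun _ _ => rfl
    ext b
    simp only [Finset.mem_filter, Set.Finite.mem_toFinset, SetLike.mem_coe, stab_union,
      Subgroup.mem_inf, mem_stab_image_add]
    refine and_congr_right fun hb => ?_
    constructor
    · rintro ⟨u, hu, e⟩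
      simp only at e
      rw [mul_assoc, ← e, inv_mul_cancel_left]
      exact hu
    · intro h
      exact ⟨_, h, by simp only [← hg]; group⟩
  · obtain ⟨a, ha, y, hy, rfl⟩ := exists_isLeftMin hZ w
    rw [hl.hcoef_mul hZ hne ha, hprod,
      hcoef_xStab_mul_heckeSum hZ hne hy ((finite_stab hZ' hne').image _), smul_zero]
    apply Finset.sum_eq_zero
    intro b hb
    simp only [Finset.mem_filter, Set.Finite.mem_toFinset, SetLike.mem_coe] at hb
    obtain ⟨hb, u, hu, e⟩ := hb
    simp only at e
    exfalso
    apply hw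
    refine ⟨a * b⁻¹, (stab d Z).mul_mem ha ((stab d Z).inv_mem hb), u, hu, ?_⟩
    rw [mul_assoc, e, ← mul_assoc, inv_mul_cancel_right]

/-- Bar is applied to `xStab_mul_rot_mul_xStab`. The rotation is fixed, the two parabolic sums and
the Poincaré polynomial reproduce themselves up to powers of `v`, and the polynomial cancels. -/
theorem heckeBar_heckeSum_rot {Z' : Set ℤ} (hZ' : PeriodicSet d Z') (hne' : Z'.Nonempty) (z : ℤ) :
    heckeBar d (heckeSum (stabCoset Z (rot d ^ z) Z')) =
      vpow (2 * maxLen d (Z ∪ (fun t => t + z) '' Z') - 2 * maxLen d Z - 2 * maxLen d Z') •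
        heckeSum (stabCoset Z (rot d ^ z) Z') := by
  have hu := hZ.union (hZ'.image_add z)
  have hu' : (Z ∪ (fun t => t + z) '' Z').Nonempty := hne.mono Set.subset_union_left
  have h := xStab_mul_rot_mul_xStab hZ hne hZ' hne' z
  have hb := congrArg (heckeBar d) h
  have hT : heckeBar d (heckeT (rot d ^ z)) = heckeT (rot d ^ z) := by
    rw [heckeBar_heckeT, ← zpow_neg]
    have h1 : heckeT (rot d ^ (-z)) * heckeT (rot d ^ z) = 1 := by
      rw [heckeT_rot_mul, ← zpow_add, neg_add_cancel, zpow_zero, heckeT_one]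
    rw [← mul_one (Ring.inverse _), ← h1, ← mul_assoc,
      Ring.inverse_mul_cancel _ (isUnit_heckeT _), one_mul]
  rw [map_mul, map_mul, heckeBar_xStab hZ hne, heckeBar_xStab hZ' hne', hT, smul_mul_assoc,
    smul_mul_assoc, mul_smul_comm, h, heckeBar_smul, invert_poincare hu hu', smul_smul, smul_smul,
    vpow_mul, mul_comm, mul_smul, mul_comm (vpow _), mul_smul] at hb
  have := smul_right_cancel (poincare_ne_zero hu hu') hb
  have h2 := congrArg (fun t => vpow (2 * maxLen d (Z ∪ (fun t => t + z) '' Z')) • t) this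
  rw [smul_smul, smul_smul, vpow_mul, vpow_mul,
    show ∀ a : ℤ, 2 * a + -2 * a = 0 by intro a; ring, vpow_zero, one_smul] at h2
  rw [← h2]
  congr 2
  ring

end StabSum

end AffineSchur
namespace AffineSchur

/-! ### Blocks of a composition -/

section Blocks

variable {n d : ℕ} [NeZero n]

theorem blockStart_add (l : Comp n d) (i q : ℤ) :
    blockStart l (i + q * n) = blockStart l i + q * d := by
  have hn : (n : ℤ) ≠ 0 := by exact_mod_cast NeZero.ne n
  unfold blockStart
  rw [show i + q * n - 1 = (i - 1) + q * n by ring, Int.add_mul_ediv_right _ _ hn,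
    Int.add_mul_emod_self_right]
  ring

theorem part_add (l : Comp n d) (i q : ℤ) : part l (i + q * n) = part l i := by
  unfold part
  rw [show i + q * n - 1 = (i - 1) + q * n by ring, Int.add_mul_emod_self_right]

omit [NeZero n] in
theorem blockStart_natCast (l : Comp n d) {k : ℕ} (hk : k < n) :
    blockStart l (k + 1) = ((∑ j : Fin n, if (j : ℕ) < k then l.1 j else 0 : ℕ) : ℤ) := by
  unfold blockStart
  have h1 : ((k : ℤ) + 1 - 1) / n = 0 := by
    rw [add_sub_cancel_right]; exact Int.ediv_eq_zero_of_lt (by omega) (by omega)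
  have h2 : ((k : ℤ) + 1 - 1) % n = k := by
    rw [add_sub_cancel_right]; exact Int.emod_eq_of_lt (by omega) (by omega)
  rw [h1, h2]
  push_cast
  simp

theorem part_natCast (l : Comp n d) (k : Fin n) : part l ((k : ℕ) + 1) = l.1 k := by
  unfold part
  have h2 : (((k : ℕ) : ℤ) + 1 - 1) % n = (k : ℕ) := by
    rw [add_sub_cancel_right]; exact Int.emod_eq_of_lt (by omega) (by omega)
  rw [h2, Int.toNat_natCast]
  exact congrArg l.1 (Fin.ofNat_val_eq_self k)

theorem exists_eq_natCast_add (i : ℤ) : ∃ (k : Fin n) (q : ℤ), i = ((k : ℕ) : ℤ) + 1 + q * n := by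
  have hn : (0 : ℤ) < n := by exact_mod_cast NeZero.pos n
  have h0 := Int.emod_nonneg (i - 1) hn.ne'
  have h1 := Int.emod_lt_of_pos (i - 1) hn
  have h2 := Int.emod_add_mul_ediv (i - 1) n
  refine ⟨⟨((i - 1) % n).toNat, by omega⟩, (i - 1) / n, ?_⟩
  simp only [Int.toNat_of_nonneg h0]
  linarith

theorem blockStart_one (l : Comp n d) : blockStart l 1 = 0 := by
  have := blockStart_natCast l (NeZero.pos n)
  simpa using this

theorem blockStart_succ (l : Comp n d) (i : ℤ) :
    blockStart l (i + 1) = blockStart l i + part l i := by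
  obtain ⟨k, q, rfl⟩ := exists_eq_natCast_add (n := n) i
  rw [show ((k : ℕ) : ℤ) + 1 + q * n + 1 = ((k : ℕ) : ℤ) + 1 + 1 + q * n by ring, blockStart_add,
    blockStart_add, part_add, part_natCast, blockStart_natCast l k.2]
  have key : ∑ j : Fin n, (if (j : ℕ) < k + 1 then l.1 j else 0) =
      (∑ j : Fin n, if (j : ℕ) < k then l.1 j else 0) + l.1 k := by
    have : ∀ j : Fin n, (if (j : ℕ) < k + 1 then l.1 j else 0) =
        (if (j : ℕ) < k then l.1 j else 0) + (if j = k then l.1 j else 0) := by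
      intro j
      rcases lt_trichotomy (j : ℕ) k with h | h | h
      · have : j ≠ k := fun e => by subst e; omega
        simp [h, this, Nat.lt_succ_of_lt h]
      · have : j = k := Fin.ext h
        simp [this]
      · have : j ≠ k := fun e => by subst e; omega
        simp [this, not_lt.mpr h.le, show ¬ (j : ℕ) < k + 1 by omega]
    rw [Finset.sum_congr rfl fun j _ => this j, Finset.sum_add_distrib, Finset.sum_ite_eq']
    simp
  have hcast : (((∑ j : Fin n, if (j : ℕ) < k then l.1 j else 0 : ℕ) : ℤ)) + l.1 k =
      ((∑ j : Fin n, (if (j : ℕ) < k + 1 then l.1 j else 0) : ℕ) : ℤ) := by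
    rw [key]; push_cast; ring
  rw [add_right_comm _ (q * (d : ℤ)), hcast]
  congr 1
  -- The last block of a period must be treated apart: the quotient in `blockStart` jumps there, and
  -- the parts add up to `d`.
  by_cases h : (k : ℕ) + 1 < n
  · have := blockStart_natCast l h
    push_cast at this
    rw [this]
    push_cast
    rfl
  · have hk : (k : ℕ) + 1 = n := by have := k.2; omega
    have e : ((k : ℕ) : ℤ) + 1 + 1 = 1 + 1 * n := by omega
    rw [e, blockStart_add, blockStart_one, hk]
    simp only [Fin.is_lt, if_true]
    rw [l.2]
    ring

theorem blockStart_mono (l : Comp n d) : Monotone (blockStart l) :=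
  monotone_int_of_le_succ fun i => by rw [blockStart_succ]; omega

theorem comp_ext {l l' : Comp n d} (h : ∀ i, part l i = part l' i) : l = l' := by
  apply Subtype.ext
  funext k
  rw [← part_natCast, ← part_natCast, h]

/-- The set of block ends of a composition. -/
def cuts (l : Comp n d) : Set ℤ := Set.range (blockStart l)

theorem periodicSet_cuts (l : Comp n d) : PeriodicSet d (cuts l) := by
  intro z
  constructor
  · rintro ⟨i, hi⟩
    refine ⟨i + (-1) * n, ?_⟩
    rw [blockStart_add, hi]; ring
  · rintro ⟨i, rfl⟩
    refine ⟨i + 1 * n, ?_⟩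
    rw [blockStart_add]; ring

omit [NeZero n] in
theorem cuts_nonempty (l : Comp n d) : (cuts l).Nonempty := ⟨_, 0, rfl⟩

theorem simple_add_mul (i q : ℤ) : simple d (i + q * d) = simple d i := by
  ext t
  change simpleFun d (i + q * d) t = simpleFun d i t
  unfold simpleFun
  have h1 : (d : ℤ) ∣ t - (i + q * d) ↔ (d : ℤ) ∣ t - i := by
    rw [show t - (i + q * d) = t - i - q * d by ring]
    exact dvd_sub_left (Dvd.intro_left q rfl)
  have h2 : (d : ℤ) ∣ t - (i + q * d + 1) ↔ (d : ℤ) ∣ t - (i + 1) := by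
    rw [show t - (i + q * d + 1) = t - (i + 1) - q * d by ring]
    exact dvd_sub_left (Dvd.intro_left q rfl)
  simp only [h1, h2]

theorem sum_Iic_eq_blockStart (l : Comp n d) (k : Fin n) :
    ((∑ j ∈ Finset.Iic k, l.1 j : ℕ) : ℤ) = blockStart l (((k : ℕ) : ℤ) + 1 + 1) := by
  rw [blockStart_succ, blockStart_natCast l k.2, part_natCast, ← Nat.cast_add]
  congr 1
  rw [← Finset.sum_filter]
  have : Finset.Iic k = insert k (Finset.univ.filter fun j : Fin n => (j : ℕ) < k) := by
    ext j
    simp only [Finset.mem_Iic, Finset.mem_insert, Finset.mem_filter, Finset.mem_univ, true_and]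
    rw [le_iff_eq_or_lt]
    rfl
  rw [this, Finset.sum_insert (by simp), add_comm]

/-- The generators of the parabolic subgroup are the `s_i` with `i` not a cut, taken modulo `d`.
They preserve the cuts, and sorting an element of the stabilizer uses only such reflections. -/
theorem parabolic_eq_stab [NeZero d] (l : Comp n d) : parabolic l = stab d (cuts l) := by
  apply le_antisymm
  · rw [parabolic, Subgroup.closure_le]
    rintro s ⟨⟨hd, i, rfl⟩, hs⟩
    refine simple_mem_stab (periodicSet_cuts l) hd ?_
    rintro ⟨j, rfl⟩
    apply hs
    obtain ⟨k, q, hk⟩ := exists_eq_natCast_add (n := n) (j - 1)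
    refine ⟨k, ?_⟩
    simp only
    rw [sum_Iic_eq_blockStart, ← simple_add_mul _ q, ← blockStart_add]
    congr 2
    linarith
  · intro g hg
    refine stab_induction (P := fun g => g ∈ parabolic l) (periodicSet_cuts l) (cuts_nonempty l)
      (parabolic l).one_mem ?_ g hg
    intro x _ i hi hd _ hx
    refine (parabolic l).mul_mem hx (Subgroup.subset_closure ⟨⟨hd, i, rfl⟩, ?_⟩)
    rintro ⟨k, hk⟩
    simp only at hk
    have h1 := simple_mem_stab (periodicSet_cuts l) hd hi
    rw [← hk, sum_Iic_eq_blockStart] at h1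
    exact notMem_of_simple_mem_stab hd h1 ⟨_, rfl⟩

/-- The starts are unbounded both ways because `n` blocks advance by `d`. Zero parts give empty
blocks with equal starts, so the last start below `t` has to be chosen. -/
theorem exists_block [NeZero d] (l : Comp n d) (t : ℤ) :
    ∃ i, blockStart l i < t ∧ t ≤ blockStart l (i + 1) := by
  have hd := natCast_pos_of_neZero (d := d)
  have hn := natCast_pos_of_neZero (d := n)
  have hq : ∀ q : ℤ, blockStart l (1 + q * n) = q * d := fun q => by
    rw [blockStart_add, blockStart_one, zero_add]
  obtain ⟨i, hi, hmax⟩ := Int.exists_greatest_of_bdd (P := fun i => blockStart l i < t)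
    ⟨1 + |t| * n, fun z hz => by
      by_contra h
      have h1 := blockStart_mono l (not_le.mp h).le
      rw [hq] at h1
      have := le_abs_self t
      nlinarith [abs_nonneg t]⟩
    ⟨1 + (-|t| - 1) * n, by
      rw [hq]
      have := neg_abs_le t
      nlinarith [abs_nonneg t]⟩
  refine ⟨i, hi, ?_⟩
  by_contra h
  have := hmax (i + 1) (not_le.mp h)
  omega

/-- The index of the block that contains `t`. -/
noncomputable def blk [NeZero d] (l : Comp n d) (t : ℤ) : ℤ := (exists_block l t).choose

theorem blk_eq_iff [NeZero d] {l : Comp n d} {t i : ℤ} :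
    blk l t = i ↔ blockStart l i < t ∧ t ≤ blockStart l (i + 1) := by
  have h := (exists_block l t).choose_spec
  constructor
  · rintro rfl; exact h
  · intro hi
    change blockStart l (blk l t) < t ∧ t ≤ blockStart l (blk l t + 1) at h
    rcases lt_trichotomy (blk l t) i with h1 | h1 | h1
    · have := blockStart_mono l (show blk l t + 1 ≤ i by omega)
      omega
    · exact h1
    · have := blockStart_mono l (show i + 1 ≤ blk l t by omega)
      omega

theorem mem_block_iff [NeZero d] {l : Comp n d} {t i : ℤ} : t ∈ block l i ↔ blk l t = i := by
  rw [blk_eq_iff, block, Set.mem_Ioc, blockStart_succ]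

theorem blk_add_mul [NeZero d] (l : Comp n d) (t q : ℤ) : blk l (t + q * d) = blk l t + q * n := by
  have h := blk_eq_iff.mp (rfl : blk l t = blk l t)
  rw [blk_eq_iff, add_right_comm, blockStart_add, blockStart_add]
  omega

theorem blk_add [NeZero d] (l : Comp n d) (t : ℤ) : blk l (t + d) = blk l t + n := by
  simpa using blk_add_mul l t 1

theorem blk_mono [NeZero d] (l : Comp n d) : Monotone (blk l) := by
  intro s t hst
  by_contra h
  have h1 := blk_eq_iff.mp (rfl : blk l s = blk l s)
  have h2 := blk_eq_iff.mp (rfl : blk l t = blk l t)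
  have := blockStart_mono l (show blk l t + 1 ≤ blk l s by omega)
  omega

theorem le_blockStart_iff [NeZero d] (l : Comp n d) (t i : ℤ) :
    t ≤ blockStart l i ↔ blk l t < i := by
  have h := blk_eq_iff.mp (rfl : blk l t = blk l t)
  constructor
  · intro h1
    by_contra h2
    have := blockStart_mono l (not_lt.mp h2)
    omega
  · intro h1
    have := blockStart_mono l (show blk l t + 1 ≤ i by omega)
    omega

/-- Preserving all block ends is the same as preserving the block index. The remaining arguments use
only this form. -/
theorem mem_stab_cuts [NeZero d] {l : Comp n d} {g : ExtWeyl d} :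
    g ∈ stab d (cuts l) ↔ ∀ t, blk l (g.1 t) = blk l t := by
  rw [mem_stab]
  simp only [cuts, Set.forall_mem_range, le_blockStart_iff]
  constructor
  · intro h t
    have h1 := h (blk l t) t
    have h2 := h (blk l t + 1) t
    omega
  · intro h i t
    rw [h]

theorem finite_blk [NeZero d] (l : Comp n d) (i : ℤ) : {t | blk l t = i}.Finite := by
  apply (Set.finite_Ioc (blockStart l i) (blockStart l (i + 1))).subset
  intro t ht
  exact blk_eq_iff.mp ht

theorem isKappa_iff [NeZero d] {l : Comp n d} {g : ExtWeyl d} {m : Comp n d} {A : Theta n d} :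
    IsKappa l g m A ↔
      ∀ i j, A.entry i j = {t | blk l t = i ∧ blk m ((g⁻¹).1 t) = j}.ncard := by
  unfold IsKappa
  refine forall_congr' fun i => forall_congr' fun j => ?_
  have : block l i ∩ g.1 '' block m j = {t | blk l t = i ∧ blk m ((g⁻¹).1 t) = j} := by
    ext t
    simp only [Set.mem_inter_iff, mem_block_iff, Set.mem_image, Set.mem_ofPred_eq]
    refine and_congr_right fun _ => ⟨?_, fun h => ⟨_, h, coe_apply_inv_self g t⟩⟩
    rintro ⟨s, hs, rfl⟩
    rwa [inv_coe_apply_self]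
  rw [this]

theorem isKappa_mul [NeZero d] {l m : Comp n d} {g g' : ExtWeyl d} {A : Theta n d}
    (h : IsKappa l g m A) (hg : g' ∈ stabCoset (cuts l) g (cuts m)) : IsKappa l g' m A := by
  rw [isKappa_iff] at h ⊢
  obtain ⟨x, hx, y, hy, rfl⟩ := hg
  intro i j
  rw [h]
  have : {t | blk l t = i ∧ blk m (((x * g * y)⁻¹).1 t) = j} =
      x.1 '' {t | blk l t = i ∧ blk m ((g⁻¹).1 t) = j} := by
    ext t
    simp only [Set.mem_image, Set.mem_ofPred_eq, mul_inv_rev, mul_coe_apply]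
    rw [mem_stab_cuts.mp ((stab d _).inv_mem hy)]
    constructor
    · rintro ⟨h1, h2⟩
      refine ⟨(x⁻¹).1 t, ⟨?_, h2⟩, coe_apply_inv_self x t⟩
      rw [mem_stab_cuts.mp ((stab d _).inv_mem hx), h1]
    · rintro ⟨s, ⟨h1, h2⟩, rfl⟩
      rw [mem_stab_cuts.mp hx, inv_coe_apply_self]
      exact ⟨h1, h2⟩
  rw [this, Set.ncard_image_of_injective _ x.1.injective]

/-- Summing over a block according to the values of a function. -/
theorem finsum_ncard_mul [NeZero d] (l : Comp n d) (i : ℤ) (f : ℤ → ℤ) (w : ℤ → ℕ) :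
    ∑ᶠ j, {t | blk l t = i ∧ f t = j}.ncard * w j =
      ∑ t ∈ Finset.Ioc (blockStart l i) (blockStart l (i + 1)), w (f t) := by
  classical
  set F := Finset.Ioc (blockStart l i) (blockStart l (i + 1)) with hF
  have hset : ∀ j, {t | blk l t = i ∧ f t = j}.ncard = (F.filter fun t => f t = j).card := by
    intro j
    rw [← Set.ncard_coe_finset]
    congr 1
    ext t
    simp [hF, blk_eq_iff]
  simp only [hset]
  rw [finsum_eq_sum_of_support_subset (s := F.image f)]
  · rw [← Finset.sum_fiberwise_of_maps_to (s := F) (g := f)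
      fun t ht => Finset.mem_image_of_mem f ht]
    apply Finset.sum_congr rfl
    intro j _
    rw [Finset.sum_congr rfl fun t ht => by rw [(Finset.mem_filter.mp ht).2], Finset.sum_const,
      smul_eq_mul]
  · intro j hj
    by_contra h
    apply hj
    have : (F.filter fun t => f t = j) = ∅ := by
      rw [Finset.filter_eq_empty_iff]
      intro t ht e
      exact h (by simpa using ⟨t, ht, e⟩)
    simp [this]

theorem rowSum_eq_part [NeZero d] {l m : Comp n d} {g : ExtWeyl d} {A : Theta n d}
    (h : IsKappa l g m A) (i : ℤ) : A.rowSum i = part l i := by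
  have := finsum_ncard_mul l i (fun t => blk m ((g⁻¹).1 t)) fun _ => 1
  simp only [mul_one, Finset.sum_const, Int.card_Ioc, smul_eq_mul] at this
  unfold Theta.rowSum
  rw [finsum_congr fun j => isKappa_iff.mp h i j, this, blockStart_succ]
  simp

theorem colSum_eq_part [NeZero d] {l m : Comp n d} {g : ExtWeyl d} {A : Theta n d}
    (h : IsKappa l g m A) (j : ℤ) : A.colSum j = part m j := by
  have := finsum_ncard_mul m j (fun t => blk l (g.1 t)) fun _ => 1
  simp only [mul_one, Finset.sum_const, Int.card_Ioc, smul_eq_mul] at this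
  have e : ∀ i, A.entry i j = {t | blk m t = j ∧ blk l (g.1 t) = i}.ncard := by
    intro i
    rw [isKappa_iff.mp h i j,
      ← Set.ncard_image_of_injective {t | blk m t = j ∧ _} g.1.injective]
    congr 1
    ext t
    simp only [Set.mem_image, Set.mem_ofPred_eq]
    constructor
    · rintro ⟨h1, h2⟩
      exact ⟨(g⁻¹).1 t, ⟨h2, by rwa [coe_apply_inv_self]⟩, coe_apply_inv_self g t⟩
    · rintro ⟨s, ⟨h1, h2⟩, rfl⟩
      exact ⟨h2, by rwa [inv_coe_apply_self]⟩
  unfold Theta.colSum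
  rw [finsum_congr e, this, blockStart_succ]
  simp

end Blocks

/-! ### Periodic colorings -/

section Colorings

variable {d : ℕ}

/-- The number of earlier positions of the same color. -/
noncomputable def colorRank {ι : Type*} (f : ℤ → ι) (t : ℤ) : ℕ := {s | s < t ∧ f s = f t}.ncard

theorem colorRank_inj {ι : Type*} {f : ℤ → ι} (hf : ∀ c, {t | f t = c}.Finite) {s t : ℤ}
    (h1 : f s = f t) (h2 : colorRank f s = colorRank f t) : s = t := by
  have key : ∀ s t, f s = f t → s < t → colorRank f s < colorRank f t := by
    intro s t h1 h2
    apply Set.ncard_lt_ncard _ ((hf (f t)).subset fun u hu => hu.2)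
    refine ⟨fun u hu => ⟨hu.1.trans h2, hu.2.trans h1⟩, fun h => ?_⟩
    have : s ∈ {u | u < s ∧ f u = f s} := h ⟨h2, h1⟩
    exact lt_irrefl _ this.1
  rcases lt_trichotomy s t with h | h | h
  · have := key s t h1 h; omega
  · exact h
  · have := key t s h1.symm h; omega

theorem colorRank_lt {ι : Type*} {f : ℤ → ι} (hf : ∀ c, {t | f t = c}.Finite) (t : ℤ) :
    colorRank f t < {s | f s = f t}.ncard := by
  apply Set.ncard_lt_ncard _ (hf (f t))
  refine ⟨fun u hu => hu.2, fun h => ?_⟩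
  have : t ∈ {u | u < t ∧ f u = f t} := h rfl
  exact lt_irrefl _ this.1

theorem exists_colorRank_eq {ι : Type*} {f : ℤ → ι} (hf : ∀ c, {t | f t = c}.Finite) (c : ι) {r : ℕ}
    (hr : r < {s | f s = c}.ncard) : ∃ t, f t = c ∧ colorRank f t = r := by
  classical
  set F := (hf c).toFinset with hF
  have hcard : {s | f s = c}.ncard = F.card := Set.ncard_eq_toFinset_card _ (hf c)
  have hmem : ∀ t, t ∈ F ↔ f t = c := fun t => by simp [hF]
  have himg : F.image (colorRank f) = Finset.range F.card := by
    apply Finset.eq_of_subset_of_card_le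
    · intro k hk
      obtain ⟨t, ht, rfl⟩ := Finset.mem_image.mp hk
      have := colorRank_lt hf t
      rw [(hmem t).mp ht, hcard] at this
      exact Finset.mem_range.mpr this
    · rw [Finset.card_range, Finset.card_image_of_injOn]
      intro s hs t ht e
      exact colorRank_inj hf (((hmem s).mp hs).trans ((hmem t).mp ht).symm) e
  have : r ∈ F.image (colorRank f) := by rw [himg, Finset.mem_range, ← hcard]; exact hr
  obtain ⟨t, ht, rfl⟩ := Finset.mem_image.mp this
  exact ⟨t, (hmem t).mp ht, rfl⟩

theorem colorRank_add {ι : Type*} {σ : ι → ι} (hσ : Function.Injective σ) {f : ℤ → ι}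
    (hf : ∀ t, f (t + d) = σ (f t)) (t : ℤ) : colorRank f (t + d) = colorRank f t := by
  have : {s | s < t + d ∧ f s = f (t + d)} = (fun s : ℤ => s + d) '' {s | s < t ∧ f s = f t} := by
    ext s
    simp only [Set.mem_image, Set.mem_ofPred_eq]
    constructor
    · rintro ⟨h1, h2⟩
      refine ⟨s - d, ⟨by omega, ?_⟩, by ring⟩
      have := hf (s - d)
      rw [sub_add_cancel, h2, hf] at this
      exact (hσ this).symm
    · rintro ⟨s, ⟨h1, h2⟩, rfl⟩
      exact ⟨by omega, by rw [hf, hf, h2]⟩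
  unfold colorRank
  rw [this, Set.ncard_image_of_injective _ (add_left_injective _)]

/-- Two periodic colorings with equally many positions of each color differ by a periodic
permutation. -/
theorem exists_perm_of_colorings {ι : Type*} {σ : ι → ι} (hσ : Function.Injective σ) {f f' : ℤ → ι}
    (hf : ∀ t, f (t + d) = σ (f t)) (hf' : ∀ t, f' (t + d) = σ (f' t))
    (fin : ∀ c, {t | f t = c}.Finite) (fin' : ∀ c, {t | f' t = c}.Finite)
    (hcard : ∀ c, {t | f t = c}.ncard = {t | f' t = c}.ncard) :
    ∃ a : ExtWeyl d, ∀ t, f' (a.1 t) = f t := by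
  -- The permutation sends the `r`-th position of a color to the `r`-th position of that color in
  -- the other coloring. Ranks are invariant under translation, so the permutation is periodic.
  have ex : ∀ t, ∃ s, f' s = f t ∧ colorRank f' s = colorRank f t := fun t =>
    exists_colorRank_eq fin' (f t) (by rw [← hcard]; exact colorRank_lt fin t)
  have ex' : ∀ t, ∃ s, f s = f' t ∧ colorRank f s = colorRank f' t := fun t =>
    exists_colorRank_eq fin (f' t) (by rw [hcard]; exact colorRank_lt fin' t)
  choose a ha using ex
  choose b hb using ex'
  let e : Equiv.Perm ℤ :=
    { toFun := a
      invFun := b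
      left_inv := fun t => colorRank_inj fin ((hb _).1.trans (ha t).1) ((hb _).2.trans (ha t).2)
      right_inv := fun t => colorRank_inj fin' ((ha _).1.trans (hb t).1) ((ha _).2.trans (hb t).2) }
  refine ⟨⟨e, fun t => ?_⟩, fun t => (ha t).1⟩
  change a (t + d) = a t + d
  refine colorRank_inj fin' ?_ ?_
  · rw [(ha _).1, hf, hf', (ha t).1]
  · rw [(ha _).2, colorRank_add hσ hf, colorRank_add hσ hf', (ha t).2]

/-- A sequence takes each value a prescribed number of times. -/
theorem exists_arrangement (w : ℤ → ℕ) (hw : (Function.support w).Finite) :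
    ∃ h : ℕ → ℤ, ∀ c, {r | r < ∑ᶠ c, w c ∧ h r = c}.ncard = w c := by
  classical
  have key : ∀ S : Finset ℤ, ∃ h : ℕ → ℤ, ∀ c,
      {r | r < ∑ c ∈ S, w c ∧ h r = c}.ncard = if c ∈ S then w c else 0 := by
    intro S
    induction S using Finset.induction_on with
    | empty => exact ⟨fun _ => 0, fun c => by simp⟩
    | insert a S ha ih =>
      obtain ⟨h, hh⟩ := ih
      set N := ∑ c ∈ S, w c with hN
      refine ⟨fun r => if r < N then h r else a, fun c => ?_⟩
      rw [Finset.sum_insert ha]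
      by_cases hc : c = a
      · subst hc
        rw [if_pos (Finset.mem_insert_self _ _)]
        have h0 := hh c
        rw [if_neg ha, Set.ncard_eq_zero ((Set.finite_lt_nat N).subset fun r hr => hr.1)] at h0
        have : {r | r < w c + N ∧ (if r < N then h r else c) = c} = Set.Ico N (w c + N) := by
          ext r
          simp only [Set.mem_ofPred_eq, Set.mem_Ico]
          constructor
          · rintro ⟨h1, h2⟩
            refine ⟨?_, h1⟩
            by_contra h3
            rw [if_pos (not_le.mp h3)] at h2
            have : r ∈ {r | r < N ∧ h r = c} := ⟨not_le.mp h3, h2⟩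
            rw [h0] at this
            exact this
          · rintro ⟨h1, h2⟩
            exact ⟨h2, by rw [if_neg (not_lt.mpr h1)]⟩
        rw [this, ← Nat.card_coe_set_eq]
        simp
      · have e1 : (c ∈ insert a S) = (c ∈ S) := by simp [hc]
        have : {r | r < w a + N ∧ (if r < N then h r else a) = c} = {r | r < N ∧ h r = c} := by
          ext r
          simp only [Set.mem_ofPred_eq]
          constructor
          · rintro ⟨h1, h2⟩
            split_ifs at h2 with h3
            · exact ⟨h3, h2⟩
            · exact absurd h2.symm hc
          · rintro ⟨h1, h2⟩
            exact ⟨by omega, by rw [if_pos h1, h2]⟩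
        rw [this, hh]
        simp only [Finset.mem_insert, hc, false_or]
  obtain ⟨h, hh⟩ := key hw.toFinset
  refine ⟨h, fun c => ?_⟩
  rw [finsum_eq_sum _ hw, hh]
  by_cases hc : w c = 0
  · simp [hc]
  · rw [if_pos (by simpa using hc)]

end Colorings

/-! ### Double cosets and periodic matrices. -/

section Kappa

variable {n d : ℕ} [NeZero n] [NeZero d]

/-- Color `t` by the pair of blocks of `t` and of `g⁻¹ t`. The matrix records how often each color
occurs, so some periodic `a` carries the coloring of `g` to that of `g'`. Matching first components
puts `a` in `W_l`, and matching second components puts `g'⁻¹ a g` in `W_m`. -/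
theorem mem_stabCoset_of_isKappa {l m : Comp n d} {g g' : ExtWeyl d} {A : Theta n d}
    (h : IsKappa l g m A) (h' : IsKappa l g' m A) : g' ∈ stabCoset (cuts l) g (cuts m) := by
  rw [isKappa_iff] at h h'
  have hper : ∀ (g : ExtWeyl d) (t : ℤ), (blk l (t + d), blk m ((g⁻¹).1 (t + d))) =
      (fun p : ℤ × ℤ => (p.1 + n, p.2 + n)) (blk l t, blk m ((g⁻¹).1 t)) := fun g t => by
    simp only [extWeyl_apply_add, blk_add]
  have hset : ∀ (g : ExtWeyl d) (c : ℤ × ℤ), {t | (blk l t, blk m ((g⁻¹).1 t)) = c} =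
      {t | blk l t = c.1 ∧ blk m ((g⁻¹).1 t) = c.2} := fun g c => by
    ext t; simp [Prod.ext_iff]
  have hfin : ∀ (g : ExtWeyl d) (c : ℤ × ℤ), {t | (blk l t, blk m ((g⁻¹).1 t)) = c}.Finite :=
    fun g c => by
      rw [hset]
      exact (finite_blk l c.1).subset fun t ht => ht.1
  obtain ⟨a, ha⟩ := exists_perm_of_colorings (d := d)
    (σ := fun p : ℤ × ℤ => (p.1 + n, p.2 + n)) (fun p q e => by
      simp only [Prod.mk.injEq] at e
      exact Prod.ext (by omega) (by omega)) (hper g) (hper g') (hfin g) (hfin g')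
      (fun c => by rw [hset, hset, ← h, ← h'])
  simp only [Prod.mk.injEq] at ha
  refine ⟨a, mem_stab_cuts.mpr fun t => (ha t).1, (g'⁻¹ * a * g)⁻¹, ?_, by group⟩
  apply Subgroup.inv_mem
  rw [mem_stab_cuts]
  intro t
  have := (ha (g.1 t)).2
  rwa [inv_coe_apply_self] at this

/-- A composition and periodic multiplicities admit a coloring of the blocks. -/
theorem exists_coloring (l : Comp n d) (w : ℤ → ℤ → ℕ) (hw : ∀ i c, w (i + n) c = w i c)
    (hfin : ∀ i, (Function.support (w i)).Finite) (hsum : ∀ i, ∑ᶠ c, w i c = part l i) :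
    ∃ f : ℤ → ℤ, (∀ t, f (t + d) = f t) ∧
      ∀ i c, {t | blk l t = i ∧ f t = c}.ncard = w i c := by
  classical
  let h : (ℤ → ℕ) → ℕ → ℤ := fun w =>
    if hw : (Function.support w).Finite then (exists_arrangement w hw).choose else fun _ => 0
  have hh : ∀ i c, {r | r < part l i ∧ h (w i) r = c}.ncard = w i c := by
    intro i c
    rw [← hsum]
    simp only [h, dif_pos (hfin i)]
    exact (exists_arrangement (w i) (hfin i)).choose_spec c
  refine ⟨fun t => h (w (blk l t)) (t - blockStart l (blk l t) - 1).toNat, fun t => ?_,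
    fun i c => ?_⟩
  · have e1 : w (blk l t + n) = w (blk l t) := funext (hw _)
    have e2 : blockStart l (blk l t + n) = blockStart l (blk l t) + d := by
      simpa using blockStart_add l (blk l t) 1
    simp only [blk_add, e1, e2]
    congr 2
    ring
  · rw [← hh i c, ← Set.ncard_image_of_injective (f := fun r : ℕ => blockStart l i + 1 + (r : ℤ))]
    · congr 1
      ext t
      simp only [Set.mem_image, Set.mem_ofPred_eq]
      constructor
      · rintro ⟨h1, h2⟩
        have h3 := blk_eq_iff.mp h1
        rw [blockStart_succ] at h3
        rw [h1] at h2
        exact ⟨(t - blockStart l i - 1).toNat, ⟨by omega, h2⟩, by omega⟩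
      · rintro ⟨r, ⟨h1, h2⟩, rfl⟩
        have h3 : blk l (blockStart l i + 1 + (r : ℤ)) = i := by
          rw [blk_eq_iff, blockStart_succ]
          omega
        refine ⟨h3, ?_⟩
        rw [h3, ← h2]
        congr 1
        omega
    · intro a b e
      simpa using e

omit [NeZero d] in
-- Sum along the diagonals `j - i = c` instead. On each of them the entries are periodic, so a
-- period of columns and a period of rows give the same total.
theorem sum_colSum (A : Theta n d) : ∑ k ∈ Finset.range n, A.colSum (1 + k) = d := by
  obtain ⟨K, hK⟩ := A.exists_width
  set S := Finset.Icc (-(K : ℤ)) K with hS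
  have hrow : ∀ i, ∑ᶠ j, A.entry i j = ∑ c ∈ S, A.entry i (i + c) := by
    intro i
    rw [← finsum_comp_equiv (Equiv.addLeft i)]
    apply finsum_eq_sum_of_support_subset
    intro c hc
    have := abs_le.mp (hK i (i + c) hc)
    simp only [hS, Finset.coe_Icc, Set.mem_Icc]
    omega
  have hcol : ∀ j, A.colSum j = ∑ c ∈ S, A.entry (j - c) (j - c + c) := by
    intro j
    unfold Theta.colSum
    rw [← finsum_comp_equiv (Equiv.subLeft j)]
    have e : ∀ c : ℤ, A.entry (Equiv.subLeft j c) j = A.entry (j - c) (j - c + c) := fun c => by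
      rw [sub_add_cancel]; rfl
    rw [finsum_congr e]
    apply finsum_eq_sum_of_support_subset
    intro c hc
    have := abs_le.mp (hK _ _ hc)
    simp only [hS, Finset.coe_Icc, Set.mem_Icc]
    omega
  have hp : ∀ c i : ℤ, A.entry (i + n) (i + n + c) = A.entry i (i + c) := by
    intro c i
    rw [← A.periodic i (i + c)]
    congr 1; ring
  refine Eq.trans ?_ A.total
  rw [Finset.sum_congr rfl fun (k : ℕ) _ => hcol (1 + k),
    Finset.sum_congr rfl fun (k : ℕ) _ => hrow (1 + k), Finset.sum_comm,
    Finset.sum_comm (s := Finset.range n)]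
  apply Finset.sum_congr rfl
  intro c _
  have h1 := sum_window n (fun i => A.entry i (i + c)) (hp c) (1 - c)
  have h2 := sum_window n (fun i => A.entry i (i + c)) (hp c) 1
  rw [← h1.trans h2.symm]
  apply Finset.sum_congr rfl
  intro k _
  congr 1 <;> ring

omit [NeZero n] [NeZero d] in
theorem colSum_add (A : Theta n d) (j : ℤ) : A.colSum (j + n) = A.colSum j := by
  unfold Theta.colSum
  rw [← finsum_comp_equiv (Equiv.addRight (n : ℤ))]
  exact finsum_congr fun i => A.periodic i j

omit [NeZero d] in
theorem exists_comp_part_eq (r : ℤ → ℕ) (hr : ∀ i, r (i + n) = r i)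
    (hsum : ∑ k ∈ Finset.range n, r (1 + k) = d) : ∃ l : Comp n d, ∀ i, part l i = r i := by
  refine ⟨⟨fun k => r (1 + (k : ℕ)), ?_⟩, fun i => ?_⟩
  · rw [← hsum, ← Fin.sum_univ_eq_sum_range fun k => r (1 + k)]
  · obtain ⟨k, q, rfl⟩ := exists_eq_natCast_add (n := n) i
    rw [part_add, part_natCast]
    have : ∀ i, r (i + q * n) = r i := by
      intro i
      induction q using Int.induction_on with
      | zero => simp
      | succ q ih => rw [← ih, ← hr (i + q * n)]; congr 1; ring
      | pred q ih => rw [← ih, ← hr (i + (-(q : ℤ) - 1) * n)]; congr 1; ring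
    rw [this, add_comm]

/-- Divide each row block and each column block into pieces of the sizes `a_ij`. Both labellings use
every pair `(i, j)` equally often, so a periodic permutation matches them. -/
theorem exists_isKappa (A : Theta n d) : ∃ l g m, IsKappa l g m A := by
  obtain ⟨l, hl⟩ := exists_comp_part_eq A.rowSum A.rowSum_add A.total
  obtain ⟨m, hm⟩ := exists_comp_part_eq A.colSum (colSum_add A) (sum_colSum A)
  obtain ⟨K, hK⟩ := A.exists_width
  -- The stored label is the offset `j - i`, which is unchanged when both indices grow by `n`, so
  -- the coloring can be chosen `d`-periodic.
  obtain ⟨f, hf, hfc⟩ := exists_coloring l (fun i c => A.entry i (i + c))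
    (fun i c => by
      rw [← A.periodic i (i + c)]
      congr 1; ring)
    (fun i => (Set.finite_Icc (-(K : ℤ)) K).subset fun c hc => by
      have := abs_le.mp (hK _ _ hc)
      constructor <;> omega)
    (fun i => by
      rw [hl, Theta.rowSum, ← finsum_comp_equiv (Equiv.addLeft i) (f := fun j => A.entry i j)]
      rfl)
  obtain ⟨f', hf', hfc'⟩ := exists_coloring m (fun j c => A.entry (j + c) j)
    (fun j c => by
      rw [← A.periodic (j + c) j]
      congr 1; ring)
    (fun j => (Set.finite_Icc (-(K : ℤ)) K).subset fun c hc => by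
      have := abs_le.mp (hK _ _ hc)
      constructor <;> omega)
    (fun j => by
      rw [hm, Theta.colSum, ← finsum_comp_equiv (Equiv.addLeft j) (f := fun i => A.entry i j)]
      rfl)
  have hs1 : ∀ c : ℤ × ℤ, {t | (blk l t, blk l t + f t) = c} =
      {t | blk l t = c.1 ∧ f t = c.2 - c.1} := fun c => by
    ext t
    simp only [Prod.ext_iff, Set.mem_ofPred_eq]
    constructor <;> rintro ⟨h1, h2⟩ <;> exact ⟨h1, by omega⟩
  have hs2 : ∀ c : ℤ × ℤ, {t | (blk m t + f' t, blk m t) = c} =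
      {t | blk m t = c.2 ∧ f' t = c.1 - c.2} := fun c => by
    ext t
    simp only [Prod.ext_iff, Set.mem_ofPred_eq]
    constructor <;> rintro ⟨h1, h2⟩ <;> constructor <;> omega
  obtain ⟨g, hg⟩ := exists_perm_of_colorings (d := d)
    (σ := fun p : ℤ × ℤ => (p.1 + n, p.2 + n)) (fun p q e => by
      simp only [Prod.mk.injEq] at e
      exact Prod.ext (by omega) (by omega))
    (f := fun t => (blk m t + f' t, blk m t)) (f' := fun t => (blk l t, blk l t + f t))
    (fun t => by simp only [blk_add, hf', Prod.mk.injEq, and_true]; ring)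
    (fun t => by simp only [blk_add, hf, Prod.mk.injEq, true_and]; ring)
    (fun c => by rw [hs2]; exact (finite_blk m c.2).subset fun t ht => ht.1)
    (fun c => by rw [hs1]; exact (finite_blk l c.1).subset fun t ht => ht.1)
    (fun c => by
      rw [hs1, hs2, hfc, hfc']
      congr 1 <;> ring)
  simp only [Prod.mk.injEq] at hg
  refine ⟨l, g, m, isKappa_iff.mpr fun i j => ?_⟩
  have : {t | blk l t = i ∧ blk m ((g⁻¹).1 t) = j} = {t | blk l t = i ∧ f t = j - i} := by
    ext t
    have := (hg ((g⁻¹).1 t)).2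
    rw [coe_apply_inv_self] at this
    simp only [Set.mem_ofPred_eq]
    constructor <;> rintro ⟨h1, h2⟩ <;> exact ⟨h1, by omega⟩
  rw [this, hfc]
  congr 1
  ring

theorem doubleCoset_eq (l m : Comp n d) (g : ExtWeyl d) :
    doubleCoset l g m = stabCoset (cuts l) g (cuts m) := by
  unfold doubleCoset stabCoset
  rw [parabolic_eq_stab, parabolic_eq_stab]

theorem distinguished_of_isLeftMin {l : Comp n d} {w : ExtWeyl d} (h : IsLeftMin (cuts l) w) :
    w ∈ distinguished l := by
  intro g hg
  rw [parabolic_eq_stab] at hg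
  exact len_mul_of_isLeftMin (periodicSet_cuts l) (cuts_nonempty l) h hg

/-- An element of minimal length in the double coset cannot be shortened by a simple reflection of
`W_l` on the left or of `W_m` on the right. In particular the definition of `eElt` never takes its
default value. -/
theorem exists_distinguished_isKappa (A : Theta n d) :
    ∃ l g m, g ∈ distinguishedDouble l m ∧ IsKappa l g m A := by
  obtain ⟨l, g, m, h⟩ := exists_isKappa A
  have hfin := finite_stabCoset (periodicSet_cuts l) (cuts_nonempty l) (periodicSet_cuts m)
    (cuts_nonempty m) g
  obtain ⟨w, hw, hmin⟩ := Set.exists_min_image _ len hfin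
    ⟨g, 1, (stab d _).one_mem, 1, (stab d _).one_mem, by simp⟩
  refine ⟨l, w, m, ⟨distinguished_of_isLeftMin fun i hi => ?_,
    distinguished_of_isLeftMin fun i hi => ?_⟩, isKappa_mul h hw⟩
  · refine lt_of_le_of_ne (not_lt.mp fun h1 => ?_) (apply_succ_ne _ i)
    have h2 := len_simple_mul_of_gt h1
    obtain ⟨x, hx, y, hy, rfl⟩ := hw
    have := hmin (simple d i * (x * g * y)) ⟨simple d i * x, (stab d _).mul_mem
      (simple_mem_stab (periodicSet_cuts l) (two_le_of_descent h1) hi) hx, y, hy, by group⟩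
    omega
  · rw [inv_inv]
    refine lt_of_le_of_ne (not_lt.mp fun h1 => ?_) (apply_succ_ne _ i)
    have h2 := len_mul_simple_of_gt h1
    obtain ⟨x, hx, y, hy, rfl⟩ := hw
    have := hmin ((x * g * y) * simple d i) ⟨x, hx, y * simple d i, (stab d _).mul_mem hy
      (simple_mem_stab (periodicSet_cuts m) (two_le_of_descent h1) hi), by group⟩
    omega

/-- Every triple defines a matrix. -/
theorem exists_theta (l : Comp n d) (g : ExtWeyl d) (m : Comp n d) :
    ∃ A : Theta n d, IsKappa l g m A := by
  have hrow : ∀ i, ∑ᶠ j, {t | blk l t = i ∧ blk m ((g⁻¹).1 t) = j}.ncard = part l i := by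
    intro i
    have := finsum_ncard_mul l i (fun t => blk m ((g⁻¹).1 t)) fun _ => 1
    simp only [mul_one, Finset.sum_const, Int.card_Ioc, smul_eq_mul] at this
    rw [this, blockStart_succ]
    simp
  refine ⟨⟨fun i j => {t | blk l t = i ∧ blk m ((g⁻¹).1 t) = j}.ncard, fun i j => ?_, fun i => ?_,
    ?_⟩, isKappa_iff.mpr fun i j => rfl⟩
  · rw [← Set.ncard_image_of_injective {t | blk l t = i ∧ _} (add_left_injective (d : ℤ))]
    congr 1
    ext t
    simp only [Set.mem_image, Set.mem_ofPred_eq]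
    constructor
    · rintro ⟨h1, h2⟩
      have e1 := blk_add l (t - d)
      have e2 := blk_add m ((g⁻¹).1 (t - d))
      rw [← extWeyl_apply_add, sub_add_cancel] at e2
      rw [sub_add_cancel] at e1
      exact ⟨t - d, ⟨by omega, by omega⟩, by ring⟩
    · rintro ⟨s, ⟨h1, h2⟩, rfl⟩
      rw [extWeyl_apply_add, blk_add, blk_add, h1, h2]
      exact ⟨rfl, rfl⟩
  · apply ((finite_blk l i).image fun t => blk m ((g⁻¹).1 t)).subset
    intro j hj
    obtain ⟨t, h1, h2⟩ := Set.nonempty_of_ncard_ne_zero hj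
    exact ⟨t, h1, h2⟩
  · rw [Finset.sum_congr rfl fun (k : ℕ) _ => hrow (1 + k)]
    have : ∀ k ∈ Finset.range n, part l (1 + k) =
        if h : k < n then l.1 ⟨k, h⟩ else 0 := by
      intro k hk
      have hk := Finset.mem_range.mp hk
      rw [dif_pos hk, ← part_natCast, add_comm]
    rw [Finset.sum_congr rfl this, ← Finset.sum_fin_eq_sum_range, l.2]

end Kappa

end AffineSchur
namespace AffineSchur

/-! ### Bases from dual families -/

/-- Jointly injective functionals with finite supports that are dual to the `e i` assemble into an
isomorphism onto finitely supported functions. -/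
theorem exists_basis_of_dual {R ι M : Type*} [CommSemiring R] [AddCommMonoid M] [Module R M]
    [DecidableEq ι] (e : ι → M) (c : ι → M →ₗ[R] R) (hc : ∀ i j, c i (e j) = if j = i then 1 else 0)
    (hfin : ∀ x, {i | c i x ≠ 0}.Finite) (hext : ∀ x y, (∀ i, c i x = c i y) → x = y) :
    ∃ b : Module.Basis ι R M, (∀ i, b i = e i) ∧ ∀ i x, b.repr x i = c i x := by
  let f : M →ₗ[R] ι →₀ R :=
    { toFun := fun x => Finsupp.ofSupportFinite (fun i => c i x) (hfin x)
      map_add' := fun x y => Finsupp.ext fun i => map_add (c i) x y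
      map_smul' := fun r x => Finsupp.ext fun i => map_smul (c i) r x }
  have hf : ∀ x i, f x i = c i x := fun x i => rfl
  have hfe : ∀ i, f (e i) = Finsupp.single i 1 := fun i => Finsupp.ext fun j => by
    rw [hf, hc, Finsupp.single_apply]
  have hbij : Function.Bijective f := by
    refine ⟨fun x y h => hext x y fun i => by rw [← hf, h, hf], fun p => ?_⟩
    refine ⟨p.sum fun i r => r • e i, ?_⟩
    rw [map_finsuppSum]
    simp only [map_smul, hfe, Finsupp.smul_single, smul_eq_mul, mul_one]
    exact p.sum_single
  refine ⟨⟨LinearEquiv.ofBijective f hbij⟩, fun i => ?_, fun i x => rfl⟩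
  exact (LinearEquiv.symm_apply_eq (LinearEquiv.ofBijective f hbij)).mpr (hfe i).symm

/-! ### Elements of the `q`-Schur algebra -/

section Schur

variable {n d : ℕ} [NeZero n] [NeZero d]

theorem xElt_eq (l : Comp n d) : xElt l = xStab (cuts l) := by
  unfold xElt xStab
  rw [parabolic_eq_stab]

theorem longestLen_eq (l : Comp n d) : longestLen l = maxLen d (cuts l) := by
  unfold longestLen maxLen
  rw [parabolic_eq_stab]

omit [NeZero n] [NeZero d] in
theorem mem_xModule {l : Comp n d} {y : Hecke d} : y ∈ xModule l ↔ ∃ h, y = xElt l * h := by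
  rw [xModule, Submodule.mem_span_singleton]
  constructor
  · rintro ⟨a, rfl⟩
    exact ⟨a.unop, rfl⟩
  · rintro ⟨h, rfl⟩
    exact ⟨MulOpposite.op h, rfl⟩

/-- The component of `F x_m` in `x_l H`. -/
noncomputable def val (m l : Comp n d) : Schur n d →ₗ[Coeff] Hecke d where
  toFun F := ((F (gen m) l : xModule l) : Hecke d)
  map_add' _ _ := rfl
  map_smul' _ _ := rfl

omit [NeZero n] [NeZero d] in
theorem val_mem (F : Schur n d) (m l : Comp n d) : ∃ h, val m l F = xElt l * h :=
  mem_xModule.mp (F (gen m) l).2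

omit [NeZero n] [NeZero d] in
theorem schur_apply_of (F : Schur n d) (m l : Comp n d) (y : xModule m) (h : Hecke d)
    (hy : (y : Hecke d) = xElt m * h) :
    ((F (DirectSum.of (fun l : Comp n d => xModule l) m y) l : xModule l) : Hecke d) =
      val m l F * h := by
  have e : DirectSum.of (fun l : Comp n d => xModule l) m y = MulOpposite.op h • gen m := by
    have : y = MulOpposite.op h • (⟨xElt m, Submodule.mem_span_singleton_self _⟩ : xModule m) :=
      Subtype.ext hy
    rw [this, gen, DirectSum.of_smul]
  rw [e, map_smul]
  rfl

omit [NeZero n] [NeZero d] in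
theorem schur_ext {F G : Schur n d} (h : ∀ m l, val m l F = val m l G) : F = G := by
  apply DirectSum.linearMap_ext
  intro m
  ext y : 1
  change F (DirectSum.of (fun l : Comp n d => xModule l) m y) =
    G (DirectSum.of (fun l : Comp n d => xModule l) m y)
  obtain ⟨k, hk⟩ := mem_xModule.mp y.2
  refine DFinsupp.ext fun l => Subtype.ext ?_
  rw [schur_apply_of F m l y k hk, schur_apply_of G m l y k hk, h]

open Classical in
omit [NeZero n] [NeZero d] in
theorem val_mul (F G : Schur n d) (m l : Comp n d) (h : Comp n d → Hecke d)
    (hh : ∀ r, val m r G = xElt r * h r) :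
    val m l (F * G) = ∑ r ∈ (G (gen m)).support, val r l F * h r := by
  have e : G (gen m) = ∑ r ∈ (G (gen m)).support,
      DirectSum.of (fun l : Comp n d => xModule l) r (G (gen m) r) :=
    (DirectSum.sum_support_of (G (gen m))).symm
  have e1 : val m l (F * G) = ((F (G (gen m)) l : xModule l) : Hecke d) := rfl
  rw [e1]
  conv_lhs => rw [e, map_sum]
  rw [DFinsupp.finsetSum_apply, AddSubmonoidClass.coe_finsetSum]
  apply Finset.sum_congr rfl
  intro r _
  exact schur_apply_of F r l _ (h r) (hh r)

omit [NeZero n] [NeZero d] in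
/-- The product with an element whose image of `x_m` has a single component. -/
theorem val_mul_of_single (F G : Schur n d) (m l r : Comp n d) (h : Hecke d)
    (hr : val m r G = xElt r * h) (h0 : ∀ r', r' ≠ r → val m r' G = 0) :
    val m l (F * G) = val r l F * h := by
  classical
  have e : G (gen m) = DirectSum.of (fun l : Comp n d => xModule l) r (G (gen m) r) := by
    refine DFinsupp.ext fun r' => ?_
    by_cases h1 : r' = r
    · subst h1
      exact (DirectSum.of_eq_same (β := fun l : Comp n d => xModule l) r' _).symm
    · have h2 : G (gen m) r' = 0 := Subtype.ext (h0 r' h1)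
      rw [h2]
      exact (DirectSum.of_eq_of_ne (β := fun l : Comp n d => xModule l) r r' _ h1).symm
  have e1 : val m l (F * G) = ((F (G (gen m)) l : xModule l) : Hecke d) := rfl
  rw [e1, e]
  exact schur_apply_of F r l _ h hr

omit [NeZero n] [NeZero d] in
-- The factor `h` in `x_m h` is not unique. Linearity of `F` on the ideal makes the image depend
-- only on `x_m h`, and this is the source of the right invariance of `val m l F`.
theorem val_mul_congr (F : Schur n d) (m l : Comp n d) {h h' : Hecke d}
    (e : xElt m * h = xElt m * h') : val m l F * h = val m l F * h' := by
  rw [← schur_apply_of F m l ⟨xElt m * h, mem_xModule.mpr ⟨h, rfl⟩⟩ h rfl,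
    ← schur_apply_of F m l ⟨xElt m * h, mem_xModule.mpr ⟨h, rfl⟩⟩ h' e]

theorem leftInvariant_val (F : Schur n d) (m l : Comp n d) :
    LeftInvariant (cuts l) (val m l F) := by
  intro hd i hi
  obtain ⟨h, e⟩ := val_mem F m l
  rw [e, xElt_eq, ← mul_assoc,
    leftInvariant_xStab (periodicSet_cuts l) (cuts_nonempty l) hd i hi, smul_mul_assoc]

theorem rightInvariant_val (F : Schur n d) (m l : Comp n d) :
    RightInvariant (cuts m) (val m l F) := by
  intro hd i hi
  have e : xElt m * heckeT (simple d i) = xElt m * (vpow 2 • (1 : Hecke d)) := by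
    rw [xElt_eq, rightInvariant_xStab (periodicSet_cuts m) (cuts_nonempty m) hd i hi,
      mul_smul_comm, mul_one]
  rw [val_mul_congr F m l e, mul_smul_comm, mul_one]

/-! ### Invariant elements as multiples of `x_Z`. -/

section Invariants

omit [NeZero n]

variable {Z : Set ℤ} (hZ : PeriodicSet d Z) (hne : Z.Nonempty)

include hZ hne

/-- The coefficients are constant on right cosets, so keeping only those at the shortest
representatives gives the cofactor, and `x_Z T_y` restores the whole coset of `y`. -/
theorem LeftInvariant.exists_eq_xStab_mul {x : Hecke d} (hx : LeftInvariant Z x) :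
    ∃ h, x = xStab Z * h := by
  classical
  set S := (finite_support_hcoef x).toFinset.filter fun y => IsLeftMin Z y with hS
  refine ⟨∑ y ∈ S, hcoef y x • heckeT y, ?_⟩
  apply hecke_ext
  intro w
  obtain ⟨a, ha, y, hy, rfl⟩ := exists_isLeftMin hZ w
  have hl : LeftInvariant Z (xStab Z * ∑ y ∈ S, hcoef y x • heckeT y) := fun hd i hi => by
    rw [← mul_assoc, leftInvariant_xStab hZ hne hd i hi, smul_mul_assoc]
  rw [hx.hcoef_mul hZ hne ha, hl.hcoef_mul hZ hne ha, Finset.mul_sum, map_sum]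
  have key : ∀ u ∈ S, hcoef y (xStab Z * hcoef u x • heckeT u) = if u = y then hcoef y x else 0 := by
    intro u hu
    have hu := (Finset.mem_filter.mp hu).2
    rw [mul_smul_comm, map_smul, hcoef_xStab_mul_heckeT hZ hne hy]
    by_cases e : u = y
    · subst e
      rw [if_pos (by simp), if_pos rfl, mul_inv_cancel, len_one]
      simp [vpow_zero]
    · rw [if_neg, if_neg e, smul_zero]
      intro h
      apply e
      have := hy.eq_one_of_mul hZ hne h (by rwa [inv_mul_cancel_right])
      exact mul_inv_eq_one.mp this
  rw [Finset.sum_congr rfl key, Finset.sum_ite_eq']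
  split_ifs with h
  · rfl
  · by_contra h1
    exact h (by simp [hS, hy, h1])

theorem RightInvariant.exists_eq_mul_xStab {x : Hecke d} (hx : RightInvariant Z x) :
    ∃ h, x = h * xStab Z := by
  classical
  set S := (finite_support_hcoef x).toFinset.filter fun y => IsLeftMin Z y⁻¹ with hS
  refine ⟨∑ y ∈ S, hcoef y x • heckeT y, ?_⟩
  apply hecke_ext
  intro w
  obtain ⟨a, ha, y, hy, e⟩ := exists_isLeftMin hZ w⁻¹
  obtain ⟨y, rfl⟩ : ∃ u, y = u⁻¹ := ⟨y⁻¹, (inv_inv y).symm⟩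
  obtain rfl : w = y * a⁻¹ := by rw [← inv_inv w, e]; simp
  have ha' := (stab d Z).inv_mem ha
  have hl : RightInvariant Z ((∑ y ∈ S, hcoef y x • heckeT y) * xStab Z) := fun hd i hi => by
    rw [mul_assoc, rightInvariant_xStab hZ hne hd i hi, mul_smul_comm]
  rw [hx.hcoef_mul hZ hne ha', hl.hcoef_mul hZ hne ha', Finset.sum_mul, map_sum]
  have key : ∀ u ∈ S, hcoef y (hcoef u x • heckeT u * xStab Z) = if u = y then hcoef y x else 0 := by
    intro u hu
    have hu := (Finset.mem_filter.mp hu).2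
    have e1 : heckeT u * xStab Z = ∑ b ∈ (finite_stab hZ hne).toFinset, heckeT (u * b) := by
      rw [xStab_eq hZ hne, Finset.mul_sum]
      refine Finset.sum_congr rfl fun b hb => heckeT_mul ?_
      simp only [Set.Finite.mem_toFinset, SetLike.mem_coe] at hb
      have := len_mul_of_isLeftMin hZ hne hu ((stab d Z).inv_mem hb)
      rw [← mul_inv_rev, len_inv, len_inv, len_inv] at this
      omega
    rw [smul_mul_assoc, map_smul, e1, map_sum]
    simp only [hcoef_heckeT]
    have hb1 : ∀ b ∈ stab d Z, u * b = y → b = 1 := by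
      intro b hb e2
      rw [← e2, mul_inv_rev] at hy
      have := hu.eq_one_of_mul hZ hne ((stab d Z).inv_mem hb) hy
      exact inv_eq_one.mp this
    by_cases e : u = y
    · subst e
      rw [if_pos rfl, Finset.sum_eq_single 1]
      · simp
      · intro b hb hb'
        simp only [Set.Finite.mem_toFinset, SetLike.mem_coe] at hb
        rw [if_neg fun h => hb' (hb1 b hb h)]
      · intro h
        exact absurd (by simp) h
    · rw [if_neg e, Finset.sum_eq_zero, smul_zero]
      intro b hb
      simp only [Set.Finite.mem_toFinset, SetLike.mem_coe] at hb
      rw [if_neg]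
      intro h
      apply e
      rw [hb1 b hb h, mul_one] at h
      exact h
  rw [Finset.sum_congr rfl key, Finset.sum_ite_eq']
  split_ifs with h
  · rfl
  · by_contra h1
    exact h (by simp [hS, hy, h1])

end Invariants

/-! ### The elements `e_A` and their coefficients. -/

omit [NeZero n] [NeZero d] in
-- An element of `x_l H ∩ H x_m` defines a map by left multiplication with its cofactor: this is
-- right linear, sends `x_m` to `y`, and therefore maps `x_m H` into `x_l H`.
theorem exists_schur_of_mul {m l : Comp n d} {y h' : Hecke d} (hy : y ∈ xModule l)
    (e : y = h' * xElt m) :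
    ∃ F : Schur n d, val m l F = y ∧ ∀ p q, ¬ (p = m ∧ q = l) → val p q F = 0 := by
  classical
  let f : xModule m →ₗ[(Hecke d)ᵐᵒᵖ] xModule l :=
    { toFun := fun x => ⟨h' * x, by
        obtain ⟨k, hk⟩ := mem_xModule.mp x.2
        rw [hk, ← mul_assoc, ← e]
        exact (xModule l).smul_mem (MulOpposite.op k) hy⟩
      map_add' := fun a b => Subtype.ext (mul_add _ _ _)
      map_smul' := fun r x => Subtype.ext (by
        change h' * ((x : Hecke d) * r.unop) = (h' * x) * r.unop
        rw [mul_assoc]) }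
  let F : Schur n d := (DirectSum.lof (Hecke d)ᵐᵒᵖ (Comp n d) (fun l => xModule l) l).comp
    (f.comp (DirectSum.component (Hecke d)ᵐᵒᵖ (Comp n d) (fun l => xModule l) m))
  have hF : ∀ p, F (gen p) = DirectSum.of (fun l : Comp n d => xModule l) l (f ((gen p) m)) :=
    fun p => rfl
  refine ⟨F, ?_, fun p q hpq => ?_⟩
  · change ((F (gen m) l : xModule l) : Hecke d) = y
    rw [hF, DirectSum.of_eq_same]
    have : (gen m : DirectSum (Comp n d) fun l => xModule l) m =
        ⟨xElt m, Submodule.mem_span_singleton_self _⟩ :=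
      DirectSum.of_eq_same (β := fun l : Comp n d => xModule l) m _
    rw [this]
    exact e.symm
  · change ((F (gen p) q : xModule q) : Hecke d) = 0
    rw [hF]
    by_cases hp : p = m
    · have hq : q ≠ l := fun hq => hpq ⟨hp, hq⟩
      rw [DirectSum.of_eq_of_ne (β := fun l : Comp n d => xModule l) l q _ hq]
      rfl
    · have : (gen p : DirectSum (Comp n d) fun l => xModule l) m = 0 :=
        DirectSum.of_eq_of_ne (β := fun l : Comp n d => xModule l) p m _ (Ne.symm hp)
      rw [this, map_zero, map_zero]
      rfl

omit [NeZero n] [NeZero d] in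
theorem mem_stabCoset_mul_left {Z Z' : Set ℤ} {g w a : ExtWeyl d} (hw : w ∈ stabCoset Z g Z')
    (ha : a ∈ stab d Z) : a * w ∈ stabCoset Z g Z' := by
  obtain ⟨x, hx, y, hy, rfl⟩ := hw
  exact ⟨a * x, (stab d Z).mul_mem ha hx, y, hy, by group⟩

omit [NeZero n] [NeZero d] in
theorem mem_stabCoset_mul_right {Z Z' : Set ℤ} {g w a : ExtWeyl d} (hw : w ∈ stabCoset Z g Z')
    (ha : a ∈ stab d Z') : w * a ∈ stabCoset Z g Z' := by
  obtain ⟨x, hx, y, hy, rfl⟩ := hw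
  exact ⟨x, hx, y * a, (stab d Z').mul_mem hy ha, by group⟩

omit [NeZero n] [NeZero d] in
theorem stabCoset_eq_of_mem {Z Z' : Set ℤ} {g w : ExtWeyl d} (hw : w ∈ stabCoset Z g Z') :
    stabCoset Z w Z' = stabCoset Z g Z' := by
  obtain ⟨x, hx, y, hy, rfl⟩ := hw
  ext u
  constructor
  · rintro ⟨a, ha, b, hb, rfl⟩
    exact ⟨a * x, (stab d Z).mul_mem ha hx, y * b, (stab d Z').mul_mem hy hb, by group⟩
  · rintro ⟨a, ha, b, hb, rfl⟩
    exact ⟨a * x⁻¹, (stab d Z).mul_mem ha ((stab d Z).inv_mem hx), y⁻¹ * b,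
      (stab d Z').mul_mem ((stab d Z').inv_mem hy) hb, by group⟩

theorem finite_stabCoset_cuts (l : Comp n d) (g : ExtWeyl d) (m : Comp n d) :
    (stabCoset (cuts l) g (cuts m)).Finite :=
  finite_stabCoset (periodicSet_cuts l) (cuts_nonempty l) (periodicSet_cuts m) (cuts_nonempty m) g

theorem heckeSum_stabCoset_eq (l : Comp n d) (g : ExtWeyl d) (m : Comp n d) :
    (∃ h, heckeSum (stabCoset (cuts l) g (cuts m)) = xElt l * h) ∧
    ∃ h, heckeSum (stabCoset (cuts l) g (cuts m)) = h * xElt m := by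
  have hfin := finite_stabCoset_cuts l g m
  rw [xElt_eq, xElt_eq]
  exact ⟨(leftInvariant_heckeSum (periodicSet_cuts l) hfin fun w hw a ha =>
      mem_stabCoset_mul_left hw ha).exists_eq_xStab_mul (periodicSet_cuts l) (cuts_nonempty l),
    (rightInvariant_heckeSum (periodicSet_cuts m) hfin fun w hw a ha =>
      mem_stabCoset_mul_right hw ha).exists_eq_mul_xStab (periodicSet_cuts m) (cuts_nonempty m)⟩

open Classical in
theorem val_phi (l : Comp n d) (g : ExtWeyl d) (m p q : Comp n d) :
    val p q (phi l g m) =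
      if p = m ∧ q = l then heckeSum (stabCoset (cuts l) g (cuts m)) else 0 := by
  have hex : ∃ F : Schur n d, IsPhi l g m F := by
    obtain ⟨⟨h, hh⟩, k, hk⟩ := heckeSum_stabCoset_eq l g m
    obtain ⟨F, hF, hF0⟩ := exists_schur_of_mul (mem_xModule.mpr ⟨h, hh⟩) hk
    refine ⟨F, fun p q => ?_⟩
    rw [doubleCoset_eq]
    by_cases hpq : p = m ∧ q = l
    · rw [if_pos hpq]
      obtain ⟨rfl, rfl⟩ := hpq
      exact hF
    · rw [if_neg hpq]
      exact hF0 p q hpq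
  have : IsPhi l g m (phi l g m) := by
    rw [phi, dif_pos hex]
    exact hex.choose_spec
  have h := this p q
  rw [doubleCoset_eq] at h
  change ((phi l g m (gen p) q : xModule q) : Hecke d) = _
  rw [h]

theorem isKappa_unique_comp {l l' m m' : Comp n d} {g g' : ExtWeyl d} {A : Theta n d}
    (h : IsKappa l g m A) (h' : IsKappa l' g' m' A) : l = l' ∧ m = m' :=
  ⟨comp_ext fun i => by rw [← rowSum_eq_part h, rowSum_eq_part h'],
    comp_ext fun j => by rw [← colSum_eq_part h, colSum_eq_part h']⟩

open Classical in
-- Row and column sums of `A` recover the compositions, and `A` recovers the double coset, so the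
-- choice made in `eElt` is immaterial. Any representative `g` may be used, not only the shortest
-- one.
theorem val_eElt {l : Comp n d} {g : ExtWeyl d} {m : Comp n d} {A : Theta n d}
    (h : IsKappa l g m A) (p q : Comp n d) :
    val p q (eElt A) =
      if p = m ∧ q = l then heckeSum (stabCoset (cuts l) g (cuts m)) else 0 := by
  have hex : ∃ t : Comp n d × ExtWeyl d × Comp n d,
      t.2.1 ∈ distinguishedDouble t.1 t.2.2 ∧ IsKappa t.1 t.2.1 t.2.2 A := by
    obtain ⟨l, g, m, h1, h2⟩ := exists_distinguished_isKappa A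
    exact ⟨(l, g, m), h1, h2⟩
  rw [eElt, dif_pos hex, val_phi]
  have h2 := hex.choose_spec.2
  obtain ⟨e1, e2⟩ := isKappa_unique_comp h2 h
  rw [e1, e2] at h2 ⊢
  rw [← stabCoset_eq_of_mem (mem_stabCoset_of_isKappa h h2)]

theorem val_eElt_self {l : Comp n d} {g : ExtWeyl d} {m : Comp n d} {A : Theta n d}
    (h : IsKappa l g m A) : val m l (eElt A) = heckeSum (stabCoset (cuts l) g (cuts m)) := by
  rw [val_eElt h, if_pos ⟨rfl, rfl⟩]

theorem hcoef_val_eq (F : Schur n d) {l m : Comp n d} {g g' : ExtWeyl d}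
    (h : g' ∈ stabCoset (cuts l) g (cuts m)) : hcoef g' (val m l F) = hcoef g (val m l F) := by
  obtain ⟨x, hx, y, hy, rfl⟩ := h
  rw [(rightInvariant_val F m l).hcoef_mul (periodicSet_cuts m) (cuts_nonempty m) hy,
    (leftInvariant_val F m l).hcoef_mul (periodicSet_cuts l) (cuts_nonempty l) hx]

/-- The coefficient of `e_A`. -/
noncomputable def schurCoef (A : Theta n d) : Schur n d →ₗ[Coeff] Coeff :=
  (hcoef (exists_isKappa A).choose_spec.choose).comp
    (val (exists_isKappa A).choose_spec.choose_spec.choose (exists_isKappa A).choose)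

theorem schurCoef_apply {l : Comp n d} {g : ExtWeyl d} {m : Comp n d} {A : Theta n d}
    (h : IsKappa l g m A) (F : Schur n d) : schurCoef A F = hcoef g (val m l F) := by
  have h2 := (exists_isKappa A).choose_spec.choose_spec.choose_spec
  obtain ⟨e1, e2⟩ := isKappa_unique_comp h2 h
  unfold schurCoef
  rw [LinearMap.comp_apply]
  generalize (exists_isKappa A).choose_spec.choose_spec.choose = m' at h2 e2 ⊢
  generalize (exists_isKappa A).choose_spec.choose = g' at h2 ⊢
  generalize (exists_isKappa A).choose = l' at h2 e1 ⊢
  subst e1 e2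
  exact hcoef_val_eq F (mem_stabCoset_of_isKappa h h2)

omit [NeZero d] in
theorem theta_eq_of_isKappa {l : Comp n d} {g : ExtWeyl d} {m : Comp n d} {A B : Theta n d}
    (h : IsKappa l g m A) (h' : IsKappa l g m B) : A = B := by
  ext i j
  rw [h i j, h' i j]

open Classical in
theorem schurCoef_eElt (A B : Theta n d) : schurCoef A (eElt B) = if B = A then 1 else 0 := by
  obtain ⟨l, g, m, h⟩ := exists_isKappa A
  obtain ⟨l', g', m', h'⟩ := exists_isKappa B
  rw [schurCoef_apply h, val_eElt h']
  by_cases e : B = A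
  · subst e
    obtain ⟨rfl, rfl⟩ := isKappa_unique_comp h h'
    rw [if_pos ⟨rfl, rfl⟩, if_pos rfl, hcoef_heckeSum (finite_stabCoset_cuts _ _ _),
      if_pos (mem_stabCoset_of_isKappa h' h)]
  · rw [if_neg e]
    split_ifs with h1
    · obtain ⟨rfl, rfl⟩ := h1
      rw [hcoef_heckeSum (finite_stabCoset_cuts _ _ _), if_neg]
      intro h2
      exact e (theta_eq_of_isKappa (isKappa_mul h' h2) h)
    · exact map_zero _

theorem schur_ext_coef {F G : Schur n d} (h : ∀ A, schurCoef A F = schurCoef A G) : F = G := by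
  apply schur_ext
  intro m l
  apply hecke_ext
  intro w
  obtain ⟨A, hA⟩ := exists_theta l w m
  rw [← schurCoef_apply hA, ← schurCoef_apply hA, h]

omit [NeZero n] [NeZero d] in
theorem finite_comp : Finite (Comp n d) := by
  let f : Comp n d → (Fin n → Fin (d + 1)) := fun l k =>
    ⟨l.1 k, Nat.lt_succ_of_le ((Finset.single_le_sum (fun _ _ => Nat.zero_le _)
      (Finset.mem_univ k)).trans_eq l.2)⟩
  apply Finite.of_injective f
  intro l l' e
  apply Subtype.ext
  funext k
  exact congrArg Fin.val (congrFun e k)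

/-- There are finitely many pairs of compositions, each component of `F` has finite support in the
basis `T_w`, and `A` is determined by its compositions and a representative. -/
theorem finite_schurCoef (F : Schur n d) : {A | schurCoef A F ≠ 0}.Finite := by
  have := finite_comp (n := n) (d := d)
  choose l g m h using exists_isKappa (n := n) (d := d)
  have hfin : (⋃ p : Comp n d × Comp n d,
      (fun w => (p, w)) '' {w | hcoef w (val p.1 p.2 F) ≠ 0}).Finite :=
    Set.finite_iUnion fun p => (finite_support_hcoef _).image _
  have hinj : Function.Injective fun A : Theta n d => ((m A, l A), g A) := by
    intro A B e
    simp only [Prod.mk.injEq] at e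
    have hB := h B
    rw [← e.1.1, ← e.1.2, ← e.2] at hB
    exact theta_eq_of_isKappa (h A) hB
  apply Set.Finite.of_finite_image _ (f := fun A : Theta n d => ((m A, l A), g A)) hinj.injOn
  apply hfin.subset
  rintro _ ⟨A, hA, rfl⟩
  refine Set.mem_iUnion.mpr ⟨(m A, l A), g A, ?_, rfl⟩
  have hA : schurCoef A F ≠ 0 := hA
  rwa [schurCoef_apply (h A)] at hA

/-- The basis `e_A` of the `q`-Schur algebra. -/
theorem exists_basis_eElt : ∃ b : Module.Basis (Theta n d) Coeff (Schur n d),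
    (∀ A, b A = eElt A) ∧ ∀ A F, b.repr F A = schurCoef A F := by
  classical
  refine exists_basis_of_dual eElt schurCoef (fun A B => ?_) finite_schurCoef
    fun F G h => schur_ext_coef h
  rw [schurCoef_eElt]

/-! ### Bar invariant elements -/

theorem isBar_iff (F G : Schur n d) : IsBar F G ↔
    ∀ m l, val m l G = vpow (2 * maxLen d (cuts m)) • heckeBar d (val m l F) := by
  refine forall_congr' fun m => forall_congr' fun l => ?_
  rw [longestLen_eq]
  rfl

theorem IsBar.bar_eq {F G : Schur n d} (h : IsBar F G) : bar F = G := by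
  have hex : ∃ G : Schur n d, IsBar F G := ⟨G, h⟩
  rw [bar, dif_pos hex]
  have h1 := (isBar_iff _ _).mp hex.choose_spec
  apply schur_ext
  intro m l
  rw [h1, (isBar_iff _ _).mp h]

/-- Invariance of `G` lets each component `x_r h_r` be rewritten as `x_r` times a rescaled bar
conjugate of `h_r`. After applying `F`, its invariance at `x_r` supplies `v^{2ℓ(w_r)}`, which
cancels the rescaling and leaves the power belonging to `m`. -/
theorem IsBar.mul {F G : Schur n d} (hF : IsBar F F) (hG : IsBar G G) : IsBar (F * G) (F * G) := by
  classical
  rw [isBar_iff] at hF hG ⊢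
  intro m l
  choose h hh using val_mem G m
  rw [val_mul F G m l h hh, map_sum, Finset.smul_sum]
  apply Finset.sum_congr rfl
  intro r _
  have e1 : xElt r * h r =
      xElt r * (vpow (2 * maxLen d (cuts m) - 2 * maxLen d (cuts r)) • heckeBar d (h r)) := by
    have := hG m r
    rw [hh] at this
    conv_lhs => rw [this]
    rw [map_mul, xElt_eq, heckeBar_xStab (periodicSet_cuts r) (cuts_nonempty r), smul_mul_assoc,
      smul_smul, vpow_mul, mul_smul_comm]
    congr 2
  conv_lhs => rw [val_mul_congr F r l e1, mul_smul_comm, hF r l]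
  rw [map_mul, smul_mul_assoc, smul_smul, vpow_mul, sub_add_cancel]

theorem isBar_one : IsBar (1 : Schur n d) 1 := by
  classical
  rw [isBar_iff]
  intro m l
  have h : val m l (1 : Schur n d) = if m = l then xElt l else 0 := by
    change (((gen m : DirectSum (Comp n d) fun l => xModule l) l : xModule l) : Hecke d) = _
    split_ifs with h
    · subst h
      exact congrArg Subtype.val (DirectSum.of_eq_same (β := fun l : Comp n d => xModule l) m _)
    · exact congrArg Subtype.val
        (DirectSum.of_eq_of_ne (β := fun l : Comp n d => xModule l) m l _ (Ne.symm h))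
  rw [h]
  split_ifs with e
  · subst e
    rw [xElt_eq, heckeBar_xStab (periodicSet_cuts m) (cuts_nonempty m), smul_smul, vpow_mul,
      show ∀ a : ℤ, 2 * a + -2 * a = 0 by intro a; ring, vpow_zero, one_smul]
  · rw [map_zero, smul_zero]

end Schur

/-! ### Unitriangular families -/

/-- In a linear relation, the coordinate at an index of largest weight with nonzero coefficient sees
only that term. Spanning is by induction on the weight, dividing by the unit `u i`. -/
theorem exists_basis_of_triangular {R ι M : Type*} [CommRing R] [Nontrivial R] [AddCommGroup M]
    [Module R M] (b : Module.Basis ι R M) (m : ι → M) (wt : ι → ℕ) (u : ι → R)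
    (hu : ∀ i, IsUnit (u i))
    (h : ∀ i, m i - u i • b i ∈ Submodule.span R (b '' {j | wt j < wt i})) :
    ∃ b' : Module.Basis ι R M, ∀ i, b' i = m i := by
  classical
  have hcoord : ∀ i j, i ≠ j → wt j ≤ wt i → b.coord i (m j) = 0 := by
    intro i j hij hle
    have h1 : b.coord i (m j - u j • b j) = 0 := by
      have h2 := (Module.Basis.mem_span_image b).mp (h j)
      by_contra h3
      have h4 : i ∈ {k | wt k < wt j} := h2 (by simpa using h3)
      have h4 : wt i < wt j := h4
      omega
    rw [map_sub, map_smul, Module.Basis.coord_apply b i (b j), Module.Basis.repr_self,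
      Finsupp.single_eq_of_ne hij, smul_zero, sub_zero] at h1
    exact h1
  have hself : ∀ i, b.coord i (m i) = u i := by
    intro i
    have h1 : b.coord i (m i - u i • b i) = 0 := by
      have h2 := (Module.Basis.mem_span_image b).mp (h i)
      by_contra h3
      have h4 : i ∈ {k | wt k < wt i} := h2 (by simpa using h3)
      have h4 : wt i < wt i := h4
      omega
    rw [map_sub, map_smul, Module.Basis.coord_apply b i (b i), Module.Basis.repr_self,
      Finsupp.single_eq_same, smul_eq_mul, mul_one, sub_eq_zero] at h1
    exact h1
  have hli : LinearIndependent R m := by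
    rw [linearIndependent_iff']
    intro s c hc
    by_contra! hne
    obtain ⟨i₀, hi₀, hc₀⟩ := hne
    obtain ⟨i, hi, hmax⟩ := (s.filter fun i => c i ≠ 0).exists_max_image wt
      ⟨i₀, Finset.mem_filter.mpr ⟨hi₀, hc₀⟩⟩
    rw [Finset.mem_filter] at hi
    have h1 := congrArg (b.coord i) hc
    rw [map_sum, map_zero, Finset.sum_eq_single i] at h1
    · rw [map_smul, hself, smul_eq_mul] at h1
      exact hi.2 ((hu i).mul_left_eq_zero.mp h1)
    · intro j hj hji
      rw [map_smul]
      by_cases hcj : c j = 0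
      · rw [hcj, zero_smul]
      · rw [hcoord i j hji.symm (hmax j (Finset.mem_filter.mpr ⟨hj, hcj⟩)), smul_zero]
    · intro h2
      exact absurd hi.1 h2
  have hspan : ∀ k i, wt i < k → b i ∈ Submodule.span R (Set.range m) := by
    intro k
    induction k with
    | zero => intro i hi; omega
    | succ k ih =>
      intro i hi
      have h1 : m i - u i • b i ∈ Submodule.span R (Set.range m) := by
        refine Submodule.span_le.mpr ?_ (h i)
        rintro _ ⟨j, hj, rfl⟩
        have hj : wt j < wt i := hj
        exact ih j (by omega)
      have h2 : u i • b i ∈ Submodule.span R (Set.range m) := by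
        have := Submodule.sub_mem _ (Submodule.subset_span (Set.mem_range_self i)) h1
        rwa [sub_sub_cancel] at this
      obtain ⟨v, hv⟩ := (hu i).exists_left_inv
      have := Submodule.smul_mem _ v h2
      rwa [smul_smul, hv, one_smul] at this
  refine ⟨Module.Basis.mk hli ?_, fun i => Module.Basis.mk_apply _ _ i⟩
  rw [← b.span_eq, Submodule.span_le]
  rintro _ ⟨i, rfl⟩
  exact hspan _ i (Nat.lt_succ_self _)

theorem exists_basis_of_coord_triangular {R ι M : Type*} [CommRing R] [Nontrivial R]
    [AddCommMonoid M] [Module R M] (b : Module.Basis ι R M) (m : ι → M) (wt : ι → ℕ)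
    (hu : ∀ i, IsUnit (b.repr (m i) i))
    (h : ∀ i j, b.repr (m i) j ≠ 0 → j = i ∨ wt j < wt i) :
    ∃ b' : Module.Basis ι R M, ∀ i, b' i = m i := by
  classical
  -- The subtraction takes place among coordinate vectors, so `M` itself needs no negatives.
  obtain ⟨b', hb'⟩ := exists_basis_of_triangular (Finsupp.basisSingleOne (R := R) (ι := ι))
    (fun i => b.repr (m i)) wt (fun i => b.repr (m i) i) hu fun i => by
      rw [Module.Basis.mem_span_image]
      intro j hj
      simp only [Finsupp.basisSingleOne_repr, LinearEquiv.refl_apply, Finsupp.coe_basisSingleOne,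
        SetLike.mem_coe, Finsupp.mem_support_iff, Finsupp.sub_apply, Finsupp.smul_apply,
        Finsupp.single_apply, smul_eq_mul] at hj
      by_cases e : i = j
      · subst e
        simp at hj
      · rw [if_neg e, mul_zero, sub_zero] at hj
        exact (h i j hj).resolve_left fun e' => e e'.symm
  exact ⟨b'.map b.repr.symm, fun i => by rw [Module.Basis.map_apply, hb', b.repr.symm_apply_apply]⟩

end AffineSchur
namespace AffineSchur

/-! ### Sums over a period -/

section Window

variable {n d : ℕ} [NeZero n]

theorem sum_blocks {M : Type*} [AddCommMonoid M] (l : Comp n d) (f : ℤ → M) :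
    ∑ k ∈ Finset.range n,
      ∑ t ∈ Finset.Ioc (blockStart l (1 + k)) (blockStart l (1 + k + 1)), f t =
      ∑ j ∈ Finset.range d, f (1 + j) := by
  have key : ∀ N : ℕ, ∑ k ∈ Finset.range N,
      ∑ t ∈ Finset.Ioc (blockStart l (1 + k)) (blockStart l (1 + k + 1)), f t =
      ∑ t ∈ Finset.Ioc (blockStart l 1) (blockStart l (1 + N)), f t := by
    intro N
    induction N with
    | zero => simp
    | succ N ih =>
      have h1 := blockStart_mono l (show (1 : ℤ) ≤ 1 + N by omega)
      have h2 := blockStart_mono l (show (1 : ℤ) + N ≤ 1 + N + 1 by omega)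
      rw [Finset.sum_range_succ, ih, Nat.cast_succ, ← add_assoc,
        ← Finset.Ioc_union_Ioc_eq_Ioc h1 h2, Finset.sum_union]
      rw [Finset.disjoint_left]
      intro t h3 h4
      rw [Finset.mem_Ioc] at h3 h4
      omega
  rw [key, show (1 : ℤ) + n = 1 + 1 * n by ring, blockStart_add, blockStart_one]
  refine Finset.sum_nbij' (fun t => (t - 1).toNat) (fun j => 1 + (j : ℤ)) ?_ ?_ ?_ ?_ ?_
  · intro t ht
    rw [Finset.mem_Ioc] at ht
    rw [Finset.mem_range]
    omega
  · intro j hj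
    rw [Finset.mem_range] at hj
    rw [Finset.mem_Ioc]
    omega
  · intro t ht
    rw [Finset.mem_Ioc] at ht
    omega
  · intro j _
    omega
  · intro t ht
    rw [Finset.mem_Ioc] at ht
    congr 1
    omega

variable [NeZero d]

/-- A sum over entries becomes a sum over the `d` positions of one period, each entry `a_ij`
standing for the positions in row block `i` and column block `j`. Weights and `dStat` are compared
position by position in this form. -/
theorem sum_isKappa {l m : Comp n d} {g : ExtWeyl d} {A : Theta n d} (h : IsKappa l g m A)
    (w : ℤ → ℤ → ℕ) : ∑ k ∈ Finset.range n, ∑ᶠ j, A.entry (1 + k) j * w (1 + k) j =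
      ∑ j ∈ Finset.range d, w (blk l (1 + j)) (blk m ((g⁻¹).1 (1 + j))) := by
  rw [← sum_blocks l fun t => w (blk l t) (blk m ((g⁻¹).1 t))]
  apply Finset.sum_congr rfl
  intro k _
  rw [finsum_congr fun j => by rw [isKappa_iff.mp h],
    finsum_ncard_mul l (1 + k) (fun t => blk m ((g⁻¹).1 t)) (w (1 + k))]
  apply Finset.sum_congr rfl
  intro t ht
  rw [Finset.mem_Ioc] at ht
  rw [blk_eq_iff.mpr ht]

theorem entry_ne_zero_iff {l m : Comp n d} {g : ExtWeyl d} {A : Theta n d} (h : IsKappa l g m A)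
    (i j : ℤ) : A.entry i j ≠ 0 ↔ ∃ t, blk l t = i ∧ blk m ((g⁻¹).1 t) = j := by
  rw [isKappa_iff.mp h, ← Nat.pos_iff_ne_zero,
    Set.ncard_pos ((finite_blk l i).subset fun t ht => ht.1)]
  rfl

/-- The sum of the squared distances to the diagonal. -/
noncomputable def weight (A : Theta n d) : ℕ :=
  ∑ k ∈ Finset.range n, ∑ᶠ j, A.entry (1 + k) j * (j - (1 + k)).natAbs ^ 2

theorem weight_eq {l m : Comp n d} {g : ExtWeyl d} {A : Theta n d} (h : IsKappa l g m A) :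
    (weight A : ℤ) =
      ∑ j ∈ Finset.range d, (blk m ((g⁻¹).1 (1 + j)) - blk l (1 + j)) ^ 2 := by
  rw [weight, sum_isKappa h fun i j => (j - i).natAbs ^ 2]
  push_cast
  simp only [sq_abs]

end Window

/-! ### Bidiagonal matrices -/

section Bidiagonal

variable {n d : ℕ}

/-- All nonzero entries lie on the diagonals `j = i` and `j = i + e`. -/
def IsBidiagonal (B : Theta n d) (e : ℤ) : Prop := ∀ i j, B.entry i j ≠ 0 → j = i ∨ j = i + e

theorem IsBidiagonal.rowSum_eq {B : Theta n d} {e : ℤ} (hB : IsBidiagonal B e) (he : e ≠ 0) (i : ℤ) :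
    B.rowSum i = B.entry i i + B.entry i (i + e) := by
  classical
  unfold Theta.rowSum
  rw [finsum_eq_sum_of_support_subset (s := {i, i + e}), Finset.sum_pair (by omega)]
  intro j hj
  simpa using hB i j hj

theorem IsBidiagonal.colSum_eq {B : Theta n d} {e : ℤ} (hB : IsBidiagonal B e) (he : e ≠ 0) (j : ℤ) :
    B.colSum j = B.entry j j + B.entry (j - e) j := by
  classical
  unfold Theta.colSum
  rw [finsum_eq_sum_of_support_subset (s := {j, j - e}), Finset.sum_pair (by omega)]
  intro i hi
  have := hB i j hi
  simp only [Finset.coe_insert, Finset.coe_singleton, Set.mem_insert_iff, Set.mem_singleton_iff]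
  omega

theorem isBidiagonal_bidiag (A : Theta n d) (c e : ℤ) : IsBidiagonal (A.bidiag c e) e := by
  intro i j h
  by_contra! hij
  simp [Theta.bidiag, hij.1, hij.2] at h

theorem bidiag_entry (A : Theta n d) (c : ℤ) {e : ℤ} (he : e ≠ 0) (i : ℤ) :
    (A.bidiag c e).entry i (i + e) = A.entry i (i + c) := by
  simp [Theta.bidiag, he]

theorem eq_of_forall_succ_eq {f : ℤ → ℤ} (h : ∀ i, f (i + 1) = f i) (i : ℤ) : f i = f 0 := by
  induction i using Int.induction_on with
  | zero => rfl
  | succ i ih => rw [h, ih]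
  | pred i ih => rw [← ih, ← h (-(i : ℤ) - 1), sub_add_cancel]

theorem rot_zpow_inv_apply (z t : ℤ) : ((rot d ^ z)⁻¹).1 t = t - z := by
  rw [← zpow_neg, rot_zpow_apply]
  ring

variable [NeZero n] [NeZero d]

theorem ncard_blk_blk_sub (l m : Comp n d) (z i j : ℤ) :
    {t | blk l t = i ∧ blk m (t - z) = j}.ncard =
      (min (blockStart l (i + 1)) (blockStart m (j + 1) + z) -
        max (blockStart l i) (blockStart m j + z)).toNat := by
  rw [← Int.card_Ioc, ← Set.ncard_coe_finset, Finset.coe_Ioc]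
  congr 1
  ext t
  simp only [Set.mem_ofPred_eq, blk_eq_iff, Set.mem_Ioc]
  omega

/-- A bidiagonal matrix comes from a rotation. -/
theorem IsBidiagonal.exists_isKappa_rot {B : Theta n d} {e : ℤ} (hB : IsBidiagonal B e)
    (he : e = 1 ∨ e = -1) : ∃ (l : Comp n d) (z : ℤ) (m : Comp n d), IsKappa l (rot d ^ z) m B := by
  have he0 : e ≠ 0 := by omega
  obtain ⟨l, hl⟩ := exists_comp_part_eq B.rowSum B.rowSum_add B.total
  obtain ⟨m, hm⟩ := exists_comp_part_eq B.colSum (colSum_add B) (sum_colSum B)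
  obtain ⟨b, hb⟩ : ∃ b : ℤ → ℕ, ∀ i, B.entry i i = b i := ⟨_, fun _ => rfl⟩
  obtain ⟨u, hu⟩ : ∃ u : ℤ → ℕ, ∀ i, B.entry i (i + e) = u i := ⟨_, fun _ => rfl⟩
  have hl' : ∀ i, blockStart l (i + 1) = blockStart l i + b i + u i := fun i => by
    rw [blockStart_succ, hl, hB.rowSum_eq he0, hb, hu]
    push_cast
    ring
  have hm' : ∀ i, blockStart m (i + 1) = blockStart m i + b i + u (i - e) := fun i => by
    have := hu (i - e)
    rw [sub_add_cancel] at this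
    rw [blockStart_succ, hm, hB.colSum_eq he0, hb, this]
    push_cast
    ring
  have hB0 : ∀ i j, j ≠ i → j ≠ i + e → B.entry i j = 0 := fun i j h1 h2 => by
    by_contra h
    have := hB i j h
    tauto
  have hlmono : ∀ i j, i ≤ j → blockStart l i ≤ blockStart l j := fun i j h => blockStart_mono l h
  suffices h : ∃ z : ℤ, ∀ i j, B.entry i j =
      (min (blockStart l (i + 1)) (blockStart m (j + 1) + z) -
        max (blockStart l i) (blockStart m j + z)).toNat by
    obtain ⟨z, hz⟩ := h
    refine ⟨l, z, m, isKappa_iff.mpr fun i j => ?_⟩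
    simp only [rot_zpow_inv_apply]
    rw [hz, ncard_blk_blk_sub]
  rcases he with rfl | rfl
  · have hD := eq_of_forall_succ_eq (f := fun i => blockStart m i - blockStart l i + u (i - 1))
      fun i => by
        simp only [hl', hm', add_sub_cancel_right]
        ring
    -- With this shift, column block `i` starts `u (i - 1)` places before row block `i`, so it
    -- begins with the last `u (i - 1)` positions of row block `i - 1`.
    refine ⟨blockStart l 0 - blockStart m 0 - u (0 - 1), fun i j => ?_⟩
    have hDj := hD j
    have hDj' := hD (j + 1)
    rw [add_sub_cancel_right] at hDj'
    by_cases h1 : j = i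
    · subst h1
      have := hl' j
      have e1 := hl' (j - 1)
      rw [sub_add_cancel] at e1
      rw [hb]
      omega
    by_cases h2 : j = i + 1
    · subst h2
      have e1 := hl' i
      have e2 := hl' (i + 1)
      rw [add_sub_cancel_right] at hDj
      rw [hu]
      omega
    · rw [hB0 i j h1 h2]
      rcases lt_or_gt_of_ne h1 with h | h
      · have := hlmono (j + 1) i (by omega)
        omega
      · have := hlmono (i + 1) (j - 1) (by omega)
        have e1 := hl' (j - 1)
        rw [sub_add_cancel] at e1
        omega
  · have hD := eq_of_forall_succ_eq (f := fun i => blockStart m i - blockStart l i - u i)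
      fun i => by
        simp only [hl', hm', sub_neg_eq_add]
        ring
    -- Here column block `i` starts `u i` places after row block `i`, whose first `u i` positions
    -- belong to column block `i - 1`.
    refine ⟨blockStart l 0 - blockStart m 0 + u 0, fun i j => ?_⟩
    have hDj := hD j
    have hDj' := hD (j + 1)
    have e0 := hl' j
    have e1 := hl' (j + 1)
    by_cases h1 : j = i
    · subst h1
      rw [hb]
      omega
    by_cases h2 : j = i + -1
    · obtain rfl : i = j + 1 := by omega
      have e2 := hu (j + 1)
      rw [add_neg_cancel_right] at e2
      rw [e2]
      omega
    · rw [hB0 i j h1 h2]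
      rcases lt_or_gt_of_ne h1 with h | h
      · have := hlmono (j + 1 + 1) i (by omega)
        omega
      · have := hlmono (i + 1) j (by omega)
        omega

theorem IsBidiagonal.blk_sub {B : Theta n d} {e z : ℤ} (hB : IsBidiagonal B e) {l m : Comp n d}
    (h : IsKappa l (rot d ^ z) m B) (t : ℤ) :
    blk m (t - z) = blk l t ∨ blk m (t - z) = blk l t + e := by
  apply hB
  rw [entry_ne_zero_iff h]
  exact ⟨t, rfl, by rw [rot_zpow_inv_apply]⟩

omit [NeZero n] [NeZero d] in
-- The entries stay within one step of the diagonal, so a pair with `x ≤ i` and `y > j` must lie in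
-- a single row, with `j` the smaller and `y` the larger of its two possible columns.
theorem IsBidiagonal.dStat_eq {B : Theta n d} {e : ℤ} (hB : IsBidiagonal B e)
    (he : e = 1 ∨ e = -1) : dStat B = ∑ k ∈ Finset.range n, ∑ᶠ j, B.entry (1 + k) j *
      if j = min (1 + (k : ℤ)) (1 + k + e) then
        B.entry (1 + k) (max (1 + (k : ℤ)) (1 + k + e)) else 0 := by
  classical
  unfold dStat
  have key : ∀ i : ℤ, (∑ᶠ j : ℤ, ∑ᶠ p ∈ {p : ℤ × ℤ | p.1 ≤ i ∧ j < p.2},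
      B.entry i j * B.entry p.1 p.2) =
      ∑ᶠ j, B.entry i j * if j = min i (i + e) then B.entry i (max i (i + e)) else 0 := by
    intro i
    apply finsum_congr
    intro j
    rw [finsum_eq_single _ ((i, max i (i + e)) : ℤ × ℤ)]
    · by_cases hj : j = min i (i + e)
      · rw [finsum_eq_if, if_pos hj, if_pos]
        simp only [Set.mem_ofPred_eq]
        omega
      · rw [if_neg hj, mul_zero]
        rw [finsum_eq_if, ite_eq_right_iff]
        rintro ⟨-, h⟩
        simp only at h
        by_contra h0
        have := hB i j (left_ne_zero_of_mul h0)
        omega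
    · rintro ⟨x, y⟩ hxy
      rw [finsum_eq_if, ite_eq_right_iff]
      rintro ⟨h1, h2⟩
      simp only at h1 h2
      by_contra h0
      have h3 := hB i j (left_ne_zero_of_mul h0)
      have h4 := hB x y (right_ne_zero_of_mul h0)
      apply hxy
      rw [Prod.mk.injEq]
      omega
  rw [Finset.sum_congr rfl fun i _ => key i]
  refine Finset.sum_nbij' (fun i => (i - 1).toNat) (fun k => 1 + (k : ℤ)) ?_ ?_ ?_ ?_ ?_
  · intro t ht
    rw [Finset.mem_Icc] at ht
    rw [Finset.mem_range]
    omega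
  · intro j hj
    rw [Finset.mem_range] at hj
    rw [Finset.mem_Icc]
    omega
  · intro t ht
    rw [Finset.mem_Icc] at ht
    omega
  · intro j _
    omega
  · intro t ht
    rw [Finset.mem_Icc] at ht
    rw [show 1 + (((t - 1).toNat : ℕ) : ℤ) = t by omega]

theorem mem_afterSet_cuts_iff (l : Comp n d) (t j : ℤ) :
    j ∈ afterSet (cuts l) t ↔ t < j ∧ blk l j = blk l t := by
  unfold afterSet
  simp only [Set.mem_ofPred_eq, cuts, Set.forall_mem_range]
  refine and_congr_right fun h => ?_
  have hlt : ∀ i, blockStart l i < t ↔ i ≤ blk l t := fun i => by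
    rw [← not_le, le_blockStart_iff, not_lt]
  simp only [hlt, le_blockStart_iff]
  have h1 := blk_mono l h.le
  constructor
  · intro h2
    have := h2 (blk l j)
    omega
  · intro h2 i
    omega

theorem mem_afterSet_union_iff (l m : Comp n d) (z t j : ℤ) :
    j ∈ afterSet (cuts l ∪ (fun s => s + z) '' cuts m) t ↔
      t < j ∧ blk l j = blk l t ∧ blk m (j - z) = blk m (t - z) := by
  have h1 := mem_afterSet_cuts_iff l t j
  have h2 := mem_afterSet_cuts_iff m (t - z) (j - z)
  unfold afterSet at h1 h2 ⊢
  simp only [Set.mem_ofPred_eq] at h1 h2 ⊢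
  constructor
  · rintro ⟨h3, h4⟩
    refine ⟨h3, (h1.mp ⟨h3, fun s hs => h4 s (Or.inl hs)⟩).2, (h2.mp ⟨by omega, fun s hs => ?_⟩).2⟩
    have := h4 (s + z) (Or.inr ⟨s, hs, rfl⟩)
    omega
  · rintro ⟨h3, h4, h5⟩
    refine ⟨h3, ?_⟩
    rintro s (hs | ⟨s, hs, rfl⟩)
    · exact (h1.mpr ⟨h3, h4⟩).2 s hs
    · have := (h2.mpr ⟨by omega, h5⟩).2 s hs
      simp only
      omega

omit [NeZero n] in
theorem maxLen_eq {Z : Set ℤ} (hZ : PeriodicSet d Z) (hne : Z.Nonempty) :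
    maxLen d Z = ∑ j ∈ Finset.range d, (afterSet Z (1 + j)).ncard := by
  obtain ⟨w, hw, h⟩ := exists_longest hZ hne
  rw [maxLen, sSup_len_stab hZ hne hw h, len_longest hZ hne hw h 1]

/-- The length of a longest element counts pairs not separated by cuts. Among pairs in one row
block, those split by the translated column cuts pair the two entries of that row, and they number
`d_B` in one period. -/
theorem IsBidiagonal.maxLen_cuts {B : Theta n d} {e z : ℤ} (hB : IsBidiagonal B e)
    (he : e = 1 ∨ e = -1) {l m : Comp n d} (h : IsKappa l (rot d ^ z) m B) :
    maxLen d (cuts l) = maxLen d (cuts l ∪ (fun s => s + z) '' cuts m) + dStat B := by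
  have hu := (periodicSet_cuts l).union ((periodicSet_cuts m).image_add z)
  rw [maxLen_eq (periodicSet_cuts l) (cuts_nonempty l),
    maxLen_eq hu ((cuts_nonempty l).mono Set.subset_union_left), hB.dStat_eq he,
    sum_isKappa h fun i j => if j = min i (i + e) then B.entry i (max i (i + e)) else 0,
    ← Finset.sum_add_distrib]
  apply Finset.sum_congr rfl
  intro k _
  generalize (1 : ℤ) + (k : ℤ) = t
  simp only [rot_zpow_inv_apply]
  set D : Set ℤ := {j | t < j ∧ blk l j = blk l t ∧ blk m (j - z) ≠ blk m (t - z)} with hD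
  have hunion : afterSet (cuts l) t = afterSet (cuts l ∪ (fun s => s + z) '' cuts m) t ∪ D := by
    ext j
    rw [Set.mem_union, mem_afterSet_cuts_iff, mem_afterSet_union_iff, hD, Set.mem_ofPred_eq]
    tauto
  have hfin := finite_blk l (blk l t)
  rw [hunion, Set.ncard_union_eq ?_
    (hfin.subset fun j hj => ((mem_afterSet_union_iff l m z t j).mp hj).2.1)
    (hfin.subset fun j hj => hj.2.1)]
  · congr 1
    have ht := hB.blk_sub h t
    split_ifs with h1
    · rw [isKappa_iff.mp h]
      congr 1
      ext j
      simp only [hD, Set.mem_ofPred_eq, rot_zpow_inv_apply]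
      constructor
      · rintro ⟨h2, h3, h4⟩
        have hj := hB.blk_sub h j
        refine ⟨h3, ?_⟩
        omega
      · rintro ⟨h2, h3⟩
        have h4 : ¬ j ≤ t := fun h4 => by
          have := blk_mono m (show j - z ≤ t - z by omega)
          omega
        exact ⟨by omega, h2, by omega⟩
    · rw [Set.ncard_eq_zero (hfin.subset fun j hj => hj.2.1), Set.eq_empty_iff_forall_notMem]
      rintro j ⟨h2, h3, h4⟩
      have hj := hB.blk_sub h j
      have := blk_mono m (show t - z ≤ j - z by omega)
      omega
  · rw [Set.disjoint_left]
    intro j hj hj'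
    exact hj'.2.2 ((mem_afterSet_union_iff l m z t j).mp hj).2.2

/-- The standard basis element of a bidiagonal matrix is bar invariant. -/
theorem IsBidiagonal.isBar_std {B : Theta n d} {e : ℤ} (hB : IsBidiagonal B e)
    (he : e = 1 ∨ e = -1) : IsBar (std B) (std B) := by
  classical
  obtain ⟨l, z, m, h⟩ := hB.exists_isKappa_rot he
  rw [isBar_iff]
  intro p q
  have e1 : val p q (std B) = vpow (-(dStat B : ℤ)) • val p q (eElt B) := map_smul _ _ _
  rw [e1, val_eElt h]
  split_ifs with hpq
  · obtain ⟨rfl, rfl⟩ := hpq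
    rw [heckeBar_smul, invert_vpow, heckeBar_heckeSum_rot (periodicSet_cuts _) (cuts_nonempty _)
      (periodicSet_cuts _) (cuts_nonempty _), smul_smul, smul_smul, vpow_mul, vpow_mul]
    congr 2
    -- The power from the bar involution of the Schur algebra cancels the length for `m`. The
    -- remaining exponent is `d_B` minus twice the difference of the lengths for `l` and for the
    -- intersection, hence `-d_B`.
    have := hB.maxLen_cuts he h
    omega
  · rw [smul_zero, map_zero, smul_zero]

end Bidiagonal

end AffineSchur
namespace AffineSchur

/-! ### Multiplication by a bidiagonal basis element -/

section Product

variable {n d : ℕ} [NeZero n] [NeZero d] {l m p : Comp n d} {z : ℤ} {B C C' : Theta n d}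

open Classical in
-- Multiplying by the Poincaré polynomial replaces the coset sum for `B` by `x_l T_{π^z} x_m`. The
-- last factor combines with `h` into the coset sum for `C'`, which `π^z` merely translates, and the
-- coefficient of `x_l` times a sum is known at a shortest `y`.
theorem poincare_mul_hcoef {w y : ExtWeyl d} (hB : IsKappa l (rot d ^ z) m B)
    (hC : IsKappa m w p C') (hy : IsLeftMin (cuts l) y) :
    poincare d (cuts l ∪ (fun s => s + z) '' cuts m) * hcoef y (val p l (eElt B * eElt C')) =
      ∑ b ∈ (finite_stab (periodicSet_cuts l) (cuts_nonempty l)).toFinset with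
        IsKappa m ((rot d ^ z)⁻¹ * (b * y)) p C', vpow (2 * len b) := by
  obtain ⟨⟨h, hh⟩, -⟩ := heckeSum_stabCoset_eq m w p
  have hv : val p l (eElt B * eElt C') = heckeSum (stabCoset (cuts l) (rot d ^ z) (cuts m)) * h := by
    rw [val_mul_of_single _ _ p l m h (by rw [val_eElt_self hC, hh])
      fun r hr => by rw [val_eElt hC, if_neg fun h => hr h.2], val_eElt_self hB]
  have hfin := finite_stabCoset_cuts m w p
  have hT : heckeT (rot d ^ z) * heckeSum (stabCoset (cuts m) w (cuts p)) =
      heckeSum ((fun u => rot d ^ z * u) '' stabCoset (cuts m) w (cuts p)) := by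
    rw [heckeSum, heckeSum, finsum_mem_image fun u _ u' _ e => mul_left_cancel e,
      mul_finsum_mem' _ _ hfin]
    exact finsum_mem_congr rfl fun u _ => heckeT_rot_mul _ _
  rw [hv, ← smul_eq_mul, ← map_smul, ← smul_mul_assoc,
    ← xStab_mul_rot_mul_xStab (periodicSet_cuts l) (cuts_nonempty l) (periodicSet_cuts m)
      (cuts_nonempty m), mul_assoc, ← xElt_eq m, ← hh, mul_assoc, hT,
    hcoef_xStab_mul_heckeSum (periodicSet_cuts l) (cuts_nonempty l) hy (hfin.image _)]
  congr 1
  apply Finset.filter_congr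
  intro b _
  constructor
  · rintro ⟨u, hu, e⟩
    simp only at e
    rw [← e, inv_mul_cancel_left]
    exact isKappa_mul hC hu
  · intro hk
    exact ⟨_, mem_stabCoset_of_isKappa hC hk, mul_inv_cancel_left _ _⟩

theorem exists_isLeftMin_isKappa (A : Theta n d) :
    ∃ l y p, IsLeftMin (cuts l) y ∧ IsKappa l y p A := by
  obtain ⟨l, w, p, h⟩ := exists_isKappa A
  obtain ⟨a, ha, y, hy, rfl⟩ := exists_isLeftMin (periodicSet_cuts l) w
  exact ⟨l, y, p, hy, isKappa_mul h ⟨a⁻¹, (stab d _).inv_mem ha, 1, (stab d _).one_mem, by group⟩⟩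

theorem IsKappa.mul_left {w b : ExtWeyl d} (h : IsKappa l w p C) (hb : b ∈ stab d (cuts l)) :
    IsKappa l (b * w) p C :=
  isKappa_mul h ⟨b, hb, 1, (stab d _).one_mem, by group⟩

/-- After mismatched compositions are excluded, a nonzero coefficient needs a summand in
`poincare_mul_hcoef`, and `w = b y` for such a `b` is the witness. One permutation then carries `B`,
`C` and `C'` together, so they can be compared at each position. -/
theorem exists_of_schurCoef_mul_ne_zero (hB : IsKappa l (rot d ^ z) m B)
    (h : schurCoef C (eElt B * eElt C') ≠ 0) :
    ∃ p w, IsKappa l w p C ∧ IsKappa m ((rot d ^ z)⁻¹ * w) p C' := by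
  classical
  obtain ⟨l', y, p', hy, hC⟩ := exists_isLeftMin_isKappa C
  obtain ⟨m', w, p, hC'⟩ := exists_isKappa C'
  rw [schurCoef_apply hC] at h
  obtain ⟨⟨k, hk⟩, -⟩ := heckeSum_stabCoset_eq m' w p
  obtain rfl : p' = p := by
    by_contra hp
    have h0 : ∀ r, val p' r (eElt C') = 0 := fun r => by
      rw [val_eElt hC', if_neg fun h => hp h.1]
    apply h
    rw [val_mul_of_single _ _ p' l' m' 0 (by rw [h0, mul_zero]) fun r _ => h0 r, mul_zero, map_zero]
  have hv : val p' l' (eElt B * eElt C') = val m' l' (eElt B) * k :=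
    val_mul_of_single _ _ p' l' m' k (by rw [val_eElt_self hC', hk])
      fun r hr => by rw [val_eElt hC', if_neg fun h => hr h.2]
  obtain ⟨rfl, rfl⟩ : m' = m ∧ l' = l := by
    by_contra hml
    apply h
    rw [hv, val_eElt hB, if_neg hml, zero_mul, map_zero]
  have hu := (periodicSet_cuts l').union ((periodicSet_cuts m').image_add z)
  have hP := mul_ne_zero
    (poincare_ne_zero hu ((cuts_nonempty l').mono Set.subset_union_left)) h
  rw [poincare_mul_hcoef hB hC' hy] at hP
  obtain ⟨b, hb, -⟩ := Finset.exists_ne_zero_of_sum_ne_zero hP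
  rw [Finset.mem_filter, Set.Finite.mem_toFinset] at hb
  exact ⟨p', b * y, hC.mul_left hb.1, hb.2⟩

/-! ### The weights of the terms of a product -/

section Compare

variable {e : ℤ} {w : ExtWeyl d} (hBd : IsBidiagonal B e) (hB : IsKappa l (rot d ^ z) m B)
  (h : IsKappa l w p C) (h' : IsKappa m ((rot d ^ z)⁻¹ * w) p C')

omit [NeZero n] [NeZero d] in
theorem inv_rot_inv_mul_apply (w : ExtWeyl d) (z s : ℤ) :
    (((rot d ^ z)⁻¹ * w)⁻¹).1 s = (w⁻¹).1 (s + z) := by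
  rw [mul_inv_rev, inv_inv, mul_coe_apply, rot_zpow_apply]

include h' in
theorem entry_blk_ne_zero (t : ℤ) : C'.entry (blk m (t - z)) (blk p ((w⁻¹).1 t)) ≠ 0 := by
  rw [entry_ne_zero_iff h']
  exact ⟨t - z, rfl, by rw [inv_rot_inv_mul_apply, sub_add_cancel]⟩

include hBd hB h h' in
theorem entry_ne_zero_of_mul {i j : ℤ} (hij : C.entry i j ≠ 0) :
    C'.entry i j ≠ 0 ∨ C'.entry (i + e) j ≠ 0 := by
  obtain ⟨t, rfl, rfl⟩ := (entry_ne_zero_iff h i j).mp hij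
  have h1 := entry_blk_ne_zero h' t
  rcases hBd.blk_sub hB t with h2 | h2
  · rw [h2] at h1
    exact Or.inl h1
  · rw [h2] at h1
    exact Or.inr h1

include hBd hB h h' in
-- A position that `B` moves has signed distance `x` to the diagonal in `C` and `x - 1` in `C'`, so
-- it contributes `x² - (x - 1)² = 2x - 1`; all others contribute nothing.
theorem weight_eq_weight_add (he : e = 1 ∨ e = -1) : (weight C : ℤ) = weight C' +
    ∑ j ∈ Finset.range d, if blk m (1 + j - z) = blk l (1 + j) + e then
      2 * (e * (blk p ((w⁻¹).1 (1 + j)) - blk l (1 + j))) - 1 else 0 := by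
  have hs := sum_window d (fun s => (blk p ((((rot d ^ z)⁻¹ * w)⁻¹).1 s) - blk m s) ^ 2)
    fun s => by simp only [extWeyl_apply_add, blk_add, add_sub_add_right_eq_sub]
  rw [weight_eq h, weight_eq h', hs 1, ← hs (1 - z), ← Finset.sum_add_distrib]
  apply Finset.sum_congr rfl
  intro j _
  simp only [inv_rot_inv_mul_apply]
  rw [show 1 - z + (j : ℤ) + z = 1 + j by ring, show 1 - z + (j : ℤ) = 1 + j - z by ring]
  rcases hBd.blk_sub hB (1 + j) with h2 | h2
  · rw [h2, if_neg (by omega), add_zero]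
  · rw [h2, if_pos rfl]
    rcases he with rfl | rfl <;> ring

/-- The contribution of the moved positions to the weight, if all are on the outermost diagonal. -/
noncomputable def shiftWeight (l m : Comp n d) (z e k : ℤ) : ℤ :=
  ∑ j ∈ Finset.range d, if blk m (1 + j - z) = blk l (1 + j) + e then 2 * k - 1 else 0

variable {k : ℤ}

include hBd hB h h' in
theorem weight_eq_of_forall_iff (he : e = 1 ∨ e = -1)
    (hU : ∀ t, blk m (t - z) = blk l t + e ↔ blk p ((w⁻¹).1 t) = blk l t + e * k) :
    (weight C : ℤ) = weight C' + shiftWeight l m z e k := by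
  rw [weight_eq_weight_add hBd hB h h' he, shiftWeight]
  congr 1
  apply Finset.sum_congr rfl
  intro j _
  split_ifs with h1
  · rw [(hU _).mp h1, add_sub_cancel_left, ← mul_assoc]
    rcases he with rfl | rfl <;> ring
  · rfl

variable (hw : ∀ i j, C'.entry i j ≠ 0 → e * (j - i) ≤ k - 1)

include h' hw in
theorem mul_blk_sub_le (he : e = 1 ∨ e = -1) {t : ℤ} (ht : blk m (t - z) = blk l t + e) :
    e * (blk p ((w⁻¹).1 t) - blk l t) ≤ k := by
  have := hw _ _ (entry_blk_ne_zero h' t)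
  rw [ht] at this
  rcases he with rfl | rfl <;> omega

include hBd hB h h' hw in
theorem weight_le_weight_add (he : e = 1 ∨ e = -1) :
    (weight C : ℤ) ≤ weight C' + shiftWeight l m z e k := by
  rw [weight_eq_weight_add hBd hB h h' he, shiftWeight]
  gcongr with j
  split_ifs with h1
  · have := mul_blk_sub_le h' hw he h1
    omega
  · exact le_rfl

include hBd hB h h' hw in
-- Termwise domination with equal sums forces equality at every moved position, which then lies on
-- the diagonal at distance `k`. Conversely, an unmoved position on that diagonal would give `C'` an
-- entry beyond the bound `k - 1`.
theorem forall_iff_of_weight_eq (he : e = 1 ∨ e = -1)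
    (hwt : (weight C : ℤ) = weight C' + shiftWeight l m z e k) (t : ℤ) :
    blk m (t - z) = blk l t + e ↔ blk p ((w⁻¹).1 t) = blk l t + e * k := by
  have key : ∀ j ∈ Finset.range d, blk m (1 + j - z) = blk l (1 + j) + e →
      blk p ((w⁻¹).1 (1 + j)) = blk l (1 + j) + e * k := by
    rw [weight_eq_weight_add hBd hB h h' he, shiftWeight, add_right_inj,
      Finset.sum_eq_sum_iff_of_le] at hwt
    · intro j hj h1
      have := hwt j hj
      rw [if_pos h1, if_pos h1] at this
      rcases he with rfl | rfl <;> omega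
    · intro j _
      split_ifs with h1
      · have := mul_blk_sub_le h' hw he h1
        omega
      · exact le_rfl
  constructor
  · intro h1
    obtain ⟨j, q, rfl⟩ := exists_eq_natCast_add (n := d) t
    have h2 := key j (Finset.mem_range.mpr j.2)
    rw [show ((j : ℕ) : ℤ) + 1 + q * d = 1 + (j : ℕ) + q * d by ring] at h1 ⊢
    rw [show (1 : ℤ) + (j : ℕ) + q * d - z = 1 + (j : ℕ) - z + q * d by ring, blk_add_mul,
      blk_add_mul] at h1
    rw [apply_add_mul, blk_add_mul, blk_add_mul, h2 (by omega)]
    ring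
  · intro h1
    rcases hBd.blk_sub hB t with h2 | h2
    · have := hw _ _ (entry_blk_ne_zero h' t)
      rw [h1, h2] at this
      rcases he with rfl | rfl <;> omega
    · exact h2

end Compare

/-! ### Moving a diagonal -/

/-- If the moved positions are exactly those on the diagonal `c`, then the positions in row `i` of
the new matrix are the unmoved ones of row `i` and the moved ones of row `i - e`, which is how
`shiftDiag` is defined. -/
theorem isKappa_shiftDiag {w : ExtWeyl d} {c e : ℤ} {A : Theta n d} (h : IsKappa l w p A)
    (hU : ∀ t, blk m (t - z) = blk l t + e ↔ blk p ((w⁻¹).1 t) = blk l t + c)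
    (hU' : ∀ t, blk m (t - z) = blk l t ∨ blk m (t - z) = blk l t + e) (he : e ≠ 0) :
    IsKappa m ((rot d ^ z)⁻¹ * w) p (A.shiftDiag c e) := by
  rw [isKappa_iff] at h ⊢
  intro i j
  have e1 : {s | blk m s = i ∧ blk p ((((rot d ^ z)⁻¹ * w)⁻¹).1 s) = j}.ncard =
      {t | blk m (t - z) = i ∧ blk p ((w⁻¹).1 t) = j}.ncard := by
    rw [← Set.ncard_image_of_injective _ (add_left_injective z)]
    congr 1
    ext t
    simp only [Set.mem_image, Set.mem_ofPred_eq, inv_rot_inv_mul_apply]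
    constructor
    · rintro ⟨s, h1, rfl⟩
      rwa [add_sub_cancel_right]
    · intro h1
      exact ⟨t - z, by rwa [sub_add_cancel], by ring⟩
  have e2 : {t | blk m (t - z) = i ∧ blk p ((w⁻¹).1 t) = j} =
      {t | (blk l t = i ∧ blk p ((w⁻¹).1 t) = j) ∧ j ≠ i + c} ∪
      {t | (blk l t = i - e ∧ blk p ((w⁻¹).1 t) = j) ∧ j = i - e + c} := by
    ext t
    have h1 := hU t
    have h2 := hU' t
    simp only [Set.mem_union, Set.mem_ofPred_eq]
    omega
  rw [e1, e2, Set.ncard_union_eq ?_ ((finite_blk l i).subset fun t ht => ht.1.1)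
    ((finite_blk l (i - e)).subset fun t ht => ht.1.1)]
  · simp only [Theta.shiftDiag, Theta.diagPart]
    congr 1
    · by_cases hj : j = i + c
      · rw [if_pos hj, ← hj]
        simp [hj]
      · simp [hj, h]
    · by_cases hj : j = i - e + c
      · rw [if_pos hj, ← hj, h]
        simp [hj]
      · simp [hj]
  · rw [Set.disjoint_left]
    rintro t ⟨⟨h1, -⟩, -⟩ ⟨⟨h2, -⟩, -⟩
    omega

omit [NeZero n] [NeZero d] in
theorem eq_of_shiftDiag_eq {A C : Theta n d} {c e : ℤ} (h : A.shiftDiag c e = C.shiftDiag c e)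
    (hd : ∀ i, A.entry i (i + c) = C.entry i (i + c)) : A = C := by
  ext i j
  have h1 := congrFun (congrFun (congrArg Theta.entry h) i) j
  simp only [Theta.shiftDiag, Theta.diagPart, hd] at h1
  by_cases hj : j = i + c
  · rw [hj, hd]
  · rw [if_neg hj] at h1
    omega

omit [NeZero n] [NeZero d] in
theorem shiftDiag_entry_ne_zero {A : Theta n d} {c e i j : ℤ}
    (h : (A.shiftDiag c e).entry i j ≠ 0) :
    (A.entry i j ≠ 0 ∧ j ≠ i + c) ∨ (j = i - e + c ∧ A.entry (i - e) j ≠ 0) := by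
  simp only [Theta.shiftDiag, Theta.diagPart] at h
  by_cases hj : j = i - e + c
  · rw [if_pos hj, ← hj] at h
    by_cases hj' : j = i + c
    · rw [if_pos hj', ← hj'] at h
      exact Or.inr ⟨hj, by omega⟩
    · rw [if_neg hj'] at h
      by_cases h0 : A.entry i j = 0
      · exact Or.inr ⟨hj, by omega⟩
      · exact Or.inl ⟨h0, hj'⟩
  · rw [if_neg hj] at h
    by_cases hj' : j = i + c
    · rw [if_pos hj', ← hj'] at h
      omega
    · exact Or.inl ⟨by omega, hj'⟩

omit [NeZero n] [NeZero d] in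
theorem mul_sub_le_of_shiftDiag {A : Theta n d} {e k : ℤ} (he : e = 1 ∨ e = -1)
    (hA : ∀ i j, A.entry i j ≠ 0 → e * (j - i) ≤ k) {i j : ℤ}
    (h : (A.shiftDiag (e * k) e).entry i j ≠ 0) : e * (j - i) ≤ k - 1 := by
  rcases shiftDiag_entry_ne_zero h with ⟨h1, h2⟩ | ⟨h1, h2⟩
  · have := hA i j h1
    rcases he with rfl | rfl <;> omega
  · rcases he with rfl | rfl <;> omega

/-- The positions that a bidiagonal matrix moves are those on the outermost diagonal. -/
theorem blk_sub_eq_iff {A : Theta n d} {e k : ℤ} (he : e = 1 ∨ e = -1)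
    (hA : ∀ i j, A.entry i j ≠ 0 → e * (j - i) ≤ k) {y : ExtWeyl d} (hy : IsLeftMin (cuts l) y)
    (hk : IsKappa l y p A) (hB : IsKappa l (rot d ^ z) m (A.bidiag (e * k) e)) (t : ℤ) :
    blk m (t - z) = blk l t + e ↔ blk p ((y⁻¹).1 t) = blk l t + e * k := by
  have hBd := isBidiagonal_bidiag A (e * k) e
  obtain ⟨i, hi⟩ : ∃ i, blk l t = i := ⟨_, rfl⟩
  set s : Set ℤ := {t | blk l t = i ∧ blk m (t - z) = i + e} with hs
  set s' : Set ℤ := {t | blk l t = i ∧ blk p ((y⁻¹).1 t) = i + e * k} with hs'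
  have hcard : s.ncard = s'.ncard := by
    have h1 := isKappa_iff.mp hB i (i + e)
    rw [bidiag_entry A _ (by omega), isKappa_iff.mp hk] at h1
    simp only [rot_zpow_inv_apply] at h1
    exact h1.symm
  have hf : s.Finite := (finite_blk l i).subset fun t ht => ht.1
  have hf' : s'.Finite := (finite_blk l i).subset fun t ht => ht.1
  have hm : ∀ a b, blk l a = i → blk l b = i → a ≤ b →
      blk p ((y⁻¹).1 a) ≤ blk p ((y⁻¹).1 b) := by
    intro a b ha hb hab
    apply blk_mono
    rcases hab.eq_or_lt with rfl | hab
    · exact le_rfl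
    · refine (hy.lt hab ?_).le
      rintro _ ⟨q, rfl⟩
      rw [← not_le, le_blockStart_iff, le_blockStart_iff]
      omega
  have hb1 : ∀ a, blk l a = i → e * (blk p ((y⁻¹).1 a) - i) ≤ k := fun a ha =>
    hA _ _ ((entry_ne_zero_iff hk _ _).mpr ⟨a, ha, rfl⟩)
  -- Both sets are final segments of block `i` for `e = 1` and initial ones for `e = -1`: the first
  -- because the column index is monotone, the second because `y⁻¹` increases on the block and the
  -- diagonal is outermost. Such segments are nested, so equal size makes them equal.
  have hss : s = s' := by
    by_cases h1 : s ⊆ s'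
    · exact Set.eq_of_subset_of_ncard_le h1 hcard.ge hf'
    by_cases h2 : s' ⊆ s
    · exact (Set.eq_of_subset_of_ncard_le h2 hcard.le hf).symm
    exfalso
    obtain ⟨a, ⟨ha, ha1⟩, ha2⟩ := Set.not_subset.mp h1
    obtain ⟨b, ⟨hb, hb1'⟩, hb2⟩ := Set.not_subset.mp h2
    have ha3 : blk p ((y⁻¹).1 a) ≠ i + e * k := fun h => ha2 ⟨ha, h⟩
    have hb3 : blk m (b - z) ≠ i + e := fun h => hb2 ⟨hb, h⟩
    have hb4 := hBd.blk_sub hB b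
    have ha4 := hb1 a ha
    rcases le_total a b with hab | hab
    · have h3 := hm a b ha hb hab
      have h4 := blk_mono m (show a - z ≤ b - z by omega)
      rcases he with rfl | rfl <;> omega
    · have h3 := hm b a hb ha hab
      have h4 := blk_mono m (show b - z ≤ a - z by omega)
      rcases he with rfl | rfl <;> omega
  have := Set.ext_iff.mp hss t
  simp only [hs, hs', Set.mem_ofPred_eq, hi, true_and] at this
  rw [hi]
  exact this

/-! ### The leading term of a product with a bidiagonal factor. -/

section Leading

variable {A : Theta n d} {e k : ℤ} (he : e = 1 ∨ e = -1)
  (hA : ∀ i j, A.entry i j ≠ 0 → e * (j - i) ≤ k)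

include he hA in
theorem exists_leading : ∃ (l : Comp n d) (z : ℤ) (m p : Comp n d) (y : ExtWeyl d),
    IsKappa l (rot d ^ z) m (A.bidiag (e * k) e) ∧ IsLeftMin (cuts l) y ∧ IsKappa l y p A ∧
    IsKappa m ((rot d ^ z)⁻¹ * y) p (A.shiftDiag (e * k) e) ∧
    ∀ t, blk m (t - z) = blk l t + e ↔ blk p ((y⁻¹).1 t) = blk l t + e * k := by
  have hBd := isBidiagonal_bidiag A (e * k) e
  obtain ⟨l, y, p, hy, hk⟩ := exists_isLeftMin_isKappa A
  obtain ⟨l', z, m, hB⟩ := hBd.exists_isKappa_rot he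
  obtain rfl : l' = l := comp_ext fun i => by
    rw [← rowSum_eq_part hB, ← rowSum_eq_part hk, Theta.rowSum_bidiag]
  have hU := blk_sub_eq_iff he hA hy hk hB
  exact ⟨l', z, m, p, y, hB, hy, hk, isKappa_shiftDiag hk hU (hBd.blk_sub hB) (by omega), hU⟩

include he hA in
-- By `poincare_mul_hcoef` the coefficient times the Poincaré polynomial is a sum over certain `b`
-- in `W_l`. As `b y` and `y` give the same two matrices, the weights are extremal and both move
-- exactly their outermost entries. Hence `b` preserves the moved positions, which places it in `W_l
-- ∩ π^z W_m π^{-z}`. Conversely all of that group occurs, so the sum is the Poincaré polynomial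
-- itself.
theorem schurCoef_leading :
    schurCoef A (eElt (A.bidiag (e * k) e) * eElt (A.shiftDiag (e * k) e)) = 1 := by
  classical
  obtain ⟨l, z, m, p, y, hB, hy, hk, hk', hU⟩ := exists_leading he hA
  have hBd := isBidiagonal_bidiag A (e * k) e
  have hu := (periodicSet_cuts l).union ((periodicSet_cuts m).image_add z)
  have hne : (cuts l ∪ (fun s => s + z) '' cuts m).Nonempty :=
    (cuts_nonempty l).mono Set.subset_union_left
  have hwt := weight_eq_of_forall_iff hBd hB hk hk' he hU
  rw [schurCoef_apply hk]
  apply mul_left_cancel₀ (poincare_ne_zero hu hne)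
  rw [poincare_mul_hcoef hB hk' hy, mul_one, poincare_eq hu hne]
  congr 1
  ext b
  rw [Finset.mem_filter, Set.Finite.mem_toFinset, Set.Finite.mem_toFinset, SetLike.mem_coe,
    SetLike.mem_coe, stab_union, Subgroup.mem_inf]
  refine and_congr_right fun hb => ?_
  rw [mem_stab_image_add]
  constructor
  · intro h1
    have h2 := forall_iff_of_weight_eq hBd hB (hk.mul_left hb) h1
      (fun i j h => mul_sub_le_of_shiftDiag he hA h) he hwt
    rw [mem_stab_cuts]
    intro s
    rw [mul_coe_apply, mul_coe_apply, rot_zpow_inv_apply, rot_zpow_apply]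
    have h3 := h2 (b.1 (s + z))
    rw [mul_inv_rev, mul_coe_apply, inv_coe_apply_self, mem_stab_cuts.mp hb, ← hU,
      add_sub_cancel_right] at h3
    have h4 := hBd.blk_sub hB (b.1 (s + z))
    have h5 := hBd.blk_sub hB (s + z)
    rw [mem_stab_cuts.mp hb] at h4
    rw [add_sub_cancel_right] at h5
    omega
  · intro h1
    have := hk'.mul_left h1
    rwa [show (rot d ^ z)⁻¹ * b * rot d ^ z * ((rot d ^ z)⁻¹ * y) = (rot d ^ z)⁻¹ * (b * y) by
      group] at this

include he hA in
-- The gain `shiftWeight` depends only on `B` and is attained by `A`. A lighter `C'` therefore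
-- yields a lighter `C`, while for the shifted matrix itself equality of weights determines `C` from
-- its image under the shift and the diagonal recorded in `B`.
theorem eq_or_weight_lt (hC' : C' = A.shiftDiag (e * k) e ∨ weight C' < weight (A.shiftDiag (e * k) e))
    (hw : ∀ i j, C'.entry i j ≠ 0 → e * (j - i) ≤ k - 1)
    (h : schurCoef C (eElt (A.bidiag (e * k) e) * eElt C') ≠ 0) :
    (C = A ∧ C' = A.shiftDiag (e * k) e) ∨ weight C < weight A := by
  obtain ⟨l, z, m, p, y, hB, hy, hk, hk', hU⟩ := exists_leading he hA
  have hBd := isBidiagonal_bidiag A (e * k) e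
  have hwt := weight_eq_of_forall_iff hBd hB hk hk' he hU
  obtain ⟨q, w, h1, h2⟩ := exists_of_schurCoef_mul_ne_zero hB h
  have hle := weight_le_weight_add hBd hB h1 h2 hw he
  rcases hC' with rfl | hC'
  · by_cases hlt : weight C < weight A
    · exact Or.inr hlt
    refine Or.inl ⟨?_, rfl⟩
    have h3 := forall_iff_of_weight_eq hBd hB h1 h2 hw he (by omega)
    have h4 := isKappa_shiftDiag h1 h3 (hBd.blk_sub hB) (by omega)
    refine eq_of_shiftDiag_eq (theta_eq_of_isKappa h4 h2) fun i => ?_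
    rw [← bidiag_entry A (e * k) (show e ≠ 0 by omega), isKappa_iff.mp h1, isKappa_iff.mp hB]
    congr 1
    ext t
    simp only [Set.mem_ofPred_eq, rot_zpow_inv_apply]
    refine and_congr_right ?_
    rintro rfl
    exact (h3 t).symm
  · exact Or.inr (by omega)

include he in
theorem exists_entry_ne_zero_of_mul (h : schurCoef C (eElt (A.bidiag (e * k) e) * eElt C') ≠ 0)
    {i j : ℤ} (hij : C.entry i j ≠ 0) : C'.entry i j ≠ 0 ∨ C'.entry (i + e) j ≠ 0 := by
  have hBd := isBidiagonal_bidiag A (e * k) e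
  obtain ⟨l, z, m, hB⟩ := hBd.exists_isKappa_rot he
  obtain ⟨q, w, h1, h2⟩ := exists_of_schurCoef_mul_ne_zero hB h
  exact entry_ne_zero_of_mul hBd hB h1 h2 hij

end Leading

/-! ### Leading terms -/

/-- The expansion of `F` in the basis `e_C` has leading term `e_A`, up to a unit, and only involves
matrices whose nonzero diagonals satisfy `P`. -/
def HasLeading (F : Schur n d) (A : Theta n d) (P : ℤ → Prop) : Prop :=
  IsUnit (schurCoef A F) ∧ ∀ C, schurCoef C F ≠ 0 →
    (C = A ∨ weight C < weight A) ∧ ∀ i j, C.entry i j ≠ 0 → P (j - i)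

theorem schurCoef_std_mul (B C : Theta n d) (F : Schur n d) :
    schurCoef C (std B * F) = vpow (-(dStat B : ℤ)) *
      ∑ C' ∈ (finite_schurCoef F).toFinset, schurCoef C' F * schurCoef C (eElt B * eElt C') := by
  have hF : F = ∑ C' ∈ (finite_schurCoef F).toFinset, schurCoef C' F • eElt C' := by
    classical
    apply schur_ext_coef
    intro A
    rw [map_sum]
    simp only [map_smul, schurCoef_eElt, smul_eq_mul, mul_ite, mul_one, mul_zero]
    rw [Finset.sum_ite_eq']
    split_ifs with h
    · rfl
    · simpa using h
  rw [std, smul_mul_assoc, map_smul, smul_eq_mul]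
  congr 1
  conv_lhs => rw [hF]
  rw [Finset.mul_sum, map_sum]
  apply Finset.sum_congr rfl
  intro C' _
  rw [mul_smul_comm, map_smul, smul_eq_mul]

theorem hasLeading_std {A : Theta n d} {P : ℤ → Prop} (h : ∀ i j, A.entry i j ≠ 0 → P (j - i)) :
    HasLeading (std A) A P := by
  classical
  have e : ∀ C, schurCoef C (std A) = vpow (-(dStat A : ℤ)) * if A = C then 1 else 0 := fun C => by
    rw [std, map_smul, schurCoef_eElt, smul_eq_mul]
  refine ⟨?_, fun C hC => ?_⟩
  · rw [e, if_pos rfl, mul_one]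
    exact isUnit_vpow _
  · rw [e] at hC
    by_cases hAC : A = C
    · subst hAC
      exact ⟨Or.inl rfl, h⟩
    · rw [if_neg hAC, mul_zero] at hC
      exact absurd rfl hC

/-- The predicate `P` bounds the diagonals of every term of `F`, not only the leading one, because
the comparison of weights needs the bound `k - 1` for each `C'`. A moved entry passes from diagonal
`x` to `x + e`, which explains `Q`. -/
theorem HasLeading.std_mul {A : Theta n d} {F : Schur n d} {e k c : ℤ} {P Q : ℤ → Prop}
    (he : e = 1 ∨ e = -1) (hc : c = e * k) (hA : ∀ i j, A.entry i j ≠ 0 → e * (j - i) ≤ k)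
    (hF : HasLeading F (A.shiftDiag c e) P) (hP : ∀ x, P x → e * x ≤ k - 1)
    (hPQ : ∀ x, P x → Q x ∧ Q (x + e)) : HasLeading (std (A.bidiag c e) * F) A Q := by
  subst hc
  obtain ⟨hu, hF⟩ := hF
  refine ⟨?_, fun C hC => ?_⟩
  · rw [schurCoef_std_mul, Finset.sum_eq_single (A.shiftDiag (e * k) e), schurCoef_leading he hA,
      mul_one]
    · exact (isUnit_vpow _).mul hu
    · intro C' hC' hne
      rw [Set.Finite.mem_toFinset] at hC'
      obtain ⟨h1, h2⟩ := hF C' hC'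
      by_contra h0
      have := eq_or_weight_lt he hA h1 (fun i j hij => hP _ (h2 i j hij)) (right_ne_zero_of_mul h0)
      rcases this with h | h
      · exact hne h.2
      · exact lt_irrefl _ h
    · intro h0
      rw [Set.Finite.mem_toFinset] at h0
      exact absurd hu.ne_zero h0
  · rw [schurCoef_std_mul] at hC
    obtain ⟨C', hC', h0⟩ := Finset.exists_ne_zero_of_sum_ne_zero (right_ne_zero_of_mul hC)
    rw [Set.Finite.mem_toFinset] at hC'
    obtain ⟨h1, h2⟩ := hF C' hC'
    have h3 := right_ne_zero_of_mul h0
    refine ⟨(eq_or_weight_lt he hA h1 (fun i j hij => hP _ (h2 i j hij)) h3).imp_left And.left,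
      fun i j hij => ?_⟩
    rcases exists_entry_ne_zero_of_mul he h3 hij with h4 | h4
    · exact (hPQ _ (h2 i j h4)).1
    · have := (hPQ _ (h2 _ j h4)).2
      rwa [show j - (i + e) + e = j - i by ring] at this

end Product

end AffineSchur
namespace AffineSchur

/-! ### The monomial basis -/

section Monomial

variable {n d : ℕ} [NeZero n]

theorem isBidiagonal_of_lowerWidth_le {L : Theta n d} (hL : ∀ i j, L.entry i j ≠ 0 → j - i ≤ 0)
    (h : L.lowerWidth ≤ 1) : IsBidiagonal L (-1) := by
  intro i j hij
  have h1 := hL i j hij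
  have h2 := L.le_lowerWidth i j hij
  omega

omit [NeZero n] in
theorem shiftDiag_lowerWidth_sub_nonpos {L : Theta n d}
    (hL : ∀ i j, L.entry i j ≠ 0 → j - i ≤ 0) (h : ¬ L.lowerWidth ≤ 1) (i j : ℤ)
    (hij : (L.shiftDiag (-L.lowerWidth) (-1)).entry i j ≠ 0) : j - i ≤ 0 := by
  rcases shiftDiag_entry_ne_zero hij with ⟨h1, -⟩ | ⟨h1, -⟩
  · exact hL i j h1
  · omega

theorem sub_nonpos_of_upperWidth_eq_zero {U : Theta n d} (h : U.upperWidth = 0) (i j : ℤ)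
    (hij : U.entry i j ≠ 0) : j - i ≤ 0 := by
  have := U.le_upperWidth i j hij
  omega

theorem isBidiagonal_of_mem_lowerFactors (L : Theta n d) (hL : ∀ i j, L.entry i j ≠ 0 → j - i ≤ 0)
    (B : Theta n d) (hB : B ∈ L.lowerFactors) : IsBidiagonal B (-1) := by
  obtain ⟨k, hk⟩ : ∃ k, L.lowerWidth = k := ⟨_, rfl⟩
  induction k using Nat.strong_induction_on generalizing L with
  | _ k ih =>
    rw [Theta.lowerFactors] at hB
    split_ifs at hB with h
    · rw [List.mem_singleton.mp hB]
      exact isBidiagonal_of_lowerWidth_le hL h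
    · rcases List.mem_cons.mp hB with rfl | hB
      · exact isBidiagonal_bidiag _ _ _
      · exact ih _ (hk ▸ L.lowerWidth_shiftDiag_lt (by omega)) _
          (shiftDiag_lowerWidth_sub_nonpos hL h) hB rfl

theorem isBidiagonal_of_mem_monomialFactors (U B : Theta n d) (hB : B ∈ U.monomialFactors) :
    IsBidiagonal B 1 ∨ IsBidiagonal B (-1) := by
  obtain ⟨k, hk⟩ : ∃ k, U.upperWidth = k := ⟨_, rfl⟩
  induction k using Nat.strong_induction_on generalizing U with
  | _ k ih =>
    rw [Theta.monomialFactors] at hB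
    split_ifs at hB with h
    · exact Or.inr (isBidiagonal_of_mem_lowerFactors U (sub_nonpos_of_upperWidth_eq_zero h) B hB)
    · rcases List.mem_cons.mp hB with rfl | hB
      · exact Or.inl (isBidiagonal_bidiag _ _ _)
      · exact ih _ (hk ▸ U.upperWidth_shiftDiag_lt h) _ hB rfl

variable [NeZero d]

theorem isBar_monomial (A : Theta n d) : IsBar (monomial A) (monomial A) := by
  have key : ∀ L : List (Theta n d), (∀ B ∈ L, IsBidiagonal B 1 ∨ IsBidiagonal B (-1)) →
      IsBar (L.map std).prod (L.map std).prod := by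
    intro L
    induction L with
    | nil => exact fun _ => isBar_one
    | cons B L ih =>
      intro h
      rw [List.map_cons, List.prod_cons]
      refine IsBar.mul ?_ (ih fun C hC => h C (List.mem_cons_of_mem _ hC))
      rcases h B List.mem_cons_self with h | h
      · exact h.isBar_std (Or.inl rfl)
      · exact h.isBar_std (Or.inr rfl)
  exact key _ (isBidiagonal_of_mem_monomialFactors A)

/-- The bound `x ≤ 0` must be carried through the induction: it makes the remaining product an
admissible start for the upper factors. The lower bound gives the room of one diagonal that each
further lower factor uses. -/
theorem hasLeading_lowerFactors (L : Theta n d) (hL : ∀ i j, L.entry i j ≠ 0 → j - i ≤ 0) :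
    HasLeading (L.lowerFactors.map std).prod L fun x => x ≤ 0 ∧ -x ≤ L.lowerWidth := by
  obtain ⟨k, hk⟩ : ∃ k, L.lowerWidth = k := ⟨_, rfl⟩
  induction k using Nat.strong_induction_on generalizing L with
  | _ k ih =>
    have hw : ∀ i j, L.entry i j ≠ 0 → -1 * (j - i) ≤ L.lowerWidth := fun i j hij => by
      have := L.le_lowerWidth i j hij
      omega
    rw [Theta.lowerFactors]
    split_ifs with h
    · rw [List.map_singleton, List.prod_singleton]
      exact hasLeading_std fun i j hij => ⟨hL i j hij, by have := hw i j hij; omega⟩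
    · have hlt := L.lowerWidth_shiftDiag_lt (by omega)
      rw [List.map_cons, List.prod_cons]
      refine (ih _ (hk ▸ hlt) _ (shiftDiag_lowerWidth_sub_nonpos hL h) rfl).std_mul (Or.inr rfl)
        (neg_one_mul _).symm hw (fun x hx => ?_) fun x hx => ?_
      · omega
      · refine ⟨⟨?_, ?_⟩, ?_, ?_⟩ <;> omega

theorem hasLeading_monomialFactors (U : Theta n d) :
    HasLeading (U.monomialFactors.map std).prod U fun x => x ≤ U.upperWidth := by
  obtain ⟨k, hk⟩ : ∃ k, U.upperWidth = k := ⟨_, rfl⟩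
  induction k using Nat.strong_induction_on generalizing U with
  | _ k ih =>
    rw [Theta.monomialFactors]
    split_ifs with h
    · obtain ⟨h1, h2⟩ := hasLeading_lowerFactors U (sub_nonpos_of_upperWidth_eq_zero h)
      refine ⟨h1, fun C hC => ⟨(h2 C hC).1, fun i j hij => ?_⟩⟩
      have := (h2 C hC).2 i j hij
      omega
    · have hlt := U.upperWidth_shiftDiag_lt h
      rw [List.map_cons, List.prod_cons]
      refine (ih _ (hk ▸ hlt) _ rfl).std_mul (Or.inl rfl) (one_mul _).symm
        (fun i j hij => ?_) (fun x hx => ?_) fun x hx => ?_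
      · have := U.le_upperWidth i j hij
        omega
      · omega
      · constructor <;> omega

end Monomial

end AffineSchur

theorem corollary3p5 (n d : ℕ) [NeZero n] [NeZero d] :
    (∃ b : Module.Basis (AffineSchur.Theta n d) (LaurentPolynomial ℤ) (AffineSchur.Schur n d),
      ∀ A : AffineSchur.Theta n d, b A = AffineSchur.monomial A) ∧
    ∀ A : AffineSchur.Theta n d,
      AffineSchur.bar (AffineSchur.monomial A) = AffineSchur.monomial A := by
  refine ⟨?_, fun A => (AffineSchur.isBar_monomial A).bar_eq⟩
  obtain ⟨b, -, hb⟩ := AffineSchur.exists_basis_eElt (n := n) (d := d)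
  -- The coordinates in the basis `e_A` are the functionals `schurCoef`, so the leading term
  -- statement is precisely the required triangularity.
  refine AffineSchur.exists_basis_of_coord_triangular b AffineSchur.monomial AffineSchur.weight
    (fun A => ?_) fun A C hC => ?_
  · rw [hb]
    exact (AffineSchur.hasLeading_monomialFactors A).1
  · rw [hb] at hC
    exact ((AffineSchur.hasLeading_monomialFactors A).2 C hC).1
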